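/- Let $M$ be a compact $W^{2,\infty}$ manifold with (possibly empty) boundary, of dimension $d\ge 1$: a compact Hausdorff space with an atlas of charts onto open subsets of the closed half-space of $\mathbb R^d$ whose changes of charts are, up to the boundary, $C^1$ with locally Lipschitz derivative. Let $g$ be a Riemannian metric and $\kappa$ a positive density on $M$, both with locally Lipschitz coefficients in the charts (under changes of charts, $\kappa$ is multiplied by the absolute value of the Jacobian determinant), and let $\Delta=\frac1\kappa\,\mathrm{div}\,g^{-1}\kappa\nabla$. Let $\widetilde M=(M\times\{-1,1\})/{\sim}$ be the double of $M$, where $(x,1)\sim(x,-1)$ for $x\in\partial M$, with the quotient topology, and let $i^{\pm}:M\to\widetilde M$, $i^\pm(x)=(x,\pm1)$. Then $\widetilde M$ is Hausdorff, and there exist on $\widetilde M$ a $W^{2,\infty}$ manifold structure without boundary (charts into $\mathbb R^d$ whose changes of charts are $C^1$ with locally Lipschitz derivative), a Riemannian metric $\widetilde g$ and a positive density $\widetilde\kappa$, both with locally Lipschitz coefficients, such that: 1. $i^+$ and $i^-$ are isometric embeddings of $(M,g)$ into $(\widetilde M,\widetilde g)$, i.e. topological embeddings of class $C^1\cap W^{2,\infty}$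 up to the boundary with $(i^\pm)^*\widetilde g=g$. 2. $(i^\pm)^*\widetilde\kappa=\kappa$. 3. If $\lambda\in\mathbb R$ and $e:M\to\mathbb R$ is an eigenfunction of $-\Delta$ with eigenvalue $\lambda^2$ and Dirichlet boundary condition, then there is an eigenfunction $\widetilde e$ of $-\widetilde\Delta=-\frac1{\widetilde\kappa}\mathrm{div}\,\widetilde g^{-1}\widetilde\kappa\nabla$ on $\widetilde M$ with the same eigenvalue $\lambda^2$ such that $\widetilde e(x,1)=e(x)$ for all $x\in M$ and $\widetilde e(x,-1)=-e(x)$ for all $x\in M\setminus\partial M$ (hence also at every $x\in\partial M$ with $e(x)=0$). 4. If $\lambda\in\mathbb R$ and $e:M\to\mathbb R$ is an eigenfunction of $-\Delta$ with eigenvalue $\lambda^2$ and Neumann boundary condition, then there is an eigenfunction $\widetilde e$ of $-\widetilde\Delta$ on $\widetilde M$ with the same eigenvalue $\lambda^2$ such that $\widetilde e(x,1)=\widetilde e(x,-1)=e(x)$ for all $x\in M$. Here a Dirichlet (resp. Neumann) eigenfunction with eigenvalue $\mu$ is a function $e\in H^1_0(M)$ (resp. $e\in H^1(M)$), not almost everywhere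 zero, such that $\int_M g^{-1}(\nabla e,\nabla v)\,\kappa=\mu\int_M e\,v\,\kappa$ for all $C^1$ functions $v$ supported in $M\setminus\partial M$ (resp. all $C^1$ functions $v$ on $M$); an eigenfunction on the manifold without boundary $\widetilde M$ is an $\widetilde e\in H^1(\widetilde M)$, not almost everywhere zero, satisfying the analogous identity for all $C^1$ functions $v$ on $\widetilde M$. -/

import Mathlib

open Set Filter Topology MeasureTheory
open scoped Manifold ContDiff Matrix

noncomputable section

/-- The Euclidean space `ℝ^d`. -/
abbrev Euc (d : ℕ) : Type := EuclideanSpace ℝ (Fin d)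

/-! ### Calculus in coordinates

`s` is an open subset of `ℝ^d` or of a closed half-space; derivatives on `s` are up to the
boundary (`fderivWithin`). -/

/-- `f` is of class `C^1 ∩ W^{2,∞}` on `s`: it is `C^1` and its derivative is locally Lipschitz. -/
def IsW2InftyOn {d : ℕ} (f : Euc d → Euc d) (s : Set (Euc d)) : Prop :=
  ContDiffOn ℝ 1 f s ∧ LocallyLipschitzOn s (fderivWithin ℝ f s)

/-- The Jacobian matrix `(∂_j f_i)` of `f` on `s`. -/
def jacobian {d : ℕ} (f : Euc d → Euc d) (s : Set (Euc d)) (y : Euc d) :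
    Matrix (Fin d) (Fin d) ℝ :=
  Matrix.of fun i j => fderivWithin ℝ f s y (EuclideanSpace.single j 1) i

/-- The gradient `(∂_i f)` of a scalar function on `s`. -/
def grad {d : ℕ} (f : Euc d → ℝ) (s : Set (Euc d)) (y : Euc d) : Fin d → ℝ :=
  fun i => fderivWithin ℝ f s y (EuclideanSpace.single i 1)

/-- `f ∈ L²(K)` for all compact `K ⊆ s` (the compact sets may touch the boundary points
belonging to `s`). -/
def IsLocL2 {d : ℕ} (s : Set (Euc d)) (f : Euc d → ℝ) : Prop :=
  ∀ K ⊆ s, IsCompact K → MemLp f 2 (volume.restrict K)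

/-- `w` is the gradient of `u` in the sense of distributions in the interior of `s`. -/
def IsWeakGradient {d : ℕ} (s : Set (Euc d)) (u : Euc d → ℝ) (w : Euc d → Fin d → ℝ) : Prop :=
  ∀ ζ : Euc d → ℝ, ContDiff ℝ ∞ ζ → HasCompactSupport ζ → tsupport ζ ⊆ interior s →
    ∀ i, ∫ y in s, u y * fderiv ℝ ζ y (EuclideanSpace.single i 1) = -∫ y in s, w y i * ζ y

/-! ### `W^{2,∞}` manifolds, Lipschitz metrics and densities -/

section Manifolds

variable {d : ℕ} {H : Type*} [TopologicalSpace H] (I : ModelWithCorners ℝ (Euc d) H)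
  {M : Type*} [TopologicalSpace M]

/-- The part of the image of the chart `φ` of `M` on which `f : M → N` can be read in the chart `ψ`
of `N`. -/
def readDomain {N : Type*} [TopologicalSpace N] {H' : Type*} [TopologicalSpace H']
    (f : M → N) (φ : OpenPartialHomeomorph M H) (ψ : OpenPartialHomeomorph N H') :
    Set (Euc d) :=
  (φ.extend I).target ∩ (φ.extend I).symm ⁻¹' (f ⁻¹' ψ.source)

/-- The map `f : M → N` read in the charts `φ` and `ψ`. -/
def readMap {N : Type*} [TopologicalSpace N] {H' : Type*} [TopologicalSpace H']
    (I' : ModelWithCorners ℝ (Euc d) H')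
    (f : M → N) (φ : OpenPartialHomeomorph M H) (ψ : OpenPartialHomeomorph N H') :
    Euc d → Euc d :=
  ψ.extend I' ∘ f ∘ (φ.extend I).symm

/-- The Jacobian matrix of `f : M → N` read in the charts `φ` and `ψ`. -/
def readJacobian {N : Type*} [TopologicalSpace N] {H' : Type*} [TopologicalSpace H']
    (I' : ModelWithCorners ℝ (Euc d) H')
    (f : M → N) (φ : OpenPartialHomeomorph M H) (ψ : OpenPartialHomeomorph N H') (y : Euc d) :
    Matrix (Fin d) (Fin d) ℝ :=
  jacobian (readMap I I' f φ ψ) (readDomain I f φ ψ) y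

variable (M) [ChartedSpace H M]

/-- The atlas of `M` is a `W^{2,∞}` atlas: all changes of charts are `C^1 ∩ W^{2,∞}` (up to the
boundary, if there is one). -/
class IsW2InftyManifold : Prop where
  change_of_charts : ∀ φ ∈ atlas H M, ∀ ψ ∈ atlas H M,
    IsW2InftyOn (readMap I I (id : M → M) φ ψ) (readDomain I (id : M → M) φ ψ)

/-- A Riemannian metric of class `W^{1,∞}`: in every chart a positive definite matrix with locally
Lipschitz entries, these matrices being related by the transformation law of a metric. -/
structure LipschitzMetric where
  coeff : OpenPartialHomeomorph M H → Euc d → Matrix (Fin d) (Fin d) ℝ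
  posDef : ∀ φ ∈ atlas H M, ∀ y ∈ (φ.extend I).target, (coeff φ y).PosDef
  lipschitz : ∀ φ ∈ atlas H M, ∀ i j,
    LocallyLipschitzOn (φ.extend I).target (fun y => coeff φ y i j)
  compat : ∀ φ ∈ atlas H M, ∀ ψ ∈ atlas H M, ∀ y ∈ readDomain I (id : M → M) φ ψ,
    coeff φ y = (readJacobian I I (id : M → M) φ ψ y)ᵀ *
      coeff ψ (readMap I I (id : M → M) φ ψ y) * readJacobian I I (id : M → M) φ ψ y

/-- A positive density of class `W^{1,∞}`: in every chart a positive locally Lipschitz function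
`κ` (the density being `κ dy`), these functions being related by the transformation law of a
density. -/
structure LipschitzDensity where
  coeff : OpenPartialHomeomorph M H → Euc d → ℝ
  pos : ∀ φ ∈ atlas H M, ∀ y ∈ (φ.extend I).target, 0 < coeff φ y
  lipschitz : ∀ φ ∈ atlas H M, LocallyLipschitzOn (φ.extend I).target (coeff φ)
  compat : ∀ φ ∈ atlas H M, ∀ ψ ∈ atlas H M, ∀ y ∈ readDomain I (id : M → M) φ ψ,
    coeff φ y = |(readJacobian I I (id : M → M) φ ψ y).det| *
      coeff ψ (readMap I I (id : M → M) φ ψ y)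

variable {I M}

/-- `f : M → N` is an isometric embedding between manifolds of dimension `d`: a topological
embedding, of class `C^1 ∩ W^{2,∞}`, with `f^* g' = g` (so that `f` is an immersion). -/
structure IsIsometricEmbedding {N : Type*} [TopologicalSpace N] {H' : Type*} [TopologicalSpace H']
    {I' : ModelWithCorners ℝ (Euc d) H'} [ChartedSpace H' N]
    (g : LipschitzMetric I M) (g' : LipschitzMetric I' N) (f : M → N) : Prop where
  isEmbedding : IsEmbedding f
  regular : ∀ φ ∈ atlas H M, ∀ ψ ∈ atlas H' N,
    IsW2InftyOn (readMap I I' f φ ψ) (readDomain I f φ ψ)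
  pullback : ∀ φ ∈ atlas H M, ∀ ψ ∈ atlas H' N, ∀ y ∈ readDomain I f φ ψ,
    g.coeff φ y = (readJacobian I I' f φ ψ y)ᵀ *
      g'.coeff ψ (readMap I I' f φ ψ y) * readJacobian I I' f φ ψ y

/-- The density `κ` is induced by the density `κ'` through `f`, that is, `f^* κ' = κ`. -/
def IsInducedDensity {N : Type*} [TopologicalSpace N] {H' : Type*} [TopologicalSpace H']
    {I' : ModelWithCorners ℝ (Euc d) H'} [ChartedSpace H' N]
    (κ : LipschitzDensity I M) (κ' : LipschitzDensity I' N) (f : M → N) : Prop :=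
  ∀ φ ∈ atlas H M, ∀ ψ ∈ atlas H' N, ∀ y ∈ readDomain I f φ ψ,
    κ.coeff φ y = |(readJacobian I I' f φ ψ y).det| * κ'.coeff ψ (readMap I I' f φ ψ y)

/-! ### Sobolev spaces and eigenfunctions

All of this is used on compact manifolds only, so that square integrability on `M` is square
integrability on the compact subsets of the images of the charts. -/

variable (I)

/-- `u ∈ H¹(M)`, with weak gradient `w φ` in the chart `φ`. -/
structure IsH1 (u : M → ℝ) (w : OpenPartialHomeomorph M H → Euc d → Fin d → ℝ) : Prop where
  memL2 : ∀ φ ∈ atlas H M, IsLocL2 (φ.extend I).target (u ∘ (φ.extend I).symm)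
  grad_memL2 : ∀ φ ∈ atlas H M, ∀ i, IsLocL2 (φ.extend I).target (fun y => w φ y i)
  weakGradient : ∀ φ ∈ atlas H M,
    IsWeakGradient (φ.extend I).target (u ∘ (φ.extend I).symm) (w φ)

/-- `u`, with weak gradient `w`, lies in `H¹₀(M)` (zero trace on the boundary): it is the limit in
`H¹(M)` of `C^1` functions supported in the interior of the manifold. -/
def IsH10 (u : M → ℝ) (w : OpenPartialHomeomorph M H → Euc d → Fin d → ℝ) : Prop :=
  IsH1 I u w ∧
  ∃ v : ℕ → M → ℝ,
    (∀ n, ContMDiff I 𝓘(ℝ, ℝ) 1 (v n) ∧ tsupport (v n) ⊆ I.interior M) ∧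
    ∀ φ ∈ atlas H M, ∀ K ⊆ (φ.extend I).target, IsCompact K →
      Tendsto (fun n => eLpNorm (fun y => v n ((φ.extend I).symm y) - u ((φ.extend I).symm y)) 2
        (volume.restrict K)) atTop (𝓝 0) ∧
      ∀ i, Tendsto (fun n => eLpNorm
        (fun y => grad (v n ∘ (φ.extend I).symm) (φ.extend I).target y i - w φ y i) 2
        (volume.restrict K)) atTop (𝓝 0)

/-- `u` is not almost everywhere zero on `M`. -/
def IsNonzeroAE (u : M → ℝ) : Prop :=
  ∃ φ ∈ atlas H M, ¬ ∀ᵐ y ∂(volume.restrict (φ.extend I).target), u ((φ.extend I).symm y) = 0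

variable {I}

/-- `∫ g⁻¹(∇u, ∇v) κ = μ ∫ u v κ` for a function `u` with weak gradient `w` and a test function `v`
supported in the domain of the chart `φ`; the integrals are computed in this chart. -/
def WeakEigenEquation (g : LipschitzMetric I M) (κ : LipschitzDensity I M) (μ : ℝ) (u : M → ℝ)
    (w : OpenPartialHomeomorph M H → Euc d → Fin d → ℝ)
    (φ : OpenPartialHomeomorph M H) (v : M → ℝ) : Prop :=
  ∫ y in (φ.extend I).target,
      (((g.coeff φ y)⁻¹ *ᵥ w φ y) ⬝ᵥ grad (v ∘ (φ.extend I).symm) (φ.extend I).target y) *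
        κ.coeff φ y =
    μ * ∫ y in (φ.extend I).target,
      u ((φ.extend I).symm y) * v ((φ.extend I).symm y) * κ.coeff φ y

/-- `u` is an eigenfunction, with eigenvalue `μ`, of `-Δ = -(1/κ) div g⁻¹ κ ∇` with Dirichlet
condition: `u ∈ H¹₀(M)`, `u ≠ 0`, and `-Δ u = μ u` weakly, tested against `C^1` functions supported
in the interior (and in a chart, which is no restriction, by partition of unity). -/
def IsDirichletEigenfunction (g : LipschitzMetric I M) (κ : LipschitzDensity I M) (μ : ℝ)
    (u : M → ℝ) : Prop :=
  IsNonzeroAE I u ∧ ∃ w, IsH10 I u w ∧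
    ∀ φ ∈ atlas H M, ∀ v : M → ℝ, ContMDiff I 𝓘(ℝ, ℝ) 1 v → tsupport v ⊆ φ.source →
      tsupport v ⊆ I.interior M → WeakEigenEquation g κ μ u w φ v

/-- `u` is an eigenfunction, with eigenvalue `μ`, of `-Δ = -(1/κ) div g⁻¹ κ ∇` with Neumann
condition: `u ∈ H¹(M)`, `u ≠ 0`, and `-Δ u = μ u` weakly, tested against all `C^1` functions
(supported in a chart, but not necessarily vanishing at the boundary, which encodes `∂_ν u = 0`). -/
def IsNeumannEigenfunction (g : LipschitzMetric I M) (κ : LipschitzDensity I M) (μ : ℝ)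
    (u : M → ℝ) : Prop :=
  IsNonzeroAE I u ∧ ∃ w, IsH1 I u w ∧
    ∀ φ ∈ atlas H M, ∀ v : M → ℝ, ContMDiff I 𝓘(ℝ, ℝ) 1 v → tsupport v ⊆ φ.source →
      WeakEigenEquation g κ μ u w φ v

end Manifolds

/-- Eigenfunctions of `-Δ = -(1/κ) div g⁻¹ κ ∇` on a manifold without boundary (no boundary
condition, so all `C^1` test functions are allowed). -/
def IsEigenfunction {d : ℕ} {N : Type*} [TopologicalSpace N] [ChartedSpace (Euc d) N]
    (g : LipschitzMetric (𝓡 d) N) (κ : LipschitzDensity (𝓡 d) N) (μ : ℝ) (u : N → ℝ) : Prop :=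
  IsNonzeroAE (𝓡 d) u ∧ ∃ w, IsH1 (𝓡 d) u w ∧
    ∀ φ ∈ atlas (Euc d) N, ∀ v : N → ℝ, ContMDiff (𝓡 d) 𝓘(ℝ, ℝ) 1 v → tsupport v ⊆ φ.source →
      WeakEigenEquation g κ μ u w φ v

/-! ### The double -/

section Double

variable (d : ℕ) [NeZero d] (M : Type*) [TopologicalSpace M]
  [ChartedSpace (EuclideanHalfSpace d) M]

/-- The relation on `M × {1, -1}` identifying `(x, 1)` and `(x, -1)` for `x ∈ ∂M`. -/
def doubleSetoid : Setoid (M × ℤˣ) where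
  r p q := p.1 = q.1 ∧ (p.2 = q.2 ∨ p.1 ∈ (𝓡∂ d).boundary M)
  iseqv :=
    { refl := fun _ => ⟨rfl, Or.inl rfl⟩
      symm := fun h => ⟨h.1.symm, h.2.elim (fun h' => Or.inl h'.symm) (fun h' => Or.inr (h.1 ▸ h'))⟩
      trans := fun h k => ⟨h.1.trans k.1, h.2.elim
        (fun h' => k.2.elim (fun k' => Or.inl (h'.trans k')) (fun k' => Or.inr (h.1.symm ▸ k')))
        (fun h' => Or.inr h')⟩ }

/-- The double of `M`: two copies of `M` glued along the boundary. -/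
def Double : Type _ := Quotient (doubleSetoid d M)

/-- The double carries the quotient topology. -/
instance : TopologicalSpace (Double d M) :=
  inferInstanceAs (TopologicalSpace (Quotient (doubleSetoid d M)))

variable {M}

/-- The inclusion `x ↦ (x, ε)` of the copy of `M` with sign `ε = ±1` in the double. -/
def Double.incl (ε : ℤˣ) (x : M) : Double d M := Quotient.mk (doubleSetoid d M) (x, ε)

end Double

end

/-! ### Locally Lipschitz functions -/

section LocallyLipschitz

/-! Reflecting the charts of M in the hyperplane `y 0 = 0` gives candidate charts of the double. A
change of charts θ of M becomes the map equal to θ above the hyperplane and to its conjugate by the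
reflection R below (`doubleMap`). The two halves match to first order when, on the hyperplane, Dθ
commutes with R, that is, when normal and tangential directions do not mix. This fails for arbitrary
charts, but it holds between charts in which the direction e₀ is g-orthogonal to the boundary: Dθ
preserves the tangent space of the boundary and, being an isometry, also its orthogonal complement
(`reflMatrix_mul_mul_eq_self`).

Such charts must be found without losing regularity. Since g is only Lipschitz, moving straight
along its normal field would in general give coordinates that are only Lipschitz. Instead an atlas
chart is composed with x ↦ x + ∑_{j ≠ 0} F_j(x) e_j, where F_j vanishes on the hyperplane and has
there the normal derivative b_j that tilts e₀ into the normal direction. F_j(x) is x₀ times the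
average of b_j around x at scale x₀: derivatives of b_j can be moved onto the averaging kernel at
the price of a factor 1/x₀, which the factor x₀ absorbs. So F_j is C^{1,1} although b_j is only
Lipschitz (`exists_normal_deriv_eq`, `exists_normal_coordinates`). In these charts the entries
g_{0j}, j ≠ 0, vanish on the boundary. The reflected metric changes the sign of exactly these
entries, so it is continuous, and Lipschitz by `LocallyLipschitzOn.glue`. The density is extended
evenly.

An eigenfunction is extended to the second copy with a sign σ, which is -1 for Dirichlet and 1 for
Neumann. Integrals over the double are folded onto M: the extension tested against v is the original
function tested against v ∘ i⁺ + σ v ∘ i⁻. Two points need an argument. The extension must be in H¹: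
for σ = 1, a test function for the normal derivative folds to one that vanishes on the boundary and
can be cut off there, while for σ = -1 the zero trace allows every test function
(`isWeakGradient_extendSign`). And the equation must hold for the folded test functions: for Neumann
nothing is required of them, and for Dirichlet v ∘ i⁺ - v ∘ i⁻ vanishes on the boundary, so it is a
limit of functions supported in the interior (`weakEigenEquation_of_eq_zero_on_boundary`).

Sobolev functions on M are given in atlas charts, whereas the double uses normal charts. Weak
gradients thus have to be transported by diffeomorphisms that are only C¹, which amounts to testing
them against fields that are only continuous. This is done by mollification
(`IsWeakGradient.integral_mul_field`). -/

theorem LocallyLipschitzOn.congr {α β : Type*} [PseudoEMetricSpace α] [PseudoEMetricSpace β]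
    {f g : α → β} {s : Set α} (hf : LocallyLipschitzOn s f) (h : EqOn g f s) :
    LocallyLipschitzOn s g := fun x hx => by
  obtain ⟨K, t, ht, hK⟩ := hf hx
  refine ⟨K, t ∩ s, inter_mem ht self_mem_nhdsWithin, fun y hy z hz => ?_⟩
  rw [h hy.2, h hz.2]
  exact hK hy.1 hz.1

theorem LocallyLipschitzOn.comp_mapsTo {α β γ : Type*} [PseudoEMetricSpace α]
    [PseudoEMetricSpace β] [PseudoEMetricSpace γ] {f : α → β} {g : β → γ} {s : Set α} {t : Set β}
    (hg : LocallyLipschitzOn t g) (hf : LocallyLipschitzOn s f) (h : MapsTo f s t) :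
    LocallyLipschitzOn s (g ∘ f) := fun x hx => by
  obtain ⟨K, u, hu, hK⟩ := hf hx
  obtain ⟨L, v, hv, hL⟩ := hg (h hx)
  have : f ⁻¹' v ∈ 𝓝[s] x :=
    (hf.continuousOn x hx).tendsto_nhdsWithin h hv
  exact ⟨L * K, u ∩ f ⁻¹' v, inter_mem hu this,
    hL.comp (hK.mono inter_subset_left) fun y hy => hy.2⟩

variable {α : Type*} [PseudoEMetricSpace α]
  {E F G : Type*} [NormedAddCommGroup E] [NormedSpace ℝ E]
  [NormedAddCommGroup F] [NormedSpace ℝ F] [NormedAddCommGroup G] [NormedSpace ℝ G]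

/-- A C¹ map is locally Lipschitz. Products, inverses and compositions of Lipschitz functions are
obtained below as C¹ operations applied to Lipschitz data. -/
theorem ContDiffAt.comp_locallyLipschitzOn {g : E → F} {f : α → E} {s : Set α}
    (hg : ∀ x ∈ s, ContDiffAt ℝ 1 g (f x)) (hf : LocallyLipschitzOn s f) :
    LocallyLipschitzOn s (g ∘ f) := fun x hx => by
  obtain ⟨K, u, hu, hK⟩ := hf hx
  obtain ⟨L, v, hv, hL⟩ := (hg x hx).exists_lipschitzOnWith
  exact ⟨L * K, u ∩ f ⁻¹' v, inter_mem hu (hf.continuousOn x hx hv),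
    hL.comp (hK.mono inter_subset_left) fun y hy => hy.2⟩

theorem ContDiff.comp_locallyLipschitzOn {g : E → F} {f : α → E} {s : Set α}
    (hg : ContDiff ℝ 1 g) (hf : LocallyLipschitzOn s f) : LocallyLipschitzOn s (g ∘ f) :=
  ContDiffAt.comp_locallyLipschitzOn (fun _ _ => hg.contDiffAt) hf

omit [NormedSpace ℝ E] [NormedSpace ℝ F] in
theorem LocallyLipschitzOn.prodMk {f : α → E} {g : α → F} {s : Set α}
    (hf : LocallyLipschitzOn s f) (hg : LocallyLipschitzOn s g) :
    LocallyLipschitzOn s fun x => (f x, g x) := fun x hx => by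
  obtain ⟨K, u, hu, hK⟩ := hf hx
  obtain ⟨L, v, hv, hL⟩ := hg hx
  refine ⟨max K L, u ∩ v, inter_mem hu hv, ?_⟩
  exact (hK.mono inter_subset_left).prodMk (hL.mono inter_subset_right)

omit [NormedSpace ℝ E] in
theorem LocallyLipschitzOn.const (c : E) (s : Set α) :
    LocallyLipschitzOn s fun _ : α => c :=
  fun _ _ => ⟨0, univ, univ_mem, (LipschitzWith.const c).lipschitzOnWith⟩

theorem LocallyLipschitzOn.clm_comp {f : α → F →L[ℝ] G} {g : α → E →L[ℝ] F} {s : Set α}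
    (hf : LocallyLipschitzOn s f) (hg : LocallyLipschitzOn s g) :
    LocallyLipschitzOn s fun x => (f x).comp (g x) := by
  have h : ContDiff ℝ 1 fun p : (F →L[ℝ] G) × (E →L[ℝ] F) => p.1.comp p.2 :=
    contDiff_fst.clm_comp contDiff_snd
  exact (ContDiff.comp_locallyLipschitzOn h (hf.prodMk hg) :)

theorem LocallyLipschitzOn.mul_real {f g : α → ℝ} {s : Set α}
    (hf : LocallyLipschitzOn s f) (hg : LocallyLipschitzOn s g) :
    LocallyLipschitzOn s fun x => f x * g x :=
  ContDiff.comp_locallyLipschitzOn (g := fun p : ℝ × ℝ => p.1 * p.2) (by fun_prop) (hf.prodMk hg)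

theorem LocallyLipschitzOn.clm_apply_const {f : α → F →L[ℝ] G} {s : Set α}
    (hf : LocallyLipschitzOn s f) (v : F) : LocallyLipschitzOn s fun x => f x v :=
  ContDiff.comp_locallyLipschitzOn (g := fun p : F →L[ℝ] G => p v) (by fun_prop) hf

omit [NormedSpace ℝ E] in
theorem LocallyLipschitzOn.sum {ι : Type*} {t : Finset ι} {f : ι → α → E} {s : Set α}
    (hf : ∀ i ∈ t, LocallyLipschitzOn s (f i)) :
    LocallyLipschitzOn s fun x => ∑ i ∈ t, f i x := by
  classical
  induction t using Finset.induction_on with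
  | empty => simpa using LocallyLipschitzOn.const (0 : E) s
  | insert a t ha ih =>
    simp only [Finset.sum_insert ha]
    exact (hf a (by simp)).add (ih fun i hi => hf i (by simp [hi]))

theorem LocallyLipschitzOn.prod {ι : Type*} {t : Finset ι} {f : ι → α → ℝ} {s : Set α}
    (hf : ∀ i ∈ t, LocallyLipschitzOn s (f i)) :
    LocallyLipschitzOn s fun x => ∏ i ∈ t, f i x := by
  classical
  induction t using Finset.induction_on with
  | empty => simpa using LocallyLipschitzOn.const (1 : ℝ) s
  | insert a t ha ih =>
    simp only [Finset.prod_insert ha]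
    exact (hf a (by simp)).mul_real (ih fun i hi => hf i (by simp [hi]))

theorem LocallyLipschitzOn.inv_real {f : α → ℝ} {s : Set α} (hf : LocallyLipschitzOn s f)
    (h : ∀ x ∈ s, f x ≠ 0) : LocallyLipschitzOn s fun x => (f x)⁻¹ :=
  ContDiffAt.comp_locallyLipschitzOn (g := fun r : ℝ => r⁻¹)
    (fun x hx => contDiffAt_inv ℝ (h x hx)) hf

/-! ### Determinants, products and inverses of locally Lipschitz matrices. -/

section Matrix

variable {n : Type*} [Fintype n] [DecidableEq n] {A B : α → Matrix n n ℝ} {s : Set α}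

theorem LocallyLipschitzOn.matrix_det (hA : ∀ i j, LocallyLipschitzOn s fun x => A x i j) :
    LocallyLipschitzOn s fun x => (A x).det := by
  simp only [Matrix.det_apply']
  exact .sum fun σ _ => (LocallyLipschitzOn.const _ s).mul_real (.prod fun i _ => hA _ _)

omit [DecidableEq n] in
theorem LocallyLipschitzOn.matrix_mul (hA : ∀ i j, LocallyLipschitzOn s fun x => A x i j)
    (hB : ∀ i j, LocallyLipschitzOn s fun x => B x i j) (i j : n) :
    LocallyLipschitzOn s fun x => (A x * B x) i j := by
  simp only [Matrix.mul_apply]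
  exact .sum fun k _ => (hA i k).mul_real (hB k j)

theorem LocallyLipschitzOn.matrix_inv (hA : ∀ i j, LocallyLipschitzOn s fun x => A x i j)
    (h : ∀ x ∈ s, (A x).det ≠ 0) (i j : n) : LocallyLipschitzOn s fun x => (A x)⁻¹ i j := by
  simp only [Matrix.inv_def, Ring.inverse_eq_inv', Matrix.smul_apply, smul_eq_mul,
    Matrix.adjugate_apply]
  refine (LocallyLipschitzOn.matrix_det hA).inv_real h |>.mul_real
    (LocallyLipschitzOn.matrix_det fun k l => ?_)
  -- An entry of the adjugate is the determinant of the matrix with row `j` replaced by a constant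
  -- row, so each row is either constant or a row of `A`.
  by_cases hk : k = j
  · subst hk; simpa using LocallyLipschitzOn.const _ s
  · simpa [Matrix.updateRow_ne hk] using hA k l

end Matrix

theorem LocallyLipschitzOn.abs_real {f : α → ℝ} {s : Set α} (hf : LocallyLipschitzOn s f) :
    LocallyLipschitzOn s fun x => |f x| := fun x hx => by
  obtain ⟨K, u, hu, hK⟩ := hf hx
  exact ⟨_, u, hu, lipschitzWith_one_norm.comp_lipschitzOnWith hK⟩

/-- Two locally Lipschitz functions on the closed half-spaces `0 ≤ ℓ` and `ℓ ≤ 0` glue together. -/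
theorem LocallyLipschitzOn.glue {β : Type*} [PseudoMetricSpace β] {ℓ : E →L[ℝ] ℝ} {s : Set E}
    (hs : IsOpen s) {f : E → β} (h₁ : LocallyLipschitzOn (s ∩ {y | 0 ≤ ℓ y}) f)
    (h₂ : LocallyLipschitzOn (s ∩ {y | ℓ y ≤ 0}) f) : LocallyLipschitzOn s f := fun x hx => by
  -- If `x` lies outside the closed set `t`, a small ball around `x` misses `t` and the bound is
  -- empty.
  have key : ∀ t : Set E, LocallyLipschitzOn (s ∩ t) f → IsClosed t →
      ∃ K : NNReal, ∃ r > 0, LipschitzOnWith K f (t ∩ Metric.ball x r) := by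
    intro t h ht
    by_cases hxt : x ∈ t
    · obtain ⟨K, u, hu, hK⟩ := h ⟨hx, hxt⟩
      rw [inter_comm, nhdsWithin_inter_of_mem' (mem_nhdsWithin_of_mem_nhds (hs.mem_nhds hx))] at hu
      obtain ⟨r, hr, hru⟩ := Metric.mem_nhdsWithin_iff.1 hu
      exact ⟨K, r, hr, hK.mono (by rwa [inter_comm])⟩
    · obtain ⟨r, hr, hru⟩ := Metric.isOpen_iff.1 ht.isOpen_compl x hxt
      exact ⟨0, r, hr, fun y hy => (hru hy.2 hy.1).elim⟩
  obtain ⟨K₁, r₁, hr₁, hK₁⟩ := key _ h₁ (isClosed_le continuous_const ℓ.continuous)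
  obtain ⟨K₂, r₂, hr₂, hK₂⟩ := key _ h₂ (isClosed_le ℓ.continuous continuous_const)
  refine ⟨max K₁ K₂, Metric.ball x (min r₁ r₂), mem_nhdsWithin_of_mem_nhds
    (Metric.ball_mem_nhds x (lt_min hr₁ hr₂)), LipschitzOnWith.of_dist_le_mul ?_⟩
  have b₁ := Metric.ball_subset_ball (x := x) (min_le_left r₁ r₂)
  have b₂ := Metric.ball_subset_ball (x := x) (min_le_right r₁ r₂)
  set K : NNReal := max K₁ K₂
  have hk₁ := hK₁.weaken (le_max_left K₁ K₂)
  have hk₂ := hK₂.weaken (le_max_right K₁ K₂)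
  -- For points on opposite sides, the segment joining them crosses the hyperplane at some `w`.
  -- Since `w` lies on the segment, the two distances add up exactly and the constant does not
  -- double.
  have cross : ∀ y ∈ Metric.ball x (min r₁ r₂), ∀ z ∈ Metric.ball x (min r₁ r₂),
      0 ≤ ℓ y → ℓ z ≤ 0 → dist (f y) (f z) ≤ K * dist y z := by
    intro y hy z hz hy0 hz0
    obtain ⟨w, hw, hw0⟩ : ∃ w ∈ segment ℝ y z, ℓ w = 0 := by
      have hc := (convex_segment y z).isPreconnected.image (f := ℓ) ℓ.continuous.continuousOn
      obtain ⟨w, hw, hw0⟩ := hc.ordConnected.out ⟨z, right_mem_segment ℝ y z, rfl⟩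
        ⟨y, left_mem_segment ℝ y z, rfl⟩ ⟨hz0, hy0⟩
      exact ⟨w, hw, hw0⟩
    have hwb := (convex_ball x _).segment_subset hy hz hw
    have e₁ := hk₁.dist_le_mul y ⟨hy0, b₁ hy⟩ w ⟨hw0.ge, b₁ hwb⟩
    have e₂ := hk₂.dist_le_mul w ⟨hw0.le, b₂ hwb⟩ z ⟨hz0, b₂ hz⟩
    calc dist (f y) (f z) ≤ dist (f y) (f w) + dist (f w) (f z) := dist_triangle _ _ _
      _ ≤ K * (dist y w + dist w z) := by rw [mul_add]; exact add_le_add e₁ e₂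
      _ = K * dist y z := by rw [dist_add_dist_of_mem_segment hw]
  intro y hy z hz
  rcases le_total 0 (ℓ y) with hy0 | hy0 <;> rcases le_total 0 (ℓ z) with hz0 | hz0
  · exact hk₁.dist_le_mul y ⟨hy0, b₁ hy⟩ z ⟨hz0, b₁ hz⟩
  · exact cross y hy z hz hy0 hz0
  · rw [dist_comm, dist_comm y]; exact cross z hz y hy hz0 hy0
  · exact hk₂.dist_le_mul y ⟨hy0, b₂ hy⟩ z ⟨hz0, b₂ hz⟩

end LocallyLipschitz

/-! ### Relatively open subsets of the half-space -/

section HalfSpace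

variable {d : ℕ} [NeZero d]

/-- The closed half-space. -/
def halfSpace (d : ℕ) [NeZero d] : Set (Euc d) := {y | 0 ≤ y 0}

/-- `s` is relatively open in the closed half-space. -/
def IsHalfOpen (s : Set (Euc d)) : Prop := ∃ O, IsOpen O ∧ s = halfSpace d ∩ O

omit [NeZero d] in
theorem continuous_coord (i : Fin d) : Continuous fun y : Euc d => y i := by fun_prop

theorem isClosed_halfSpace : IsClosed (halfSpace d) :=
  isClosed_le continuous_const (continuous_coord 0)

theorem convex_halfSpace : Convex ℝ (halfSpace d) := by
  intro x hx y hy a b ha hb _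
  simp only [halfSpace, mem_ofPred_eq, PiLp.add_apply, PiLp.smul_apply, smul_eq_mul] at *
  positivity

theorem interior_halfSpace_eq : interior (halfSpace d) = {y | 0 < y 0} :=
  interior_halfSpace 2 0 0

theorem uniqueDiffOn_halfSpace : UniqueDiffOn ℝ (halfSpace d) := by
  refine uniqueDiffOn_convex convex_halfSpace ⟨EuclideanSpace.single 0 1, ?_⟩
  rw [interior_halfSpace_eq]
  simp

namespace IsHalfOpen

variable {s t : Set (Euc d)}

theorem subset (hs : IsHalfOpen s) : s ⊆ halfSpace d := by
  obtain ⟨O, _, rfl⟩ := hs; exact inter_subset_left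

/-- Consequently derivatives within any relatively open set are derivatives within the half-space,
and domains can be shrunk or exchanged freely. -/
theorem nhdsWithin_eq (hs : IsHalfOpen s) {y : Euc d} (hy : y ∈ s) : 𝓝[s] y = 𝓝[halfSpace d] y := by
  obtain ⟨O, hO, rfl⟩ := hs
  rw [nhdsWithin_inter_of_mem' (mem_nhdsWithin_of_mem_nhds (hO.mem_nhds hy.2))]

theorem uniqueDiffOn (hs : IsHalfOpen s) : UniqueDiffOn ℝ s := by
  obtain ⟨O, hO, rfl⟩ := hs
  exact uniqueDiffOn_halfSpace.inter hO

theorem fderivWithin_eq {F : Type*} [NormedAddCommGroup F] [NormedSpace ℝ F] {f : Euc d → F}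
    (hs : IsHalfOpen s) {y : Euc d} (hy : y ∈ s) :
    fderivWithin ℝ f s y = fderivWithin ℝ f (halfSpace d) y :=
  fderivWithin_congr_set' y (by
    have := hs.nhdsWithin_eq hy
    rw [nhdsWithin_eq_iff_eventuallyEq] at this
    exact this.filter_mono nhdsWithin_le_nhds)

theorem measurableSet (hs : IsHalfOpen s) : MeasurableSet s := by
  obtain ⟨O, hO, rfl⟩ := hs
  exact isClosed_halfSpace.measurableSet.inter hO.measurableSet

theorem interior_eq (hs : IsHalfOpen s) : interior s = {y ∈ s | 0 < y 0} := by
  obtain ⟨O, hO, rfl⟩ := hs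
  rw [interior_inter, hO.interior_eq, interior_halfSpace_eq]
  ext y
  simp only [halfSpace, mem_inter_iff, mem_ofPred_eq]
  exact ⟨fun h => ⟨⟨h.1.le, h.2⟩, h.1⟩, fun h => ⟨h.2, h.1.2⟩⟩

theorem inter_preimage {X : Type*} [TopologicalSpace X] {f : Euc d → X} {U : Set X}
    (hs : IsHalfOpen s) (hf : ContinuousOn f s) (hU : IsOpen U) : IsHalfOpen (s ∩ f ⁻¹' U) := by
  obtain ⟨O, hO, rfl⟩ := hs
  obtain ⟨V, hV, h⟩ := continuousOn_iff'.1 hf U hU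
  refine ⟨V ∩ O, hV.inter hO, ?_⟩
  rw [inter_comm, h]
  ext; simp only [mem_inter_iff]; tauto

theorem contDiffWithinAt {F : Type*} [NormedAddCommGroup F] [NormedSpace ℝ F] {f : Euc d → F}
    {n : WithTop ℕ∞} (hs : IsHalfOpen s) (hf : ContDiffOn ℝ n f s) {y : Euc d} (hy : y ∈ s) :
    ContDiffWithinAt ℝ n f (halfSpace d) y :=
  (hf y hy).mono_of_mem_nhdsWithin (by rw [← hs.nhdsWithin_eq hy]; exact self_mem_nhdsWithin)

theorem hasFDerivWithinAt {F : Type*} [NormedAddCommGroup F] [NormedSpace ℝ F] {f : Euc d → F}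
    (hs : IsHalfOpen s) (hf : ContDiffOn ℝ 1 f s) {y : Euc d} (hy : y ∈ s) :
    HasFDerivWithinAt f (fderivWithin ℝ f (halfSpace d) y) (halfSpace d) y :=
  ((hs.contDiffWithinAt hf hy).differentiableWithinAt one_ne_zero).hasFDerivWithinAt

/-- The mean value inequality needs convexity, which the half-space provides up to the boundary. -/
theorem locallyLipschitzOn {F : Type*} [NormedAddCommGroup F] [NormedSpace ℝ F] {f : Euc d → F}
    (hs : IsHalfOpen s) (hf : ContDiffOn ℝ 1 f s) : LocallyLipschitzOn s f := fun y hy => by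
  obtain ⟨K, t, ht, hK⟩ :=
    (hs.contDiffWithinAt hf hy).exists_lipschitzOnWith convex_halfSpace
  exact ⟨K, t, by rwa [hs.nhdsWithin_eq hy], hK⟩

end IsHalfOpen

theorem ContDiffOn.locallyLipschitzOn_of_isOpen {E F : Type*} [NormedAddCommGroup E]
    [NormedSpace ℝ E] [NormedAddCommGroup F] [NormedSpace ℝ F] {f : E → F} {s : Set E}
    (hf : ContDiffOn ℝ 1 f s) (hs : IsOpen s) : LocallyLipschitzOn s f := fun y hy => by
  obtain ⟨K, t, ht, hK⟩ := (hf.contDiffAt (hs.mem_nhds hy)).exists_lipschitzOnWith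
  exact ⟨K, t, mem_nhdsWithin_of_mem_nhds ht, hK⟩

end HalfSpace

/-! ### Maps of class `C^1 ∩ W^{2,∞}` -/

section W2Infty

variable {d : ℕ}

namespace IsW2InftyOn

variable {f g : Euc d → Euc d} {s t : Set (Euc d)}

/-- By the chain rule the derivative is a product of Lipschitz factors. The Lipschitz bound on `f`
is a separate hypothesis because `s` is not assumed convex. -/
theorem comp (hg : IsW2InftyOn g t) (hf : IsW2InftyOn f s) (hs : UniqueDiffOn ℝ s)
    (hfl : LocallyLipschitzOn s f) (h : MapsTo f s t) : IsW2InftyOn (g ∘ f) s := by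
  refine ⟨hg.1.comp hf.1 h, ?_⟩
  refine ((hg.2.comp_mapsTo hfl h).clm_comp hf.2).congr fun y hy => ?_
  exact fderivWithin_comp y (hg.1.differentiableOn one_ne_zero _ (h hy))
    (hf.1.differentiableOn one_ne_zero _ hy) h (hs y hy)

theorem mono (hf : IsW2InftyOn f s) (ht : UniqueDiffOn ℝ t) (h : t ⊆ s) : IsW2InftyOn f t :=
  ⟨hf.1.mono h, (hf.2.mono h).congr fun y hy =>
    fderivWithin_subset h (ht y hy) (hf.1.differentiableOn one_ne_zero _ (h hy))⟩

theorem congr (hf : IsW2InftyOn f s) (h : EqOn g f s) : IsW2InftyOn g s :=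
  ⟨hf.1.congr h, hf.2.congr fun _ hy => fderivWithin_congr h (h hy)⟩

end IsW2InftyOn

theorem jacobian_comp {f g : Euc d → Euc d} {s t : Set (Euc d)} {y : Euc d}
    (hg : DifferentiableWithinAt ℝ g t (f y)) (hf : DifferentiableWithinAt ℝ f s y)
    (h : MapsTo f s t) (hs : UniqueDiffWithinAt ℝ s y) :
    jacobian (g ∘ f) s y = jacobian g t (f y) * jacobian f s y := by
  ext i j
  simp only [jacobian, Matrix.of_apply, Matrix.mul_apply]
  rw [fderivWithin_comp y hg hf h hs, ContinuousLinearMap.comp_apply]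
  conv_lhs => rw [← (EuclideanSpace.basisFun (Fin d) ℝ).sum_repr
    (fderivWithin ℝ f s y (EuclideanSpace.single j 1))]
  simp [map_sum, Finset.sum_apply, mul_comm]

theorem grad_comp {f : Euc d → Euc d} {v : Euc d → ℝ} {s t : Set (Euc d)} {y : Euc d}
    (hg : DifferentiableWithinAt ℝ v t (f y)) (hf : DifferentiableWithinAt ℝ f s y)
    (h : MapsTo f s t) (hs : UniqueDiffWithinAt ℝ s y) :
    grad (v ∘ f) s y = (jacobian f s y)ᵀ *ᵥ grad v t (f y) := by
  ext j
  simp only [jacobian, grad, Matrix.mulVec, dotProduct, Matrix.transpose_apply, Matrix.of_apply]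
  rw [fderivWithin_comp y hg hf h hs, ContinuousLinearMap.comp_apply]
  conv_lhs => rw [← (EuclideanSpace.basisFun (Fin d) ℝ).sum_repr
    (fderivWithin ℝ f s y (EuclideanSpace.single j 1))]
  simp

theorem jacobian_det (f : Euc d → Euc d) (s : Set (Euc d)) (y : Euc d) :
    (jacobian f s y).det = (fderivWithin ℝ f s y).det := by
  rw [ContinuousLinearMap.det, ← LinearMap.det_toMatrix (EuclideanSpace.basisFun (Fin d) ℝ).toBasis]
  congr 1

theorem jacobian_congr {f g : Euc d → Euc d} {s : Set (Euc d)} {y : Euc d} (h : EqOn f g s)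
    (hy : y ∈ s) : jacobian f s y = jacobian g s y := by
  simp only [jacobian, fderivWithin_congr h (h hy)]

theorem jacobian_id {s : Set (Euc d)} {y : Euc d} (hs : UniqueDiffWithinAt ℝ s y) :
    jacobian id s y = 1 := by
  ext i j
  simp [jacobian, fderivWithin_id hs, Matrix.one_apply]

theorem jacobian_eq_of_halfOpen [NeZero d] {f : Euc d → Euc d} {s : Set (Euc d)} {y : Euc d}
    (hs : IsHalfOpen s) (hy : y ∈ s) : jacobian f s y = jacobian f (halfSpace d) y := by
  simp only [jacobian, hs.fderivWithin_eq hy]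

end W2Infty

/-! ### A `C^{1,1}` function on `ℝ^d` with prescribed Lipschitz normal derivative -/

section ScaledAverage

variable {d : ℕ}

/-- The average of `b` around `p.1` at scale `p.2` with respect to the kernel `k`. -/
noncomputable def scaledAverage (b k : Euc d → ℝ) (p : Euc d × ℝ) : ℝ :=
  ∫ z, b (p.1 - p.2 • z) * k z

variable {b k ρ : Euc d → ℝ} {L : NNReal}

theorem integrable_scaledAverage (hb : LipschitzWith L b) (hk : Continuous k)
    (hkc : HasCompactSupport k) (p : Euc d × ℝ) :
    Integrable fun z => b (p.1 - p.2 • z) * k z := by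
  have := hb.continuous
  exact Continuous.integrable_of_hasCompactSupport (by fun_prop) hkc.mul_left

theorem abs_scaledAverage_integrand_sub_le (hb : LipschitzWith L b) (p q : Euc d × ℝ) (z : Euc d) :
    ‖b (p.1 - p.2 • z) * k z - b (q.1 - q.2 • z) * k z‖ ≤
      L * ((1 + ‖z‖) * ‖k z‖) * dist p q := by
  rw [← sub_mul, norm_mul]
  have h1 : ‖b (p.1 - p.2 • z) - b (q.1 - q.2 • z)‖ ≤ L * ((1 + ‖z‖) * dist p q) := by
    rw [← dist_eq_norm]
    refine (hb.dist_le_mul _ _).trans ?_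
    gcongr
    rw [dist_eq_norm, show p.1 - p.2 • z - (q.1 - q.2 • z) = (p.1 - q.1) - (p.2 - q.2) • z by
      module]
    refine (norm_sub_le _ _).trans ?_
    rw [norm_smul, add_mul, one_mul, mul_comm ‖z‖]
    have e1 : ‖p.1 - q.1‖ ≤ dist p q := by
      rw [← dist_eq_norm, Prod.dist_eq]; exact le_max_left _ _
    have e2 : ‖p.2 - q.2‖ ≤ dist p q := by
      rw [← dist_eq_norm, Prod.dist_eq]; exact le_max_right _ _
    gcongr
  calc _ ≤ L * ((1 + ‖z‖) * dist p q) * ‖k z‖ := by gcongr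
    _ = _ := by ring

theorem integrable_scaledAverage_bound (hk : Continuous k) (hkc : HasCompactSupport k) :
    Integrable fun z => (L : ℝ) * ((1 + ‖z‖) * ‖k z‖) :=
  Continuous.integrable_of_hasCompactSupport (by fun_prop) (hkc.norm.mul_left.mul_left)

/-- Changing the centre and the scale moves the sample point indexed by `z` by at most `1 + ‖z‖`
times the distance of the parameters, and this weight is integrable against a compactly supported
kernel. -/
theorem lipschitz_scaledAverage (hb : LipschitzWith L b) (hk : Continuous k)
    (hkc : HasCompactSupport k) : ∃ C, LipschitzWith C (scaledAverage b k) := by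
  refine ⟨(∫ z, (L : ℝ) * ((1 + ‖z‖) * ‖k z‖)).toNNReal, LipschitzWith.of_dist_le_mul fun p q => ?_⟩
  rw [Real.coe_toNNReal _ (integral_nonneg fun z => by positivity), dist_eq_norm, scaledAverage,
    scaledAverage, ← integral_sub (integrable_scaledAverage hb hk hkc p)
    (integrable_scaledAverage hb hk hkc q), ← integral_mul_const]
  exact norm_integral_le_of_norm_le ((integrable_scaledAverage_bound hk hkc).mul_const _)
    (Eventually.of_forall fun z => abs_scaledAverage_integrand_sub_le hb p q z)

/-- The divergence of `z ↦ ρ z z`. -/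
noncomputable def radialDiv (ρ : Euc d → ℝ) (z : Euc d) : ℝ :=
  ∑ i, fderiv ℝ (fun z => z i * ρ z) z (EuclideanSpace.single i 1)

/-- The derivative of `p ↦ p.2 * scaledAverage b ρ p`. -/
noncomputable def scaledAverageDeriv (b ρ : Euc d → ℝ) (p : Euc d × ℝ) : Euc d × ℝ →L[ℝ] ℝ :=
  (∑ i, scaledAverage b (fun z => fderiv ℝ ρ z (EuclideanSpace.single i 1)) p •
    (EuclideanSpace.proj i).comp (ContinuousLinearMap.fst ℝ (Euc d) ℝ)) +
  (scaledAverage b ρ p - scaledAverage b (radialDiv ρ) p) • ContinuousLinearMap.snd ℝ (Euc d) ℝ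

/-- Here `f` is only Lipschitz: by Rademacher's theorem its derivative exists almost everywhere and
coincides there with the line derivatives. -/
theorem integral_fderiv_mul_eq {f g : Euc d → ℝ} (hf : LipschitzWith L f) (hg : ContDiff ℝ 1 g)
    (hgc : HasCompactSupport g) (v : Euc d) :
    ∫ z, fderiv ℝ f z v * g z = -∫ z, f z * fderiv ℝ g z v := by
  obtain ⟨D, hD⟩ := hg.lipschitzWith_of_hasCompactSupport hgc one_ne_zero
  have h := hf.integral_lineDeriv_mul_eq (μ := volume) hD hgc v
  have h1 : ∫ z, fderiv ℝ f z v * g z = ∫ z, lineDeriv ℝ f z v * g z := by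
    refine integral_congr_ae ?_
    filter_upwards [hf.ae_differentiableAt] with z hz
    rw [hz.lineDeriv_eq_fderiv]
  rw [h1, h, ← integral_neg]
  refine integral_congr_ae (Eventually.of_forall fun z => ?_)
  simp only [(hg.differentiable one_ne_zero z).lineDeriv_eq_fderiv, map_neg]
  ring

theorem contDiff_coord_mul (hρ : ContDiff ℝ ∞ ρ) (i : Fin d) :
    ContDiff ℝ ∞ fun z : Euc d => z i * ρ z := by fun_prop

theorem hasCompactSupport_coord_mul (hρc : HasCompactSupport ρ) (i : Fin d) :
    HasCompactSupport fun z : Euc d => z i * ρ z := hρc.mul_left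

theorem continuous_radialDiv (hρ : ContDiff ℝ ∞ ρ) : Continuous (radialDiv ρ) := by
  unfold radialDiv
  refine continuous_finsetSum _ fun i _ => ?_
  exact ((contDiff_coord_mul hρ i).continuous_fderiv (by simp)).clm_apply continuous_const

theorem hasCompactSupport_radialDiv (hρc : HasCompactSupport ρ) :
    HasCompactSupport (radialDiv ρ) := by
  refine HasCompactSupport.of_support_subset_isCompact hρc fun z hz => ?_
  by_contra h
  refine hz (Finset.sum_eq_zero fun i _ => ?_)
  have h1 : z ∉ tsupport fun z : Euc d => z i * ρ z := fun h2 =>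
    h (closure_mono (fun y hy => by
      simp only [Function.mem_support] at hy ⊢
      exact right_ne_zero_of_mul hy) h2)
  have h2 : fderiv ℝ (fun z : Euc d => z i * ρ z) z = 0 := by
    by_contra h3
    exact h1 (support_fderiv_subset ℝ h3)
  rw [h2]; rfl

theorem continuous_partialDeriv (hρ : ContDiff ℝ ∞ ρ) (v : Euc d) :
    Continuous fun z => fderiv ℝ ρ z v :=
  (hρ.continuous_fderiv (by simp)).clm_apply continuous_const

theorem hasCompactSupport_partialDeriv (hρc : HasCompactSupport ρ) (v : Euc d) :
    HasCompactSupport fun z => fderiv ℝ ρ z v := hρc.fderiv_apply (𝕜 := ℝ) v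

theorem integral_partialDeriv (hρ : ContDiff ℝ ∞ ρ) (hρc : HasCompactSupport ρ) (v : Euc d) :
    ∫ z, fderiv ℝ ρ z v = 0 := by
  have := integral_fderiv_mul_eq (f := fun _ => (1 : ℝ)) (L := 0) (LipschitzWith.const _)
    (hρ.of_le (by simp)) hρc v
  simpa using this

/-- Only averages of `b` itself enter the derivative, never derivatives of `b`. This is the gain of
one order of regularity. -/
theorem locallyLipschitz_scaledAverageDeriv (hb : LipschitzWith L b) (hρ : ContDiff ℝ ∞ ρ)
    (hρc : HasCompactSupport ρ) : LocallyLipschitzOn univ (scaledAverageDeriv b ρ) := by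
  have key : ∀ {k : Euc d → ℝ}, Continuous k → HasCompactSupport k →
      LocallyLipschitzOn univ (scaledAverage b k) := fun hk hkc => by
    obtain ⟨C, hC⟩ := lipschitz_scaledAverage hb hk hkc
    exact locallyLipschitzOn_univ.2 hC.locallyLipschitz
  have smul : ∀ {f : Euc d × ℝ → ℝ} (l : Euc d × ℝ →L[ℝ] ℝ), LocallyLipschitzOn univ f →
      LocallyLipschitzOn univ fun p => f p • l := fun l hf =>
    (ContDiff.comp_locallyLipschitzOn (g := fun r : ℝ => r • l) (by fun_prop) hf :)
  refine LocallyLipschitzOn.add (LocallyLipschitzOn.sum fun i _ => smul _ (key ?_ ?_))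
    (smul _ ((key ?_ ?_).sub (key ?_ ?_)))
  · exact continuous_partialDeriv hρ _
  · exact hasCompactSupport_partialDeriv hρc _
  · exact hρ.continuous
  · exact hρc
  · exact continuous_radialDiv hρ
  · exact hasCompactSupport_radialDiv hρc

theorem scaledAverageDeriv_apply (b ρ : Euc d → ℝ) (p v : Euc d × ℝ) :
    scaledAverageDeriv b ρ p v =
      ∑ i, scaledAverage b (fun z => fderiv ℝ ρ z (EuclideanSpace.single i 1)) p * v.1 i +
      (scaledAverage b ρ p - scaledAverage b (radialDiv ρ) p) * v.2 := by
  simp [scaledAverageDeriv]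

theorem sum_fderiv_single (f : Euc d →L[ℝ] ℝ) (v : Euc d) :
    f v = ∑ i, v i * f (EuclideanSpace.single i 1) := by
  conv_lhs => rw [← (EuclideanSpace.basisFun (Fin d) ℝ).sum_repr v]
  simp

theorem scaledAverage_zero (x : Euc d) : scaledAverage b k (x, 0) = b x * ∫ z, k z := by
  simp [scaledAverage, integral_const_mul]

theorem integral_radialDiv (hρ : ContDiff ℝ ∞ ρ) (hρc : HasCompactSupport ρ) :
    ∫ z, radialDiv ρ z = 0 := by
  unfold radialDiv
  rw [integral_finsetSum]
  · exact Finset.sum_eq_zero fun i _ =>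
      integral_partialDeriv (contDiff_coord_mul hρ i) (hasCompactSupport_coord_mul hρc i) _
  · exact fun i _ => (continuous_partialDeriv (contDiff_coord_mul hρ i) _).integrable_of_hasCompactSupport
      (hasCompactSupport_partialDeriv (hasCompactSupport_coord_mul hρc i) _)

/-- At scale zero an average is `b x` times the integral of its kernel. Kernels that are derivatives
or divergences integrate to zero, and only `ρ` itself contributes. -/
theorem scaledAverageDeriv_zero (hρ : ContDiff ℝ ∞ ρ)
    (hρc : HasCompactSupport ρ) (hρi : ∫ z, ρ z = 1) (x : Euc d) :
    scaledAverageDeriv b ρ (x, 0) = b x • ContinuousLinearMap.snd ℝ (Euc d) ℝ := by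
  ext v
  · simp [scaledAverageDeriv_apply, scaledAverage_zero, integral_partialDeriv hρ hρc]
  · simp [scaledAverageDeriv_apply, scaledAverage_zero, integral_radialDiv hρ hρc, hρi]

/-- Write `f z = b (x - t • z)`. Differentiating under the integral sign produces `-1/t` times
derivatives of `f` in `z`. The prefactor `t` cancels `1/t`, and an integration by parts moves the
derivatives onto the kernel. -/
theorem hasFDerivAt_mul_scaledAverage_of_ne (hb : LipschitzWith L b) (hρ : ContDiff ℝ ∞ ρ)
    (hρc : HasCompactSupport ρ) {p : Euc d × ℝ} (hp : p.2 ≠ 0) :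
    HasFDerivAt (fun p => p.2 * scaledAverage b ρ p) (scaledAverageDeriv b ρ p) p := by
  obtain ⟨x, t⟩ := p
  simp only at hp
  set f : Euc d → ℝ := fun z => b (x - t • z) with hf_def
  have hf : LipschitzWith (L * ‖t‖₊) f := by
    refine hb.comp (LipschitzWith.of_dist_le_mul fun y z => ?_)
    simp only [dist_eq_norm, coe_nnnorm, ← norm_smul, smul_sub]
    rw [← norm_neg]; apply le_of_eq; congr 1; abel
  set F' : Euc d → Euc d × ℝ →L[ℝ] ℝ := fun z => (-(t⁻¹) * ρ z) • (fderiv ℝ f z).comp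
    (ContinuousLinearMap.fst ℝ (Euc d) ℝ - (ContinuousLinearMap.snd ℝ (Euc d) ℝ).smulRight z)
  have hdiff : ∀ᵐ z : Euc d, HasFDerivAt (fun p : Euc d × ℝ => b (p.1 - p.2 • z) * ρ z)
      (F' z) (x, t) := by
    -- Rademacher's theorem is applied to `f` and not to `b`, so that the exceptional set is null in
    -- the integration variable `z`. Differentiability of `b` at `x - t • z` follows by undoing the
    -- scaling.
    filter_upwards [hf.ae_differentiableAt] with z hz
    have h1 : HasFDerivAt (fun w => f (t⁻¹ • (x - w)))
        ((fderiv ℝ f z).comp (t⁻¹ • (-ContinuousLinearMap.id ℝ (Euc d)))) (x - t • z) := by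
      refine HasFDerivAt.comp (x - t • z) (g := f) (f := fun w => t⁻¹ • (x - w)) ?_ ?_
      · rw [show t⁻¹ • (x - (x - t • z)) = z by simp [smul_smul, hp]]
        exact hz.hasFDerivAt
      · exact ((hasFDerivAt_id (𝕜 := ℝ) (x - t • z)).const_sub x).const_smul t⁻¹
    have h2 : (fun w => f (t⁻¹ • (x - w))) = b := by
      ext w; simp [hf_def, smul_smul, hp]
    rw [h2] at h1
    have h3 : HasFDerivAt (fun p : Euc d × ℝ => p.1 - p.2 • z)
        (ContinuousLinearMap.fst ℝ (Euc d) ℝ -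
          (ContinuousLinearMap.snd ℝ (Euc d) ℝ).smulRight z) (x, t) :=
      hasFDerivAt_fst.sub (hasFDerivAt_snd.smul_const z)
    have h4 := (HasFDerivAt.comp (x, t) (g := b) h1 h3).mul_const (ρ z)
    refine h4.congr_fderiv ?_
    ext v <;> simp [F'] <;> ring
  have hmeas : AEStronglyMeasurable F' volume := by
    have h1 : Measurable fun z => fderiv ℝ f z := measurable_fderiv ℝ f
    have h2 : Continuous fun z : Euc d => (ContinuousLinearMap.fst ℝ (Euc d) ℝ -
        (ContinuousLinearMap.snd ℝ (Euc d) ℝ).smulRight z) := by fun_prop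
    have h3 : Continuous fun q : (Euc d →L[ℝ] ℝ) × (Euc d × ℝ →L[ℝ] Euc d) => q.1.comp q.2 :=
      (contDiff_fst.clm_comp contDiff_snd : ContDiff ℝ 0 _).continuous
    have h4 := h3.comp_aestronglyMeasurable
      (h1.aestronglyMeasurable.prodMk (h2.aestronglyMeasurable (μ := volume)))
    have h5 : Continuous fun z => -(t⁻¹) * ρ z := by have := hρ.continuous; fun_prop
    exact h5.aestronglyMeasurable.smul h4
  have hmain := hasFDerivAt_integral_of_dominated_loc_of_lip (μ := (volume : Measure (Euc d)))
    (𝕜 := ℝ) (F := fun (p : Euc d × ℝ) z => b (p.1 - p.2 • z) * ρ z) (x₀ := (x, t)) (F' := F')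
    (bound := fun z => (L : ℝ) * ((1 + ‖z‖) * ‖ρ z‖)) (s := univ) univ_mem
    (Eventually.of_forall fun p =>
      (integrable_scaledAverage hb hρ.continuous hρc p).aestronglyMeasurable)
    (integrable_scaledAverage hb hρ.continuous hρc _) hmeas
    (Eventually.of_forall fun z => LipschitzOnWith.of_dist_le_mul fun p _ q _ => by
      rw [dist_eq_norm, Real.coe_nnabs, abs_of_nonneg (by positivity)]
      exact abs_scaledAverage_integrand_sub_le hb p q z)
    (integrable_scaledAverage_bound hρ.continuous hρc) hdiff
  obtain ⟨hint, hder⟩ := hmain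
  have hprod := (hasFDerivAt_snd (𝕜 := ℝ) (p := ((x, t) : Euc d × ℝ))).mul hder
  refine hprod.congr_fderiv ?_
  have hint' : ∀ v : Euc d × ℝ, (∫ z, F' z) v = ∫ z, F' z v := fun v =>
    ContinuousLinearMap.integral_apply hint v
  have hA : ∀ v : Euc d, t * ∫ z, F' z (v, 0) =
      ∑ i, scaledAverage b (fun z => fderiv ℝ ρ z (EuclideanSpace.single i 1)) (x, t) * v i := by
    intro v
    have h1 : t * ∫ z, F' z (v, 0) = -∫ z, fderiv ℝ f z v * ρ z := by
      rw [← integral_const_mul, ← integral_neg]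
      congr 1; ext z
      simp only [F', smul_apply, ContinuousLinearMap.comp_apply, sub_apply, smul_eq_mul,
        ContinuousLinearMap.coe_fst', ContinuousLinearMap.smulRight_apply,
        ContinuousLinearMap.coe_snd', zero_smul, sub_zero]
      field_simp
    rw [h1, integral_fderiv_mul_eq hf (hρ.of_le (by simp)) hρc, neg_neg]
    have h2 : ∀ z, f z * fderiv ℝ ρ z v =
        ∑ i, (b (x - t • z) * fderiv ℝ ρ z (EuclideanSpace.single i 1)) * v i := fun z => by
      rw [sum_fderiv_single (fderiv ℝ ρ z) v, Finset.mul_sum]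
      exact Finset.sum_congr rfl fun i _ => by simp only [hf_def]; ring
    simp only [h2]
    rw [integral_finsetSum]
    · simp only [integral_mul_const, scaledAverage]
    · exact fun i _ => (integrable_scaledAverage hb (continuous_partialDeriv hρ _)
        (hasCompactSupport_partialDeriv hρc _) (x, t)).mul_const _
  -- The derivative in the scale brings down `z · ∇f`. Integrating by parts against `z i * ρ z`
  -- leaves minus the average with kernel `radialDiv ρ`.
  have hB : t * ∫ z, F' z (0, 1) = -scaledAverage b (radialDiv ρ) (x, t) := by
    have h1 : t * ∫ z, F' z (0, 1) =
        ∫ z, ∑ i, fderiv ℝ f z (EuclideanSpace.single i 1) * (z i * ρ z) := by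
      rw [← integral_const_mul]
      congr 1; ext z
      simp only [F', smul_apply, ContinuousLinearMap.comp_apply, sub_apply, smul_eq_mul,
        ContinuousLinearMap.coe_fst', ContinuousLinearMap.smulRight_apply,
        ContinuousLinearMap.coe_snd', one_smul, zero_sub, map_neg]
      rw [sum_fderiv_single (fderiv ℝ f z) z]
      field_simp
      rw [Finset.mul_sum]
      exact Finset.sum_congr rfl fun i _ => by ring
    have hg1 := fun i : Fin d => (contDiff_coord_mul hρ i)
    have hg2 := fun i : Fin d => (hasCompactSupport_coord_mul hρc i)
    rw [h1, integral_finsetSum]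
    · simp only [fun i => integral_fderiv_mul_eq hf ((hg1 i).of_le (by simp)) (hg2 i)]
      rw [Finset.sum_neg_distrib, ← integral_finsetSum]
      · simp only [scaledAverage, radialDiv, Finset.mul_sum, hf_def]
      · exact fun i _ => integrable_scaledAverage hb (continuous_partialDeriv (hg1 i) _)
          (hasCompactSupport_partialDeriv (hg2 i) _) (x, t)
    · intro i _
      have hc : Continuous fun z : Euc d => z i * ρ z := (hg1 i).continuous
      refine Integrable.bdd_mul (c := (L * ‖t‖₊ : NNReal) * ‖EuclideanSpace.single i (1 : ℝ)‖)
        (hc.integrable_of_hasCompactSupport (hg2 i))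
        ((measurable_fderiv_apply_const ℝ f _).aestronglyMeasurable) ?_
      refine Eventually.of_forall fun z => ((fderiv ℝ f z).le_opNorm _).trans ?_
      gcongr
      exact norm_fderiv_le_of_lipschitz ℝ hf
  ext v
  · simp [scaledAverageDeriv_apply, hint', hA v]
  · simp [scaledAverageDeriv_apply, hint', hB, scaledAverage]; ring

theorem hasFDerivAt_mul_scaledAverage (hb : LipschitzWith L b) (hρ : ContDiff ℝ ∞ ρ)
    (hρc : HasCompactSupport ρ) (hρi : ∫ z, ρ z = 1) (p : Euc d × ℝ) :
    HasFDerivAt (fun p => p.2 * scaledAverage b ρ p) (scaledAverageDeriv b ρ p) p := by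
  by_cases hp : p.2 = 0
  · obtain ⟨x, t⟩ := p
    obtain rfl : t = 0 := hp
    rw [scaledAverageDeriv_zero hρ hρc hρi]
    obtain ⟨C, hC⟩ := lipschitz_scaledAverage hb hρ.continuous hρc
    have h1 : HasFDerivAt (fun p : Euc d × ℝ => b x * p.2)
        (b x • ContinuousLinearMap.snd ℝ (Euc d) ℝ) (x, 0) := hasFDerivAt_snd.const_mul _
    have h0 : scaledAverage b ρ (x, 0) = b x := by rw [scaledAverage_zero, hρi, mul_one]
    -- At scale zero the function is `b x * p.2` plus `p.2` times a difference that tends to zero by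
    -- continuity of the average. The latter is `O(‖p - (x, 0)‖) * o(1)`, so its derivative
    -- vanishes.
    refine (h1.add (f' := b x • ContinuousLinearMap.snd ℝ (Euc d) ℝ) (g' := 0)
      (g := fun p : Euc d × ℝ => p.2 * (scaledAverage b ρ p - b x)) ?_).congr_fderiv (by simp)
      |>.congr_of_eventuallyEq (Eventually.of_forall fun p => by simp only [Pi.add_apply]; ring)
    refine HasFDerivAt.of_isLittleO ?_
    simp only [zero_mul, sub_zero, zero_apply]
    have e1 : (fun p : Euc d × ℝ => p.2) =O[𝓝 (x, 0)] fun p => p - (x, 0) := by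
      refine Asymptotics.IsBigO.of_bound 1 (Eventually.of_forall fun p => ?_)
      rw [one_mul, Prod.norm_def]
      simp
    have e2 : (fun p : Euc d × ℝ => scaledAverage b ρ p - b x) =o[𝓝 (x, 0)] fun _ => (1 : ℝ) := by
      rw [Asymptotics.isLittleO_one_iff, ← h0]
      have := (hC.continuous.tendsto (x, 0)).sub_const (scaledAverage b ρ (x, 0))
      simpa using this
    have := e1.norm_right.mul_isLittleO e2
    simpa using this.norm_right
  · exact hasFDerivAt_mul_scaledAverage_of_ne hb hρ hρc hp

/-- Every Lipschitz function `b` is, on the hyperplane `y 0 = 0`, the normal derivative of a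
function of class `C^{1,1}` vanishing there. -/
theorem exists_normal_deriv_eq [NeZero d] (hb : LipschitzWith L b) :
    ∃ (F : Euc d → ℝ) (F' : Euc d → Euc d →L[ℝ] ℝ), (∀ x, HasFDerivAt F (F' x) x) ∧
      LocallyLipschitzOn univ F' ∧
      ∀ x : Euc d, x 0 = 0 → F x = 0 ∧ F' x = b x • EuclideanSpace.proj (0 : Fin d) := by
  let φ : ContDiffBump (0 : Euc d) := ⟨1, 2, one_pos, one_lt_two⟩
  have hρ : ContDiff ℝ ∞ (φ.normed volume) := φ.contDiff_normed
  have hρc : HasCompactSupport (φ.normed volume) := φ.hasCompactSupport_normed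
  have hρi : ∫ z, φ.normed volume z = 1 := φ.integral_normed
  -- The averaging scale at `x` is `x 0`, the signed distance to the hyperplane.
  let l : Euc d →L[ℝ] Euc d × ℝ :=
    (ContinuousLinearMap.id ℝ (Euc d)).prod (EuclideanSpace.proj (0 : Fin d))
  refine ⟨fun x => x 0 * scaledAverage b (φ.normed volume) (x, x 0),
    fun x => (scaledAverageDeriv b (φ.normed volume) (l x)).comp l, fun x => ?_, ?_, ?_⟩
  · exact HasFDerivAt.comp (f := l) x (hasFDerivAt_mul_scaledAverage hb hρ hρc hρi (l x))
      l.hasFDerivAt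
  · refine LocallyLipschitzOn.clm_comp ?_ (LocallyLipschitzOn.const _ _)
    exact (locallyLipschitz_scaledAverageDeriv hb hρ hρc).comp_mapsTo
      (locallyLipschitzOn_univ.2 l.lipschitz.locallyLipschitz) (mapsTo_univ _ _)
  · intro x hx
    refine ⟨by simp [hx], ?_⟩
    have : l x = (x, 0) := by simp [l, hx]
    simp only [this, scaledAverageDeriv_zero hρ hρc hρi]
    ext v
    simp [l]

end ScaledAverage

/-! ### Coordinates whose normal direction is orthogonal to the boundary -/

section NormalCoordinates

variable {d : ℕ}

theorem isW2InftyOn_of_hasFDerivAt {f : Euc d → Euc d} {f' : Euc d → Euc d →L[ℝ] Euc d}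
    {s : Set (Euc d)} (hs : IsOpen s) (hf : ∀ x, HasFDerivAt f (f' x) x)
    (hf' : LocallyLipschitzOn univ f') : IsW2InftyOn f s := by
  have h : ContDiff ℝ 1 f := contDiff_one_iff_hasFDerivAt.2
    ⟨f', by simpa using hf'.continuousOn, hf⟩
  refine ⟨h.contDiffOn, (hf'.mono (subset_univ s)).congr fun y hy => ?_⟩
  rw [fderivWithin_of_isOpen hs hy, (hf y).fderiv]

/-- The derivative of the inverse map is operator inversion composed with the derivative of `e` and
with `e.symm`. Inversion is C¹ at invertible operators, and the other two are Lipschitz. -/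
theorem OpenPartialHomeomorph.isW2InftyOn_symm (e : OpenPartialHomeomorph (Euc d) (Euc d))
    (he : IsW2InftyOn e e.source)
    (h : ∀ x ∈ e.source, fderiv ℝ e x ∈ range ((↑) : (Euc d ≃L[ℝ] Euc d) → Euc d →L[ℝ] Euc d)) :
    IsW2InftyOn e.symm e.target := by
  have hdiff : ∀ x ∈ e.source, HasFDerivAt e (fderiv ℝ e x) x := fun x hx =>
    ((he.1.contDiffAt (e.open_source.mem_nhds hx)).differentiableAt one_ne_zero).hasFDerivAt
  have hc : ContDiffOn ℝ 1 e.symm e.target := fun y hy => by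
    obtain ⟨A, hA⟩ := h _ (e.map_target hy)
    refine (e.contDiffAt_symm (f₀' := A) hy ?_
      (he.1.contDiffAt (e.open_source.mem_nhds (e.map_target hy)))).contDiffWithinAt
    rw [hA]; exact hdiff _ (e.map_target hy)
  have hlip := hc.locallyLipschitzOn_of_isOpen e.open_target
  have h1 : LocallyLipschitzOn e.target fun y => fderiv ℝ e (e.symm y) := by
    refine LocallyLipschitzOn.comp_mapsTo (g := fderiv ℝ e) (t := e.source) ?_ hlip (OpenPartialHomeomorph.mapsTo_symm e)
    exact he.2.congr fun y hy => (fderivWithin_of_isOpen e.open_source hy).symm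
  have h2 := ContDiffAt.comp_locallyLipschitzOn (g := ContinuousLinearMap.inverse) (fun y hy => by
    obtain ⟨A, hA⟩ := h _ (e.map_target hy)
    rw [← hA]; exact contDiffAt_map_inverse A) h1
  refine ⟨hc, h2.congr fun y hy => ?_⟩
  obtain ⟨A, hA⟩ := h _ (e.map_target hy)
  have := hdiff _ (e.map_target hy)
  rw [← hA] at this
  rw [fderivWithin_of_isOpen e.open_target hy, (e.hasFDerivAt_symm hy this).fderiv,
    Function.comp_apply, ← hA, ContinuousLinearMap.inverse_equiv]

variable [NeZero d]

/-- If `v` is orthogonal to `e_j` for `j ≠ 0` with respect to `A`, so is `B e₀ = v` to `B e_j`. -/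
theorem transpose_mul_mul_apply_eq_zero {A J : Matrix (Fin d) (Fin d) ℝ}
    {j : Fin d} (hJ : ∀ i, J i j = if i = j then 1 else 0)
    (h0 : ∑ k, J k 0 * A k j = 0) : (Jᵀ * A * J) 0 j = 0 := by
  rw [Matrix.mul_apply]
  simp only [hJ, mul_ite, mul_one, mul_zero, Finset.sum_ite_eq', Finset.mem_univ, if_true]
  simpa [Matrix.mul_apply] using h0

/-- The vector `G⁻¹ e₀` is `G`-orthogonal to `e_j` for `j ≠ 0`. Normalised to have first component
1, it has the components appearing here. They are Lipschitz near `p` in `V` only, and are extended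
to the whole space so that they can be averaged. -/
theorem exists_extension_inv_normal {V : Set (Euc d)}
    {G : Euc d → Matrix (Fin d) (Fin d) ℝ}
    (hG : ∀ i j, LocallyLipschitzOn V fun y => G y i j) (hpos : ∀ y ∈ V, (G y).PosDef)
    {p : Euc d} (hp : p ∈ V) :
    ∃ (L : Fin d → NNReal) (b : Fin d → Euc d → ℝ) (r : ℝ), 0 < r ∧ (∀ j, LipschitzWith (L j) (b j)) ∧
      ∀ y ∈ V, y ∈ Metric.ball p r → ∀ j, b j y = (G y)⁻¹ j 0 * ((G y)⁻¹ 0 0)⁻¹ := by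
  have hlip : ∀ j, LocallyLipschitzOn V fun y => (G y)⁻¹ j 0 * ((G y)⁻¹ 0 0)⁻¹ := fun j => by
    have hinv := fun i j => LocallyLipschitzOn.matrix_inv hG (fun y hy => (hpos y hy).det_pos.ne') i j
    exact (hinv j 0).mul_real ((hinv 0 0).inv_real fun y hy => ((hpos y hy).inv.diag_pos).ne')
  choose L t ht hL using fun j => hlip j hp
  choose r hr hrt using fun j => Metric.mem_nhdsWithin_iff.1 (ht j)
  choose b hbL hb using fun j => ((hL j).mono (hrt j)).extend_real
  refine ⟨L, b, Finset.univ.inf' ⟨0, Finset.mem_univ 0⟩ r, ?_, hbL, fun y hy hyr j => ?_⟩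
  · exact (Finset.lt_inf'_iff _).2 fun j _ => hr j
  · refine (hb j ⟨Metric.ball_subset_ball (Finset.inf'_le _ (Finset.mem_univ j)) hyr, hy⟩).symm

/-- The map is the identity corrected by `∑ F j • e j` over `j ≠ 0`. On the hyperplane its
derivative sends `e₀` to the normal direction and fixes tangential vectors. The first coordinate is
unchanged everywhere, so the half-space is respected. -/
theorem exists_normal_coordinates {V : Set (Euc d)} (hV : IsHalfOpen V)
    {G : Euc d → Matrix (Fin d) (Fin d) ℝ}
    (hG : ∀ i j, LocallyLipschitzOn V fun y => G y i j) (hpos : ∀ y ∈ V, (G y).PosDef)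
    {p : Euc d} (hp : p ∈ V) :
    ∃ Φ : OpenPartialHomeomorph (Euc d) (Euc d), p ∈ Φ.target ∧ IsW2InftyOn Φ Φ.source ∧
      IsW2InftyOn Φ.symm Φ.target ∧ (∀ x ∈ Φ.source, (Φ x) 0 = x 0) ∧
      ∀ x ∈ Φ.source, Φ x ∈ V → x 0 = 0 → ∀ j ≠ 0,
        ((jacobian Φ Φ.source x)ᵀ * G (Φ x) * jacobian Φ Φ.source x) 0 j = 0 := by
  rcases (show 0 ≤ p 0 from hV.subset hp).lt_or_eq with hp0 | hp0
  -- Near an interior point the identity of the open half-space suffices, since the condition on the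
  -- hyperplane is void.
  · have hO : IsOpen {y : Euc d | 0 < y 0} := isOpen_lt continuous_const (continuous_coord 0)
    have hid : IsW2InftyOn (id : Euc d → Euc d) {y : Euc d | 0 < y 0} :=
      isW2InftyOn_of_hasFDerivAt hO (fun x => hasFDerivAt_id x) (LocallyLipschitzOn.const _ _)
    refine ⟨OpenPartialHomeomorph.ofSet _ hO, hp0, hid, hid, fun x _ => rfl, ?_⟩
    intro x hx _ hx0
    exact absurd hx0 (ne_of_gt hx)
  · obtain ⟨L, b, r, hr, hbL, hb⟩ := exists_extension_inv_normal hG hpos hp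
    choose F F' hF hF' hF0 using fun j => exists_normal_deriv_eq (hbL j)
    set e : Fin d → Euc d := fun j => EuclideanSpace.single j 1
    set f : Euc d → Euc d := fun x => x + ∑ j ∈ Finset.univ.erase 0, F j x • e j
    set f' : Euc d → Euc d →L[ℝ] Euc d := fun x => ContinuousLinearMap.id ℝ (Euc d) +
      ∑ j ∈ Finset.univ.erase 0, (F' j x).smulRight (e j)
    have hf : ∀ x, HasFDerivAt f (f' x) x := fun x =>
      (hasFDerivAt_id x).add (HasFDerivAt.fun_sum fun j _ => (hF j x).smul_const (e j))
    have hf'lip : LocallyLipschitzOn univ f' := by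
      refine (LocallyLipschitzOn.const _ _).add (LocallyLipschitzOn.sum fun j _ => ?_)
      exact (ContDiff.comp_locallyLipschitzOn
        (g := fun l : Euc d →L[ℝ] ℝ => l.smulRight (e j)) (by fun_prop) (hF' j) :)
    have hf0 : ∀ x, (f x) 0 = x 0 := fun x => by
      simp only [f, PiLp.add_apply, WithLp.ofLp_sum, Finset.sum_apply, PiLp.smul_apply, e,
        PiLp.single_apply, smul_eq_mul]
      rw [Finset.sum_eq_zero, add_zero]
      intro j hj
      rw [if_neg (Finset.ne_of_mem_erase hj).symm, mul_zero]
    have hfb : ∀ x : Euc d, x 0 = 0 → f x = x := fun x hx => by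
      simp [f, fun j => (hF0 j x hx).1]
    set B : Euc d → Euc d := fun x => ∑ j ∈ Finset.univ.erase 0, b j x • e j
    have hB0 : ∀ x, (B x) 0 = 0 := fun x => by
      simp only [B, WithLp.ofLp_sum, Finset.sum_apply, PiLp.smul_apply, e,
        PiLp.single_apply, smul_eq_mul]
      refine Finset.sum_eq_zero fun j hj => ?_
      rw [if_neg (Finset.ne_of_mem_erase hj).symm, mul_zero]
    have hf'b : ∀ x : Euc d, x 0 = 0 → ∀ v : Euc d, f' x v = v + v 0 • B x := fun x hx v => by
      simp only [f', B, fun j => (hF0 j x hx).2, Finset.smul_sum, smul_smul, add_apply, sum_apply,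
        ContinuousLinearMap.id_apply, ContinuousLinearMap.smulRight_apply, smul_apply,
        smul_eq_mul]
      exact congrArg _ (Finset.sum_congr rfl fun j _ => by rw [mul_comm]; rfl)
    -- At `p` the derivative is the shear `v ↦ v + v 0 • B p`. As `B p` has zero first component,
    -- the opposite shear is its inverse, and the inverse function theorem applies.
    let A : Euc d ≃L[ℝ] Euc d := ContinuousLinearEquiv.equivOfInverse (f' p)
      (ContinuousLinearMap.id ℝ (Euc d) -
        (EuclideanSpace.proj (0 : Fin d) : Euc d →L[ℝ] ℝ).smulRight (B p))
      (fun v => by simp [hf'b p hp0.symm, hB0]) (fun v => by simp [hf'b p hp0.symm, hB0])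
    have hcd : ContDiff ℝ 1 f := contDiff_one_iff_hasFDerivAt.2
      ⟨f', by simpa using hf'lip.continuousOn, hf⟩
    have hA : HasFDerivAt f (A : Euc d →L[ℝ] Euc d) p := hf p
    let Φ₀ := hcd.contDiffAt.toOpenPartialHomeomorph f hA one_ne_zero
    have hΦ₀ : (Φ₀ : Euc d → Euc d) = f := rfl
    have hp₀ : p ∈ Φ₀.source := hcd.contDiffAt.mem_toOpenPartialHomeomorph_source hA one_ne_zero
    -- Restrict to the points where the derivative stays invertible and where `b` agrees with the
    -- components of the normal direction.
    set U : Set (Euc d) := f' ⁻¹' range ((↑) : (Euc d ≃L[ℝ] Euc d) → Euc d →L[ℝ] Euc d) ∩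
      Metric.ball p r
    have hU : IsOpen U := (ContinuousLinearEquiv.isOpen.preimage
      (by simpa using hf'lip.continuousOn)).inter Metric.isOpen_ball
    have hpU : p ∈ U := ⟨⟨A, rfl⟩, Metric.mem_ball_self hr⟩
    let Φ := Φ₀.restrOpen U hU
    have hΦ : (Φ : Euc d → Euc d) = f := rfl
    have hsrc : Φ.source = Φ₀.source ∩ U := rfl
    have hW : IsW2InftyOn Φ Φ.source := isW2InftyOn_of_hasFDerivAt Φ.open_source hf hf'lip
    refine ⟨Φ, ?_, hW, ?_, fun x _ => hf0 x, ?_⟩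
    · have := Φ.map_source (x := p) ⟨hp₀, hpU⟩
      rwa [hΦ, hfb p hp0.symm] at this
    · refine Φ.isW2InftyOn_symm hW fun x hx => ?_
      rw [hΦ, (hf x).fderiv]
      exact hx.2.1
    · intro x hx hxV hx0 j hj
      rw [hΦ, hfb x hx0] at *
      have hJ : ∀ i k, jacobian f Φ.source x i k = (if i = k then 1 else 0) +
          (if k = 0 then 1 else 0) * (B x) i := fun i k => by
        simp only [jacobian, Matrix.of_apply]
        rw [fderivWithin_of_isOpen Φ.open_source hx, (hf x).fderiv, hf'b x hx0]
        by_cases hk : k = 0 <;> simp [hk, eq_comm]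
      have hB : ∀ i, i ≠ 0 → (B x) i = b i x := fun i hi => by
        simp [B, e, hi, Pi.single_apply]
      have hinv : (G x) * (G x)⁻¹ = 1 := Matrix.mul_nonsing_inv _
        ((hpos x hxV).det_pos.ne'.isUnit)
      have h00 : (G x)⁻¹ 0 0 ≠ 0 := ((hpos x hxV).inv.diag_pos).ne'
      refine transpose_mul_mul_apply_eq_zero (fun i => by simp [hJ, hj]) ?_
      have hJ0 : ∀ k, jacobian f Φ.source x k 0 = (G x)⁻¹ k 0 * ((G x)⁻¹ 0 0)⁻¹ := fun k => by
        rw [hJ]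
        by_cases hk : k = 0
        · subst hk; simp [hB0, h00]
        · simp [hk, hB k hk, hb x hxV hx.2.2 k]
      have hsymm : ∀ k, G x k j = G x j k := fun k => by
        simpa using (hpos x hxV).isHermitian.apply j k
      -- Up to the normalising factor, the sum is the entry `(j, 0)` of `G * G⁻¹ = 1`.
      calc _ = (∑ k, G x j k * (G x)⁻¹ k 0) * ((G x)⁻¹ 0 0)⁻¹ := by
            rw [Finset.sum_mul]
            exact Finset.sum_congr rfl fun k _ => by rw [hJ0, hsymm]; ring
        _ = 0 := by
            have := congrFun (congrFun hinv j) 0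
            rw [Matrix.mul_apply] at this
            rw [this, Matrix.one_apply_ne hj, zero_mul]

end NormalCoordinates

/-! ### Reflection in the boundary of the half-space -/

section Reflection

variable {d : ℕ} [NeZero d]

/-- The sign of the `i`-th coordinate under the reflection in the hyperplane `y 0 = 0`. -/
def reflSign (i : Fin d) : ℝ := if i = 0 then -1 else 1

theorem reflSign_mul_self (i : Fin d) : reflSign i * reflSign i = 1 := by
  unfold reflSign; split_ifs <;> norm_num

/-- The reflection in the hyperplane `y 0 = 0`. -/
noncomputable def reflect (d : ℕ) [NeZero d] : Euc d ≃ₗᵢ[ℝ] Euc d :=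
  LinearIsometryEquiv.piLpCongrRight 2 fun i =>
    if i = 0 then LinearIsometryEquiv.neg ℝ else LinearIsometryEquiv.refl ℝ ℝ

theorem reflect_apply (y : Euc d) (i : Fin d) : reflect d y i = reflSign i * y i := by
  unfold reflSign
  by_cases h : i = 0 <;> simp [reflect, h]

@[simp]
theorem reflect_apply_zero (y : Euc d) : reflect d y 0 = -y 0 := by
  simp [reflect_apply, reflSign]

@[simp]
theorem reflect_reflect (y : Euc d) : reflect d (reflect d y) = y := by
  ext i
  rw [reflect_apply, reflect_apply, ← mul_assoc, reflSign_mul_self, one_mul]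

theorem reflect_of_zero {y : Euc d} (h : y 0 = 0) : reflect d y = y := by
  ext i
  rw [reflect_apply, reflSign]
  split_ifs with hi
  · rw [hi, h]; simp
  · simp

theorem reflect_single (i : Fin d) : reflect d (EuclideanSpace.single i 1) =
    reflSign i • EuclideanSpace.single i (1 : ℝ) := by
  ext j
  rw [reflect_apply]
  by_cases h : j = i
  · subst h; simp
  · simp [h]

theorem measurePreserving_reflect : MeasurePreserving (reflect d) volume volume :=
  (reflect d).measurePreserving

/-- The point `(|y₀|, y')` of the half-space. -/
noncomputable def fold (y : Euc d) : Euc d := if 0 ≤ y 0 then y else reflect d y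

theorem fold_of_nonneg {y : Euc d} (h : 0 ≤ y 0) : fold y = y := if_pos h

theorem fold_of_nonpos {y : Euc d} (h : y 0 ≤ 0) : fold y = reflect d y := by
  rcases h.lt_or_eq with h | h
  · exact if_neg (not_le.2 h)
  · rw [fold_of_nonneg h.ge, reflect_of_zero h]

theorem fold_reflect (y : Euc d) : fold (reflect d y) = fold y := by
  rcases le_total 0 (y 0) with h | h
  · rw [fold_of_nonneg h, fold_of_nonpos (by simpa using h), reflect_reflect]
  · rw [fold_of_nonpos h, fold_of_nonneg (by simpa using h)]

theorem fold_mem_halfSpace (y : Euc d) : fold y ∈ halfSpace d := by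
  rcases le_total 0 (y 0) with h | h
  · rw [fold_of_nonneg h]; exact h
  · rw [fold_of_nonpos h]; simpa [halfSpace] using h

theorem continuous_fold : Continuous (fold : Euc d → Euc d) :=
  Continuous.if_le continuous_id (reflect d).continuous continuous_const (continuous_coord 0)
    fun _ h => (reflect_of_zero h.symm).symm

/-- Folding always lands in the half-space, so the half-space constraint disappears. Images of
doubled charts are therefore open in the full space. -/
theorem IsHalfOpen.isOpen_preimage_fold {s : Set (Euc d)} (hs : IsHalfOpen s) :
    IsOpen (fold ⁻¹' s) := by
  obtain ⟨O, hO, rfl⟩ := hs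
  have : (fold ⁻¹' (halfSpace d ∩ O) : Set (Euc d)) = fold ⁻¹' O := by
    ext y; simp [fold_mem_halfSpace]
  rw [this]
  exact hO.preimage continuous_fold

theorem volume_hyperplane : volume {y : Euc d | y 0 = 0} = 0 := by
  let l : Euc d →L[ℝ] ℝ := EuclideanSpace.proj 0
  have h := Measure.addHaar_submodule (volume : Measure (Euc d)) (LinearMap.ker l.toLinearMap) (by
    intro h
    have : EuclideanSpace.single (0 : Fin d) (1 : ℝ) ∈ LinearMap.ker l.toLinearMap := by
      rw [h]; trivial
    simp [l] at this)
  convert h using 2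
  ext y
  simp [l]

theorem ae_coord_ne_zero : ∀ᵐ y : Euc d, y 0 ≠ 0 := by
  rw [ae_iff]
  simpa using volume_hyperplane

theorem ae_restrict_interior {s : Set (Euc d)} (hs : IsHalfOpen s) :
    ∀ᵐ y ∂volume.restrict s, y ∈ s ∧ 0 < y 0 := by
  filter_upwards [ae_restrict_mem hs.measurableSet, ae_restrict_of_ae ae_coord_ne_zero] with y hy h0
  exact ⟨hy, lt_of_le_of_ne (hs.subset hy) h0.symm⟩

theorem preimage_fold_eq {s : Set (Euc d)} (hs : s ⊆ halfSpace d) :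
    fold ⁻¹' s = s ∪ reflect d ⁻¹' s := by
  ext y
  simp only [mem_preimage, mem_union]
  rcases le_total 0 (y 0) with h | h
  · rw [fold_of_nonneg h]
    refine ⟨Or.inl, fun h' => h'.elim id fun h' => ?_⟩
    have h0 : y 0 = 0 := le_antisymm (by simpa [halfSpace] using hs h') h
    rwa [reflect_of_zero h0] at h'
  · rw [fold_of_nonpos h]
    refine ⟨Or.inr, fun h' => h'.elim (fun h' => ?_) id⟩
    have h0 : y 0 = 0 := le_antisymm h (by simpa [halfSpace] using hs h')
    rwa [reflect_of_zero h0]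

theorem integrableOn_reflect_preimage {s : Set (Euc d)} {f : Euc d → ℝ}
    (hf : IntegrableOn (fun y => f (reflect d y)) s) : IntegrableOn f (reflect d ⁻¹' s) := by
  have h := (measurePreserving_reflect (d := d)).integrableOn_comp_preimage
    (reflect d).toHomeomorph.measurableEmbedding (f := fun y => f (reflect d y)) (s := s)
  simpa [Function.comp_def] using h.2 hf

/-- The set and its mirror image meet only in the hyperplane, which is null, and the reflection
preserves volume. -/
theorem integral_preimage_fold {s : Set (Euc d)} (hs : IsHalfOpen s) {f : Euc d → ℝ}
    (h₁ : IntegrableOn f s) (h₂ : IntegrableOn (fun y => f (reflect d y)) s) :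
    ∫ y in fold ⁻¹' s, f y = ∫ y in s, (f y + f (reflect d y)) := by
  have hd : AEDisjoint volume s (reflect d ⁻¹' s) := by
    refine measure_mono_null (fun y hy => ?_) (volume_hyperplane (d := d))
    have h1 := hs.subset hy.1
    have h2 : reflect d y ∈ halfSpace d := hs.subset hy.2
    simp only [halfSpace, mem_ofPred_eq, reflect_apply_zero] at h1 h2 ⊢
    linarith
  have hm : MeasurableSet (reflect d ⁻¹' s) := (reflect d).continuous.measurable hs.measurableSet
  rw [preimage_fold_eq hs.subset, setIntegral_union₀ hd hm.nullMeasurableSet h₁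
    (integrableOn_reflect_preimage h₂), integral_add h₁ h₂]
  congr 1
  have h := (measurePreserving_reflect (d := d)).setIntegral_preimage_emb
    (reflect d).toHomeomorph.measurableEmbedding (fun y => f (reflect d y)) s
  rw [← h]
  simp

end Reflection

/-! ### Diffeomorphisms between relatively open subsets of the half-space -/

section HalfDiffeo

variable {d : ℕ} [NeZero d]

/-- `e` is a `C^1` diffeomorphism up to the boundary between relatively open subsets of the
half-space. -/
structure IsHalfDiffeo (e : PartialEquiv (Euc d) (Euc d)) : Prop where
  source : IsHalfOpen e.source
  target : IsHalfOpen e.target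
  contDiffOn : ContDiffOn ℝ 1 e e.source
  contDiffOn_symm : ContDiffOn ℝ 1 e.symm e.target
  coord_eq_zero : ∀ y ∈ e.source, e y 0 = 0 ↔ y 0 = 0

namespace IsHalfDiffeo

variable {e : PartialEquiv (Euc d) (Euc d)}

theorem symm (he : IsHalfDiffeo e) : IsHalfDiffeo e.symm :=
  ⟨he.target, he.source, he.contDiffOn_symm, he.contDiffOn, fun y hy => by
    have := he.coord_eq_zero _ (e.map_target hy)
    rw [e.right_inv hy] at this
    exact this.symm⟩

theorem map_interior (he : IsHalfDiffeo e) {y : Euc d} (hy : y ∈ e.source) (h0 : 0 < y 0) :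
    0 < e y 0 :=
  lt_of_le_of_ne (he.target.subset (e.map_source hy)) fun h =>
    h0.ne' ((he.coord_eq_zero y hy).1 h.symm)

theorem jacobian_symm_mul (he : IsHalfDiffeo e) {y : Euc d} (hy : y ∈ e.source) :
    jacobian e.symm e.target (e y) * jacobian e e.source y = 1 := by
  rw [← jacobian_comp (he.contDiffOn_symm.differentiableOn one_ne_zero _ (e.map_source hy))
    (he.contDiffOn.differentiableOn one_ne_zero _ hy) e.mapsTo (he.source.uniqueDiffOn y hy),
    jacobian_congr (f := e.symm ∘ e) (g := id) (fun z hz => e.left_inv hz) hy,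
    jacobian_id (he.source.uniqueDiffOn y hy)]

theorem det_ne_zero (he : IsHalfDiffeo e) {y : Euc d} (hy : y ∈ e.source) :
    (jacobian e e.source y).det ≠ 0 := by
  have := congrArg Matrix.det (he.jacobian_symm_mul hy)
  rw [Matrix.det_mul, Matrix.det_one] at this
  exact right_ne_zero_of_mul_eq_one this

theorem hasFDerivWithinAt (he : IsHalfDiffeo e) {y : Euc d} (hy : y ∈ e.source) :
    HasFDerivWithinAt e (fderivWithin ℝ e e.source y) e.source y :=
  (he.contDiffOn.differentiableOn one_ne_zero _ hy).hasFDerivWithinAt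

theorem integral_target (he : IsHalfDiffeo e) (h : Euc d → ℝ) :
    ∫ x in e.target, h x = ∫ y in e.source, |(jacobian e e.source y).det| * h (e y) := by
  rw [← e.image_source_eq_target, integral_image_eq_integral_abs_det_fderiv_smul volume
    he.source.measurableSet (fun y hy => he.hasFDerivWithinAt hy) e.injOn]
  simp only [jacobian_det, smul_eq_mul]

theorem integral_source (he : IsHalfDiffeo e) (h : Euc d → ℝ) :
    ∫ y in e.source, h y =
      ∫ x in e.target, |(jacobian e.symm e.target x).det| * h (e.symm x) :=
  he.symm.integral_target h

theorem continuousOn_fderivWithin (he : IsHalfDiffeo e) :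
    ContinuousOn (fderivWithin ℝ e e.source) e.source :=
  he.contDiffOn.continuousOn_fderivWithin he.source.uniqueDiffOn le_rfl

theorem continuousOn_jacobian (he : IsHalfDiffeo e) (i j : Fin d) :
    ContinuousOn (fun y => jacobian e e.source y i j) e.source := by
  simp only [jacobian, Matrix.of_apply]
  exact (continuous_coord i).comp_continuousOn
    (he.continuousOn_fderivWithin.clm_apply continuousOn_const)

theorem continuousOn_jacobian' (he : IsHalfDiffeo e) :
    ContinuousOn (fun y => jacobian e e.source y) e.source :=
  continuousOn_pi.2 fun i => continuousOn_pi.2 fun j => he.continuousOn_jacobian i j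

theorem continuousOn_abs_det (he : IsHalfDiffeo e) :
    ContinuousOn (fun y => |(jacobian e e.source y).det|) e.source :=
  (Continuous.matrix_det continuous_id).abs.comp_continuousOn he.continuousOn_jacobian'

theorem image_isCompact (he : IsHalfDiffeo e) {K : Set (Euc d)} (hK : IsCompact K)
    (hKs : K ⊆ e.source) : IsCompact (e '' K) :=
  hK.image_of_continuousOn (he.contDiffOn.continuousOn.mono hKs)

/-- The density of the pushed-forward volume is the Jacobian determinant of the inverse map, which
is bounded on the compact image. -/
theorem map_restrict_le (he : IsHalfDiffeo e) {K : Set (Euc d)} (hK : IsCompact K)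
    (hKs : K ⊆ e.source) :
    ∃ C : NNReal, (volume.restrict K).map e ≤ C • volume.restrict (e '' K) := by
  obtain ⟨C, hC⟩ := (he.image_isCompact hK hKs).exists_bound_of_continuousOn
    (he.symm.continuousOn_abs_det.mono (image_subset_iff.2 fun y hy => e.map_source (hKs hy)))
  refine ⟨C.toNNReal, Measure.le_iff.2 fun A hA => ?_⟩
  have hem : AEMeasurable e (volume.restrict K) :=
    (he.contDiffOn.continuousOn.mono hKs).aemeasurable hK.measurableSet
  have hAm : MeasurableSet (A ∩ e '' K) :=
    hA.inter (he.image_isCompact hK hKs).measurableSet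
  have hsub : A ∩ e '' K ⊆ e.target := by
    rintro _ ⟨_, y, hy, rfl⟩
    exact e.map_source (hKs hy)
  have himg : e.symm '' (A ∩ e '' K) = e ⁻¹' A ∩ K := by
    ext y
    constructor
    · rintro ⟨_, ⟨hA', z, hz, rfl⟩, rfl⟩
      rw [e.left_inv (hKs hz)]
      exact ⟨hA', hz⟩
    · rintro ⟨hyA, hyK⟩
      exact ⟨e y, ⟨hyA, y, hyK, rfl⟩, e.left_inv (hKs hyK)⟩
  rw [Measure.map_apply_of_aemeasurable hem hA, Measure.smul_apply, Measure.restrict_apply hA,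
    Measure.restrict_apply₀' hK.measurableSet.nullMeasurableSet, ← himg,
    ← lintegral_abs_det_fderiv_eq_addHaar_image volume hAm
      (fun x hx => (he.symm.hasFDerivWithinAt (hsub hx)).mono hsub) (e.symm.injOn.mono hsub)]
  calc _ ≤ ∫⁻ _ in A ∩ e '' K, ENNReal.ofReal C := by
        refine setLIntegral_mono' hAm fun x hx => ENNReal.ofReal_le_ofReal ?_
        have := hC x hx.2
        rw [Real.norm_eq_abs, abs_abs, jacobian_det] at this
        exact this
    _ = _ := by rw [setLIntegral_const]; rfl

/-- The constant does not depend on `f`, so L² convergence passes through changes of coordinates. -/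
theorem eLpNorm_comp_le (he : IsHalfDiffeo e) {K : Set (Euc d)} (hK : IsCompact K)
    (hKs : K ⊆ e.source) :
    ∃ C : NNReal, ∀ f : Euc d → ℝ, AEStronglyMeasurable f (volume.restrict (e '' K)) →
      AEStronglyMeasurable (f ∘ e) (volume.restrict K) ∧
      eLpNorm (f ∘ e) 2 (volume.restrict K) ≤ C * eLpNorm f 2 (volume.restrict (e '' K)) := by
  obtain ⟨C, hC⟩ := he.map_restrict_le hK hKs
  have hem : AEMeasurable e (volume.restrict K) :=
    (he.contDiffOn.continuousOn.mono hKs).aemeasurable hK.measurableSet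
  refine ⟨C ^ ((2 : ENNReal).toReal⁻¹), fun f hf => ?_⟩
  have hf' : AEStronglyMeasurable f ((volume.restrict K).map e) :=
    (hf.smul_measure C).mono_measure hC
  refine ⟨hf'.comp_aemeasurable hem, ?_⟩
  rw [← eLpNorm_map_measure hf' hem]
  refine (eLpNorm_mono_measure f hC).trans ?_
  have := eLpNorm_smul_measure_of_ne_top' (p := 2) (by simp) C f
    (μ := volume.restrict (e '' K))
  rw [this]
  rfl

end IsHalfDiffeo

end HalfDiffeo

/-! ### Weak gradients -/

section WeakGradient

variable {d : ℕ}

theorem IsLocL2.integrableOn {s K : Set (Euc d)} {u : Euc d → ℝ} (hu : IsLocL2 s u) (hK : IsCompact K)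
    (hKs : K ⊆ s) : IntegrableOn u K := by
  have : IsFiniteMeasure (volume.restrict K) := ⟨by simpa using hK.measure_lt_top⟩
  exact (hu K hKs hK).integrable one_le_two

theorem IsLocL2.mono {s t : Set (Euc d)} {u : Euc d → ℝ} (hu : IsLocL2 s u) (h : t ⊆ s) :
    IsLocL2 t u := fun K hK hKc => hu K (hK.trans h) hKc

theorem integrableOn_mul_of_support {s K : Set (Euc d)} {u g : Euc d → ℝ} (hs : MeasurableSet s)
    (hK : IsCompact K) (hu : IntegrableOn u K) (hg : ContinuousOn g K)
    (hg0 : ∀ y ∈ s, y ∉ K → g y = 0) : IntegrableOn (fun y => u y * g y) s := by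
  have h1 : IntegrableOn (fun y => u y * g y) K := hu.mul_continuousOn hg hK
  exact h1.of_forall_sdiff_eq_zero hs fun y hy => by rw [hg0 y hy.1 hy.2, mul_zero]

/-- Dominated convergence for test functions living on a fixed compact set, where `u` is known to be
integrable. It serves both for mollification and for cutting off near the boundary. -/
theorem tendsto_setIntegral_mul_of_bounded {s K : Set (Euc d)} {u g₀ : Euc d → ℝ}
    {g : ℕ → Euc d → ℝ} {C : ℝ} (hs : MeasurableSet s) (hK : MeasurableSet K) (hKs : K ⊆ s)
    (hu : IntegrableOn u K) (hgm : ∀ n, AEStronglyMeasurable (g n) (volume.restrict s))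
    (hgC : ∀ n, ∀ y ∈ K, |g n y| ≤ C) (hg : ∀ n, ∀ y ∈ s, y ∉ K → g n y = 0)
    (hg₀ : ∀ y ∈ s, y ∉ K → g₀ y = 0)
    (hlim : ∀ᵐ y ∂volume.restrict s, Tendsto (fun n => g n y) atTop (𝓝 (g₀ y))) :
    Tendsto (fun n => ∫ y in s, u y * g n y) atTop (𝓝 (∫ y in s, u y * g₀ y)) := by
  have red : ∀ f : Euc d → ℝ, (∀ y ∈ s, y ∉ K → f y = 0) →
      ∫ y in s, u y * f y = ∫ y in K, u y * f y := fun f hf =>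
    setIntegral_eq_of_subset_of_forall_sdiff_eq_zero hs hKs fun y hy => by
      rw [hf y hy.1 hy.2, mul_zero]
  rw [red g₀ hg₀]
  simp only [fun n => red (g n) (hg n)]
  refine tendsto_integral_of_dominated_convergence (fun y => |u y| * C)
    (fun n => hu.aestronglyMeasurable.mul ((hgm n).mono_set hKs)) (hu.abs.mul_const C)
    (fun n => ?_) ?_
  · filter_upwards [ae_restrict_mem hK] with y hy
    rw [norm_mul, Real.norm_eq_abs, Real.norm_eq_abs]
    exact mul_le_mul_of_nonneg_left (hgC n y hy) (abs_nonneg _)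
  · filter_upwards [ae_restrict_of_ae_restrict_of_subset hKs hlim] with y hy
    exact hy.const_mul _

theorem contDiff_indicator_of_compact {U K : Set (Euc d)} (hU : IsOpen U) (hK : IsCompact K)
    (hKU : K ⊆ U) {h : Euc d → ℝ} {n : WithTop ℕ∞} (hh : ContDiffOn ℝ n h U)
    (h0 : ∀ y ∈ U, y ∉ K → h y = 0) : ContDiff ℝ n (U.indicator h) := by
  rw [contDiff_iff_contDiffAt]
  intro x
  by_cases hx : x ∈ K
  · refine (hh.contDiffAt (hU.mem_nhds (hKU hx))).congr_of_eventuallyEq ?_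
    filter_upwards [hU.mem_nhds (hKU hx)] with y hy
    rw [indicator_of_mem hy]
  · refine (contDiffAt_const (c := (0 : ℝ))).congr_of_eventuallyEq ?_
    filter_upwards [hK.isClosed.isOpen_compl.mem_nhds hx] with y hy
    by_cases hyU : y ∈ U
    · rw [indicator_of_mem hyU, h0 y hyU hy]
    · rw [indicator_of_notMem hyU]

theorem hasCompactSupport_indicator_of_compact {U K : Set (Euc d)} (hK : IsCompact K)
    {h : Euc d → ℝ} (h0 : ∀ y ∈ U, y ∉ K → h y = 0) : HasCompactSupport (U.indicator h) := by
  refine HasCompactSupport.of_support_subset_isCompact hK fun y hy => ?_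
  by_contra hyK
  refine hy ?_
  by_cases hyU : y ∈ U
  · rw [indicator_of_mem hyU, h0 y hyU hyK]
  · rw [indicator_of_notMem hyU]

/-- Integration by parts when one of the factors vanishes near each point outside a compact set. -/
theorem setIntegral_mul_fderiv_eq_neg {U K : Set (Euc d)} (hU : IsOpen U) (hK : IsCompact K)
    (hKU : K ⊆ U) {v ζ : Euc d → ℝ} (hv : ContDiffOn ℝ 1 v U) (hζ : ContDiffOn ℝ 1 ζ U)
    (h0 : ∀ y ∈ U, y ∉ K → v =ᶠ[𝓝 y] 0 ∨ ζ =ᶠ[𝓝 y] 0) (e : Euc d) :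
    ∫ y in U, v y * fderiv ℝ ζ y e = -∫ y in U, fderiv ℝ v y e * ζ y := by
  have hcd : ContDiffOn ℝ 1 (fun y => v y * ζ y) U := hv.mul hζ
  have hz : ∀ y ∈ U, y ∉ K → v y * ζ y = 0 := fun y hy hyK => by
    rcases h0 y hy hyK with h | h <;> simp [h.eq_of_nhds]
  have hh := contDiff_indicator_of_compact hU hK hKU hcd hz
  -- The product extended by zero is C¹ with compact support, and testing it against the constant 1
  -- shows that its derivative has zero integral.
  have hint : ∫ y, fderiv ℝ (U.indicator fun y => v y * ζ y) y e = 0 := by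
    have := integral_fderiv_mul_eq (f := fun _ => (1 : ℝ)) (L := 0) (LipschitzWith.const _)
      hh (hasCompactSupport_indicator_of_compact hK hz) e
    simpa using this
  have hd : ∀ y ∈ U, fderiv ℝ (U.indicator fun y => v y * ζ y) y e =
      v y * fderiv ℝ ζ y e + fderiv ℝ v y e * ζ y := fun y hy => by
    have h1 : (U.indicator fun y => v y * ζ y) =ᶠ[𝓝 y] fun y => v y * ζ y := by
      filter_upwards [hU.mem_nhds hy] with z hz
      rw [indicator_of_mem hz]
    rw [h1.fderiv_eq, fderiv_fun_mul ((hv.contDiffAt (hU.mem_nhds hy)).differentiableAt one_ne_zero)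
      ((hζ.contDiffAt (hU.mem_nhds hy)).differentiableAt one_ne_zero)]
    simp [mul_comm]
  have hd0 : ∀ y, y ∉ U → fderiv ℝ (U.indicator fun y => v y * ζ y) y e = 0 := fun y hy => by
    have h1 : (U.indicator fun y => v y * ζ y) =ᶠ[𝓝 y] fun _ => 0 := by
      filter_upwards [hK.isClosed.isOpen_compl.mem_nhds fun h => hy (hKU h)] with z hz'
      by_cases hzU : z ∈ U
      · rw [indicator_of_mem hzU, hz z hzU hz']
      · rw [indicator_of_notMem hzU]
    rw [h1.fderiv_eq]; simp
  have hv0 : ∀ y ∈ U, y ∉ K → v y * fderiv ℝ ζ y e = 0 := fun y hy hyK => by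
    rcases h0 y hy hyK with h | h
    · simp [h.eq_of_nhds]
    · rw [h.fderiv_eq]; simp
  have hζ0 : ∀ y ∈ U, y ∉ K → fderiv ℝ v y e * ζ y = 0 := fun y hy hyK => by
    rcases h0 y hy hyK with h | h
    · rw [h.fderiv_eq]; simp
    · simp [h.eq_of_nhds]
  have hc : ∀ {f : Euc d → ℝ}, ContDiffOn ℝ 1 f U → ContinuousOn (fun y => fderiv ℝ f y e) U :=
    fun hf => (hf.continuousOn_fderiv_of_isOpen hU le_rfl).clm_apply continuousOn_const
  have i1 : IntegrableOn (fun y => v y * fderiv ℝ ζ y e) U :=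
    (((hv.continuousOn.mul (hc hζ)).mono hKU).integrableOn_compact hK).of_forall_sdiff_eq_zero
      hU.measurableSet fun y hy => hv0 y hy.1 hy.2
  have i2 : IntegrableOn (fun y => fderiv ℝ v y e * ζ y) U :=
    ((((hc hv).mul hζ.continuousOn).mono hKU).integrableOn_compact hK).of_forall_sdiff_eq_zero
      hU.measurableSet fun y hy => hζ0 y hy.1 hy.2
  rw [← setIntegral_eq_integral_of_forall_compl_eq_zero (s := U) hd0,
    setIntegral_congr_fun hU.measurableSet hd, integral_add i1 i2] at hint
  linarith

/-! ### Weak gradients tested against continuous fields. -/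

section Mollification

open ContinuousLinearMap

/-- The derivative falls on the smooth kernel, so continuity of `b` is enough. -/
theorem fderiv_convolution_apply {ρ b : Euc d → ℝ} (hρ : ContDiff ℝ ∞ ρ) (hρc : HasCompactSupport ρ)
    (hb : Continuous b) (y v : Euc d) :
    fderiv ℝ (convolution ρ b (lsmul ℝ ℝ) volume) y v = ∫ z, b z * fderiv ℝ ρ (y - z) v := by
  have h1 := hρc.hasFDerivAt_convolution_left (lsmul ℝ ℝ) (hρ.of_le (by simp))
    (hb.locallyIntegrable (μ := volume)) y
  rw [h1.fderiv, convolution_def, ContinuousLinearMap.integral_apply]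
  · rw [← integral_sub_left_eq_self _ volume y]
    congr 1; ext z
    simp [precompL_apply, mul_comm]
  · have hc := hρ.continuous_fderiv (by simp)
    refine Continuous.integrable_of_hasCompactSupport
      ((((lsmul ℝ ℝ).precompL (Euc d)).continuous.comp hc).clm_apply
        (hb.comp (continuous_const.sub continuous_id))) ?_
    refine (hρc.fderiv (𝕜 := ℝ)).mono fun t ht ht0 => ht ?_
    simp only [ht0, map_zero, zero_apply]

/-- The field `b` is only continuous, and `hdiv` says that its distributional divergence is the
continuous function `a`. Mollified fields are admissible smooth test fields whose divergence is the
mollified `a`, and one passes to the limit. Such fields arise from smooth test functions carried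
along a C¹ diffeomorphism. -/
theorem IsWeakGradient.integral_mul_field {s K : Set (Euc d)} (hs : MeasurableSet s) {u : Euc d → ℝ}
    {w : Euc d → Fin d → ℝ} (h : IsWeakGradient s u w) (hu : IsLocL2 s u)
    (hw : ∀ i, IsLocL2 s fun y => w y i) (hK : IsCompact K) (hKs : K ⊆ interior s) {a : Euc d → ℝ}
    {b : Fin d → Euc d → ℝ} (ha : Continuous a) (hb : ∀ j, Continuous (b j))
    (ha0 : ∀ y ∉ K, a y = 0) (hb0 : ∀ j, ∀ y ∉ K, b j y = 0)
    (hdiv : ∀ f : Euc d → ℝ, ContDiff ℝ ∞ f →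
      ∫ y, a y * f y = -∑ j, ∫ y, b j y * fderiv ℝ f y (EuclideanSpace.single j 1)) :
    ∫ y in s, u y * a y = -∑ j, ∫ y in s, w y j * b j y := by
  obtain ⟨δ, hδ, hδs⟩ := hK.exists_cthickening_subset_open isOpen_interior hKs
  set K₁ := Metric.cthickening δ K with hK₁_def
  have hK₁ : IsCompact K₁ := hK.cthickening
  have hK₁s : K₁ ⊆ s := hδs.trans interior_subset
  have cs : ∀ {g : Euc d → ℝ}, (∀ y ∉ K, g y = 0) → HasCompactSupport g := fun hg =>
    HasCompactSupport.of_support_subset_isCompact hK fun y hy => by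
      by_contra hyK; exact hy (hg y hyK)
  -- The shift by 2 keeps every outer radius strictly below `δ`, so that all mollified functions are
  -- supported in `K₁`.
  let φ : ℕ → ContDiffBump (0 : Euc d) := fun n =>
    ⟨δ / (n + 2) / 2, δ / (n + 2), by positivity, by
      have : 0 < δ / ((n : ℝ) + 2) := by positivity
      linarith⟩
  have hφδ : ∀ n, (φ n).rOut < δ := fun n => by
    change δ / ((n : ℝ) + 2) < δ
    exact div_lt_self hδ (by have := n.cast_nonneg (α := ℝ); linarith)
  have hφ0 : Tendsto (fun n => (φ n).rOut) atTop (𝓝 0) := by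
    change Tendsto (fun n : ℕ => δ / ((n : ℝ) + 2)) atTop (𝓝 0)
    exact tendsto_const_nhds.div_atTop
      (tendsto_atTop_add_const_right _ _ tendsto_natCast_atTop_atTop)
  let m : ℕ → (Euc d → ℝ) → Euc d → ℝ := fun n g => convolution ((φ n).normed volume) g (lsmul ℝ ℝ) volume
  have hρ : ∀ n, ContDiff ℝ ∞ ((φ n).normed volume) := fun n => (φ n).contDiff_normed
  have hρc : ∀ n, HasCompactSupport ((φ n).normed volume) := fun n => (φ n).hasCompactSupport_normed
  have hm0 : ∀ n (g : Euc d → ℝ), (∀ y ∉ K, g y = 0) → ∀ y ∉ K₁, m n g y = 0 := by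
    intro n g hg y hy
    by_contra hne
    have h1 := support_convolution_subset (lsmul ℝ ℝ) (μ := (volume : Measure (Euc d))) hne
    obtain ⟨p, hp, q, hq, rfl⟩ := h1
    refine hy ?_
    rw [(φ n).support_normed_eq, Metric.mem_ball, dist_zero_right] at hp
    refine Metric.mem_cthickening_of_dist_le _ q δ K (by by_contra hqK; exact hq (hg q hqK)) ?_
    simpa using (hp.trans (hφδ n)).le
  have hms : ∀ n (g : Euc d → ℝ), Continuous g → ContDiff ℝ ∞ (m n g) := fun n g hg =>
    (hρc n).contDiff_convolution_left _ (hρ n) (hg.locallyIntegrable (μ := volume))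
  have lim : ∀ (f g : Euc d → ℝ), IsLocL2 s f → Continuous g → (∀ y ∉ K, g y = 0) →
      Tendsto (fun n => ∫ y in s, f y * m n g y) atTop (𝓝 (∫ y in s, f y * g y)) := by
    intro f g hf hg hg0
    obtain ⟨C, hC⟩ := (cs hg0).exists_bound_of_continuous hg
    -- A mollification differs from `g` by at most the oscillation `2 * C`, and `g` is bounded by
    -- `C`.
    refine tendsto_setIntegral_mul_of_bounded (C := 3 * C) hs hK₁.measurableSet hK₁s
      (hf.integrableOn hK₁ hK₁s) (fun n => (hms n g hg).continuous.aestronglyMeasurable)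
      (fun n y _ => ?_) (fun n y _ hy => hm0 n g hg0 y hy)
      (fun y _ hy => hg0 y fun hyK => hy (Metric.self_subset_cthickening _ hyK))
      (Eventually.of_forall fun y =>
        ContDiffBump.convolution_tendsto_right_of_continuous hφ0 hg y)
    have h1 : dist (m n g y) (g y) ≤ 2 * C :=
      ContDiffBump.dist_normed_convolution_le hg.aestronglyMeasurable fun x _ => by
        rw [dist_eq_norm]
        linarith [norm_sub_le (g x) (g y), hC x, hC y]
    rw [dist_eq_norm] at h1
    have h2 := norm_le_norm_add_norm_sub' (m n g y) (g y)
    rw [← Real.norm_eq_abs]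
    linarith [hC y]
  have key : ∀ n, ∫ y in s, u y * m n a y = -∑ j, ∫ y in s, w y j * m n (b j) y := by
    intro n
    have hts : ∀ j, tsupport (m n (b j)) ⊆ K₁ := fun j =>
      closure_minimal (fun y hy => by by_contra hyK; exact hy (hm0 n _ (hb0 j) y hyK))
        hK₁.isClosed
    have e1 : ∀ j, ∫ y in s, u y * fderiv ℝ (m n (b j)) y (EuclideanSpace.single j 1) =
        -∫ y in s, w y j * m n (b j) y := fun j =>
      h _ (hms n _ (hb j)) (hK₁.of_isClosed_subset (isClosed_tsupport _) (hts j))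
        ((hts j).trans hδs) j
    -- Apply `hdiv` to the reflected and translated kernel: mollification commutes with taking the
    -- divergence.
    have e2 : ∀ y, m n a y = ∑ j, fderiv ℝ (m n (b j)) y (EuclideanSpace.single j 1) := by
      intro y
      have hf : ContDiff ℝ ∞ fun z => (φ n).normed volume (y - z) :=
        (hρ n).comp (contDiff_const.sub contDiff_id)
      have h1 : m n a y = ∫ z, a z * (φ n).normed volume (y - z) := by
        change (convolution _ _ _ _) y = _
        rw [convolution_def, ← integral_sub_left_eq_self _ volume y]
        congr 1; ext z; simp [mul_comm]
      rw [h1, hdiv _ hf, ← Finset.sum_neg_distrib]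
      refine Finset.sum_congr rfl fun j _ => ?_
      rw [fderiv_convolution_apply (hρ n) (hρc n) (hb j), ← integral_neg]
      congr 1; ext z
      have h2 : HasFDerivAt (fun z => (φ n).normed volume (y - z))
          ((fderiv ℝ ((φ n).normed volume) (y - z)).comp (-ContinuousLinearMap.id ℝ (Euc d))) z :=
        HasFDerivAt.comp z (((hρ n).differentiable (by simp)) _).hasFDerivAt
          ((hasFDerivAt_id (𝕜 := ℝ) z).const_sub y)
      rw [h2.fderiv]; simp
    simp only [e2, Finset.mul_sum]
    rw [integral_finsetSum, ← Finset.sum_neg_distrib]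
    · exact Finset.sum_congr rfl fun j _ => e1 j
    · intro j _
      refine integrableOn_mul_of_support hs hK₁ (hu.integrableOn hK₁ hK₁s)
        (continuous_partialDeriv (hms n _ (hb j)) _).continuousOn fun y _ hy => ?_
      have : fderiv ℝ (m n (b j)) y = 0 := by
        by_contra h3
        exact hy (hts j (support_fderiv_subset ℝ h3))
      rw [this]; rfl
  have l1 := lim u a hu ha ha0
  have l2 : Tendsto (fun n => -∑ j, ∫ y in s, w y j * m n (b j) y) atTop
      (𝓝 (-∑ j, ∫ y in s, w y j * b j y)) :=
    (tendsto_finsetSum _ fun j _ => lim (fun y => w y j) (b j) (hw j) (hb j) (hb0 j)).neg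
  simp only [key] at l1
  exact tendsto_nhds_unique l1 l2

end Mollification

end WeakGradient

/-! ### Transport of L² functions and weak gradients by C¹ diffeomorphisms. -/

section WeakGradient

variable {d : ℕ}

theorem IsLocL2.continuousOn_mul {s : Set (Euc d)} {u c : Euc d → ℝ} (hu : IsLocL2 s u)
    (hc : ContinuousOn c s) : IsLocL2 s fun y => c y * u y := fun K hKs hK => by
  obtain ⟨C, hC⟩ := hK.exists_bound_of_continuousOn (hc.mono hKs)
  refine (hu K hKs hK).of_le_mul (c := C) (((hc.mono hKs).aestronglyMeasurable
    hK.measurableSet).mul (hu K hKs hK).aestronglyMeasurable) ?_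
  filter_upwards [ae_restrict_mem hK.measurableSet] with y hy
  rw [norm_mul]
  exact mul_le_mul_of_nonneg_right (hC y hy) (norm_nonneg _)

theorem IsLocL2.sum {s : Set (Euc d)} {ι : Type*} {t : Finset ι} {u : ι → Euc d → ℝ}
    (hu : ∀ i ∈ t, IsLocL2 s (u i)) : IsLocL2 s fun y => ∑ i ∈ t, u i y := fun K hKs hK =>
  memLp_finsetSum t fun i hi => hu i hi K hKs hK

theorem IsLocL2.congr {s : Set (Euc d)} {u v : Euc d → ℝ} (hu : IsLocL2 s u)
    (h : ∀ᵐ y ∂volume.restrict s, u y = v y) : IsLocL2 s v := fun K hKs hK =>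
  (hu K hKs hK).ae_eq (ae_restrict_of_ae_restrict_of_subset hKs h)

variable [NeZero d]

theorem IsHalfOpen.setIntegral_interior {s : Set (Euc d)} (hs : IsHalfOpen s) (g : Euc d → ℝ) :
    ∫ y in s, g y = ∫ y in interior s, g y := by
  refine setIntegral_congr_set ?_
  filter_upwards [ae_coord_ne_zero] with y hy0
  refine propext ⟨fun hy => ?_, fun hy => interior_subset hy⟩
  change y ∈ interior s
  rw [hs.interior_eq]
  exact ⟨hy, lt_of_le_of_ne (hs.subset hy) hy0.symm⟩

namespace IsHalfDiffeo

variable {e : PartialEquiv (Euc d) (Euc d)}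

theorem isLocL2_comp (he : IsHalfDiffeo e) {u : Euc d → ℝ} (hu : IsLocL2 e.target u) :
    IsLocL2 e.source (u ∘ e) := fun K hKs hK => by
  obtain ⟨C, hC⟩ := he.eLpNorm_comp_le hK hKs
  have hu' := hu (e '' K) (image_subset_iff.2 fun y hy => e.map_source (hKs hy))
    (he.image_isCompact hK hKs)
  obtain ⟨h1, h2⟩ := hC u hu'.aestronglyMeasurable
  exact ⟨h1, h2.trans_lt (ENNReal.mul_lt_top ENNReal.coe_lt_top hu'.2)⟩

theorem isLocL2_transpose_mulVec (he : IsHalfDiffeo e) {w : Euc d → Fin d → ℝ}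
    (hw : ∀ i, IsLocL2 e.target fun y => w y i) (i : Fin d) :
    IsLocL2 e.source fun y => ((jacobian e e.source y)ᵀ *ᵥ w (e y)) i := by
  simp only [Matrix.mulVec, dotProduct, Matrix.transpose_apply]
  exact IsLocL2.sum fun j _ => (he.isLocL2_comp (hw j)).continuousOn_mul
    (he.continuousOn_jacobian j i)

/-- The support is carried to a compact subset of the interior of the target, so extending by zero
creates no jump. The Jacobian factor makes integration against this function the same as integration
against `g` in the source. -/
theorem continuous_indicator (he : IsHalfDiffeo e) {K : Set (Euc d)} (hK : IsCompact K)
    (hKs : K ⊆ interior e.source) {g : Euc d → ℝ} (hg : ContinuousOn g e.source)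
    (hg0 : ∀ y ∈ e.source, y ∉ K → g y = 0) :
    Continuous (e.target.indicator fun x => |(jacobian e.symm e.target x).det| * g (e.symm x)) := by
  rw [continuous_iff_continuousAt]
  intro x
  have hKs' := hKs.trans interior_subset
  by_cases hx : x ∈ e '' K
  · obtain ⟨y, hy, rfl⟩ := hx
    have hint : e y ∈ interior e.target := by
      have := hKs hy
      rw [he.source.interior_eq] at this
      rw [he.target.interior_eq]
      exact ⟨e.map_source this.1, he.map_interior this.1 this.2⟩
    have hnh : e.target ∈ 𝓝 (e y) := mem_interior_iff_mem_nhds.1 hint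
    have hc : ContinuousOn (fun x => |(jacobian e.symm e.target x).det| * g (e.symm x)) e.target :=
      he.symm.continuousOn_abs_det.mul
        (hg.comp he.contDiffOn_symm.continuousOn e.symm.mapsTo)
    refine (hc.continuousAt hnh).congr ?_
    filter_upwards [hnh] with z hz
    rw [indicator_of_mem hz]
  · have hcl := (he.image_isCompact hK hKs').isClosed.isOpen_compl
    refine (continuousAt_const (y := (0 : ℝ))).congr ?_
    filter_upwards [hcl.mem_nhds hx] with z hz
    by_cases hzt : z ∈ e.target
    · rw [indicator_of_mem hzt, hg0 _ (e.map_target hzt), mul_zero]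
      exact fun hzK => hz ⟨_, hzK, e.right_inv hzt⟩
    · rw [indicator_of_notMem hzt]

omit [NeZero d] in
theorem indicator_eq_zero {e : PartialEquiv (Euc d) (Euc d)} {K : Set (Euc d)} {g : Euc d → ℝ}
    (hg0 : ∀ y ∈ e.source, y ∉ K → g y = 0) :
    ∀ x ∉ e '' K,
      (e.target.indicator fun x => |(jacobian e.symm e.target x).det| * g (e.symm x)) x = 0 := by
  intro x hx
  by_cases hxt : x ∈ e.target
  · rw [indicator_of_mem hxt, hg0 _ (e.map_target hxt), mul_zero]
    exact fun hxK => hx ⟨_, hxK, e.right_inv hxt⟩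
  · rw [indicator_of_notMem hxt]

theorem integral_mul_indicator (he : IsHalfDiffeo e) (f g : Euc d → ℝ) :
    ∫ x in e.target, f x *
      (e.target.indicator fun x => |(jacobian e.symm e.target x).det| * g (e.symm x)) x =
      ∫ y in e.source, f (e y) * g y := by
  rw [he.integral_source]
  refine setIntegral_congr_fun he.target.measurableSet fun x hx => ?_
  simp only [indicator_of_mem hx, e.right_inv hx]
  ring

theorem integral_indicator_mul (he : IsHalfDiffeo e) (f g : Euc d → ℝ) :
    ∫ x, (e.target.indicator fun x => |(jacobian e.symm e.target x).det| * g (e.symm x)) x * f x =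
      ∫ y in e.source, f (e y) * g y := by
  rw [← he.integral_mul_indicator, ← setIntegral_eq_integral_of_forall_compl_eq_zero (s := e.target)]
  · simp only [mul_comm]
  · intro x hx
    rw [indicator_of_notMem hx, zero_mul]

theorem fderiv_comp_single (he : IsHalfDiffeo e) {f : Euc d → ℝ} {y : Euc d}
    (hy : y ∈ interior e.source) (hf : DifferentiableAt ℝ f (e y)) (i : Fin d) :
    fderiv ℝ (fun y => f (e y)) y (EuclideanSpace.single i 1) =
      ∑ j, jacobian e e.source y j i * fderiv ℝ f (e y) (EuclideanSpace.single j 1) := by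
  have hys := interior_subset hy
  have hnh : e.source ∈ 𝓝 y := mem_interior_iff_mem_nhds.1 hy
  have h1 := (he.hasFDerivWithinAt hys).hasFDerivAt hnh
  have h2 : HasFDerivAt (fun y => f (e y)) _ y := hf.hasFDerivAt.comp y h1
  rw [h2.fderiv, ContinuousLinearMap.comp_apply, sum_fderiv_single]
  rfl

/-- Weak gradients transform like gradients under `C^1` diffeomorphisms. -/
theorem isWeakGradient_comp (he : IsHalfDiffeo e) {u : Euc d → ℝ} {w : Euc d → Fin d → ℝ}
    (h : IsWeakGradient e.target u w) (hu : IsLocL2 e.target u)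
    (hw : ∀ i, IsLocL2 e.target fun y => w y i) :
    IsWeakGradient e.source (u ∘ e) fun y => (jacobian e e.source y)ᵀ *ᵥ w (e y) := by
  intro ζ hζ hζc hζs i
  set K := tsupport ζ
  have hK : IsCompact K := hζc
  have hKs : K ⊆ e.source := hζs.trans interior_subset
  have hz : ∀ y ∈ e.source, y ∉ K → ζ y = 0 := fun y _ hy => image_eq_zero_of_notMem_tsupport hy
  have hz' : ∀ y ∈ e.source, y ∉ K → fderiv ℝ ζ y (EuclideanSpace.single i 1) = 0 :=
    fun y _ hy => by
      have : fderiv ℝ ζ y = 0 := by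
        by_contra h3
        exact hy (support_fderiv_subset ℝ h3)
      rw [this]; rfl
  have hzJ : ∀ j, ∀ y ∈ e.source, y ∉ K → jacobian e e.source y j i * ζ y = 0 :=
    fun j y hy hyK => by rw [hz y hy hyK, mul_zero]
  have hcJ : ∀ j, ContinuousOn (fun y => jacobian e e.source y j i * ζ y) e.source := fun j =>
    (he.continuousOn_jacobian j i).mul hζ.continuous.continuousOn
  have himg : e '' K ⊆ interior e.target := by
    rw [he.target.interior_eq]
    rintro _ ⟨y, hy, rfl⟩
    have := hζs hy
    rw [he.source.interior_eq] at this
    exact ⟨e.map_source this.1, he.map_interior this.1 this.2⟩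
  -- The transported field has components `|det D(e⁻¹)| * (∂_i e_j * ζ) ∘ e⁻¹`, and its divergence
  -- is `|det D(e⁻¹)| * (∂_i ζ) ∘ e⁻¹`. No derivative of the Jacobian occurs, so C¹ regularity
  -- suffices.
  have main := h.integral_mul_field he.target.measurableSet hu hw (he.image_isCompact hK hKs) himg
    (he.continuous_indicator hK hζs
      (continuous_partialDeriv hζ (EuclideanSpace.single i 1)).continuousOn hz')
    (fun j => he.continuous_indicator hK hζs (hcJ j) (hzJ j)) (indicator_eq_zero hz')
    (fun j => indicator_eq_zero (hzJ j)) ?_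
  · rw [he.integral_mul_indicator u fun y => fderiv ℝ ζ y (EuclideanSpace.single i 1),
      Finset.sum_congr rfl fun j _ => he.integral_mul_indicator (fun y => w y j)
        fun y => jacobian e e.source y j i * ζ y] at main
    simp only [Function.comp_apply]
    rw [main, ← integral_finsetSum]
    · congr 1
      refine integral_congr_ae (Eventually.of_forall fun y => ?_)
      simp only [Matrix.mulVec, dotProduct, Matrix.transpose_apply, Finset.sum_mul]
      exact Finset.sum_congr rfl fun j _ => by ring
    · intro j _
      exact integrableOn_mul_of_support he.source.measurableSet hK
        ((he.isLocL2_comp (hw j)).integrableOn hK hKs) ((hcJ j).mono hKs) (hzJ j)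
  -- The divergence identity is checked against smooth `f`: after a change of variables it is the
  -- integration by parts of `f ∘ e` against `ζ` in the source.
  · intro f hf
    rw [he.integral_indicator_mul f fun y => fderiv ℝ ζ y (EuclideanSpace.single i 1),
      Finset.sum_congr rfl fun j _ => he.integral_indicator_mul
        (fun y => fderiv ℝ f y (EuclideanSpace.single j 1)) fun y => jacobian e e.source y j i * ζ y]
    have hint := fun g : Euc d → ℝ => he.source.setIntegral_interior g
    have hfe : ContDiffOn ℝ 1 (fun y => f (e y)) (interior e.source) :=
      (hf.of_le (by simp)).comp_contDiffOn (he.contDiffOn.mono interior_subset)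
    rw [← integral_finsetSum]
    · rw [hint, setIntegral_mul_fderiv_eq_neg isOpen_interior hK hζs hfe (hζ.of_le (by simp)).contDiffOn
        (fun y _ hyK => Or.inr (notMem_tsupport_iff_eventuallyEq.1 hyK)), hint]
      congr 1
      refine setIntegral_congr_fun isOpen_interior.measurableSet fun y hy => ?_
      simp only [he.fderiv_comp_single hy (hf.differentiable (by simp) _) i, Finset.sum_mul]
      exact Finset.sum_congr rfl fun j _ => by ring
    · intro j _
      refine integrableOn_mul_of_support he.source.measurableSet hK ?_ ((hcJ j).mono hKs) (hzJ j)
      exact (((continuous_partialDeriv hf _).comp_continuousOn he.contDiffOn.continuousOn).mono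
        hKs).integrableOn_compact hK

end IsHalfDiffeo

end WeakGradient

/-! ### Cutting off near the boundary -/

section Cutoff

variable {d : ℕ} [NeZero d]

/-- A function vanishing for `y 0 ≤ 1 / n` and equal to `1` for `y 0 ≥ 2 / n`. -/
noncomputable def boundaryCutoff (n : ℕ) (y : Euc d) : ℝ := Real.smoothTransition (n * y 0 - 1)

theorem contDiff_boundaryCutoff (n : ℕ) : ContDiff ℝ ∞ (boundaryCutoff n : Euc d → ℝ) := by
  unfold boundaryCutoff
  exact Real.smoothTransition.contDiff.comp (by fun_prop)

theorem boundaryCutoff_nonneg (n : ℕ) (y : Euc d) : 0 ≤ boundaryCutoff n y :=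
  Real.smoothTransition.nonneg _

theorem boundaryCutoff_le_one (n : ℕ) (y : Euc d) : boundaryCutoff n y ≤ 1 :=
  Real.smoothTransition.le_one _

theorem boundaryCutoff_eq_zero {n : ℕ} {y : Euc d} (h : n * y 0 ≤ 1) : boundaryCutoff n y = 0 :=
  Real.smoothTransition.zero_of_nonpos (by linarith)

theorem eventually_boundaryCutoff_eq_one {y : Euc d} (h : 0 < y 0) :
    ∀ᶠ n : ℕ in atTop, boundaryCutoff n =ᶠ[𝓝 y] 1 := by
  obtain ⟨N, hN⟩ := exists_nat_gt (2 / y 0)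
  filter_upwards [eventually_ge_atTop N] with n hn
  have h2 : 2 < n * y 0 := by
    have : (N : ℝ) ≤ n := by exact_mod_cast hn
    rw [div_lt_iff₀ h] at hN
    nlinarith
  have hc : Continuous fun z : Euc d => (n : ℝ) * z 0 := by fun_prop
  filter_upwards [hc.continuousAt.eventually (lt_mem_nhds h2)] with z hz
  exact Real.smoothTransition.one_of_one_le (by linarith)

theorem fderiv_boundaryCutoff (n : ℕ) (y : Euc d) (i : Fin d) :
    fderiv ℝ (boundaryCutoff n) y (EuclideanSpace.single i 1) =
      if i = 0 then n * deriv Real.smoothTransition (n * y 0 - 1) else 0 := by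
  have h1 : HasFDerivAt (fun y : Euc d => (n : ℝ) * y 0 - 1)
      ((n : ℝ) • (EuclideanSpace.proj 0 : Euc d →L[ℝ] ℝ)) y :=
    ((EuclideanSpace.proj 0 : Euc d →L[ℝ] ℝ).hasFDerivAt.const_mul (n : ℝ)).sub_const 1
  have h2 : HasDerivAt Real.smoothTransition
      (deriv Real.smoothTransition (n * y 0 - 1)) (n * y 0 - 1) :=
    ((Real.smoothTransition.contDiff (n := 1)).differentiable one_ne_zero _).hasDerivAt
  have h3 := h2.comp_hasFDerivAt y h1
  have h4 : Real.smoothTransition ∘ (fun y : Euc d => (n : ℝ) * y 0 - 1) = boundaryCutoff n := rfl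
  rw [h4] at h3
  rw [h3.fderiv]
  by_cases hi : i = 0
  · subst hi; simp [mul_comm]
  · simp [hi]

/-- With `t = n * y 0 - 1` this bounds `n * y 0` times the derivative of the transition. The
gradient of the cutoff grows like `n`, but stays bounded after multiplication by the distance to the
boundary. -/
theorem exists_deriv_smoothTransition_bound :
    ∃ C : ℝ, 0 ≤ C ∧ ∀ t : ℝ, |deriv Real.smoothTransition t * (t + 1)| ≤ C := by
  have hc : Continuous fun t : ℝ => deriv Real.smoothTransition t * (t + 1) :=
    ((Real.smoothTransition.contDiff (n := 1)).continuous_deriv le_rfl).mul (by fun_prop)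
  obtain ⟨C, hC⟩ := (isCompact_Icc (a := (0 : ℝ)) (b := 1)).exists_bound_of_continuousOn
    hc.continuousOn
  refine ⟨max C 0, le_max_right _ _, fun t => ?_⟩
  rcases lt_or_ge t 0 with h | h
  · have : Real.smoothTransition =ᶠ[𝓝 t] fun _ => 0 := by
      filter_upwards [gt_mem_nhds h] with s hs
      exact Real.smoothTransition.zero_of_nonpos hs.le
    rw [this.deriv_eq]; simp
  rcases lt_or_ge 1 t with h' | h'
  · have : Real.smoothTransition =ᶠ[𝓝 t] fun _ => 1 := by
      filter_upwards [lt_mem_nhds h'] with s hs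
      exact Real.smoothTransition.one_of_one_le hs.le
    rw [this.deriv_eq]; simp
  · exact (hC t ⟨h, h'⟩).trans (le_max_left _ _)

omit [NeZero d] in
/-- The gradient vanishes where the function vanishes on a relatively open set. -/
theorem grad_eq_zero_of_notMem {T K : Set (Euc d)} (hK : IsClosed K)
    {V : Euc d → ℝ} (h0 : ∀ y ∈ T, y ∉ K → V y = 0) {y : Euc d} (hy : y ∈ T) (hyK : y ∉ K)
    (i : Fin d) : grad V T y i = 0 := by
  have h1 : V =ᶠ[𝓝[T] y] fun _ => (0 : ℝ) := by
    filter_upwards [self_mem_nhdsWithin, mem_nhdsWithin_of_mem_nhds (hK.isOpen_compl.mem_nhds hyK)]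
      with z hz hzK
    exact h0 z hz hzK
  simp only [grad]
  rw [h1.fderivWithin_eq (h0 y hy hyK)]
  simp

theorem continuousOn_grad {T : Set (Euc d)} (hT : IsHalfOpen T) {V : Euc d → ℝ}
    (hV : ContDiffOn ℝ 1 V T) (i : Fin d) : ContinuousOn (fun y => grad V T y i) T :=
  (hV.continuousOn_fderivWithin hT.uniqueDiffOn le_rfl).clm_apply continuousOn_const

theorem grad_mul {T : Set (Euc d)} (hT : IsHalfOpen T) {χ V : Euc d → ℝ}
    (hV : ContDiffOn ℝ 1 V T) (hχ : ContDiff ℝ 1 χ) {y : Euc d} (hy : y ∈ T) (i : Fin d) :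
    grad (fun y => χ y * V y) T y i =
      χ y * grad V T y i + fderiv ℝ χ y (EuclideanSpace.single i 1) * V y := by
  simp only [grad]
  rw [fderivWithin_fun_mul (hT.uniqueDiffOn y hy)
    (hχ.differentiable one_ne_zero y).differentiableWithinAt (hV.differentiableOn one_ne_zero y hy),
    (hχ.differentiable one_ne_zero y).fderivWithin (hT.uniqueDiffOn y hy)]
  simp [mul_comm]

/-- In the product rule the extra term is `V` times a derivative of the cutoff. It is zero in
tangential directions and bounded when `V` is dominated by `y 0`. It disappears pointwise in the
interior, and dominated convergence applies. -/
theorem tendsto_integral_grad_boundaryCutoff {T K : Set (Euc d)} (hT : IsHalfOpen T)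
    (hK : IsCompact K) (hKT : K ⊆ T) {V : Euc d → ℝ} (hV : ContDiffOn ℝ 1 V T)
    (h0 : ∀ y ∈ T, y ∉ K → V y = 0) {F : Euc d → ℝ} (hF : IntegrableOn F K) {i : Fin d}
    (hi : i ≠ 0 ∨ ∃ L : ℝ, 0 ≤ L ∧ ∀ y ∈ T, |V y| ≤ L * y 0) :
    Tendsto (fun n => ∫ y in T, F y * grad (fun y => boundaryCutoff n y * V y) T y i) atTop
      (𝓝 (∫ y in T, F y * grad V T y i)) := by
  have hχ : ∀ n, ContDiff ℝ 1 (boundaryCutoff n : Euc d → ℝ) := fun n =>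
    (contDiff_boundaryCutoff n).of_le (by simp)
  have hVn : ∀ n, ContDiffOn ℝ 1 (fun y => boundaryCutoff n y * V y) T := fun n =>
    (hχ n).contDiffOn.mul hV
  obtain ⟨C, hC⟩ := hK.exists_bound_of_continuousOn ((continuousOn_grad hT hV i).mono hKT)
  obtain ⟨D, hD⟩ : ∃ D : ℝ, ∀ n : ℕ, ∀ y ∈ K,
      |fderiv ℝ (boundaryCutoff n) y (EuclideanSpace.single i 1) * V y| ≤ D := by
    obtain ⟨B, hB0, hB⟩ := exists_deriv_smoothTransition_bound
    rcases hi with hi | ⟨L, hLn, hL⟩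
    · exact ⟨0, fun n y _ => by rw [fderiv_boundaryCutoff, if_neg hi]; simp⟩
    · by_cases hi : i = 0
      · refine ⟨B * L, fun n y hy => ?_⟩
        rw [fderiv_boundaryCutoff, if_pos hi, abs_mul]
        have h1 := hL y (hKT hy)
        have h2 := hB (n * y 0 - 1)
        have hy0 : 0 ≤ y 0 := hT.subset (hKT hy)
        rw [sub_add_cancel, abs_mul, abs_mul, abs_of_nonneg hy0, Nat.abs_cast] at h2
        rw [abs_mul, Nat.abs_cast]
        have h3 : 0 ≤ (n : ℝ) * |deriv Real.smoothTransition (n * y 0 - 1)| := by positivity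
        calc _ ≤ (n : ℝ) * |deriv Real.smoothTransition (n * y 0 - 1)| * (L * y 0) :=
              mul_le_mul_of_nonneg_left h1 h3
          _ = (|deriv Real.smoothTransition (n * y 0 - 1)| * (n * y 0)) * L := by ring
          _ ≤ B * L := mul_le_mul_of_nonneg_right h2 hLn
      · exact ⟨0, fun n y _ => by rw [fderiv_boundaryCutoff, if_neg hi]; simp⟩
  refine tendsto_setIntegral_mul_of_bounded (C := C + D) hT.measurableSet hK.measurableSet hKT hF
    (fun n => (continuousOn_grad hT (hVn n) i).aestronglyMeasurable hT.measurableSet)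
    (fun n y hy => ?_)
    (fun n y hy hyK => grad_eq_zero_of_notMem hK.isClosed
      (fun z hz hzK => by rw [h0 z hz hzK, mul_zero]) hy hyK i)
    (fun y hy hyK => grad_eq_zero_of_notMem hK.isClosed h0 hy hyK i) ?_
  · rw [grad_mul hT hV (hχ n) (hKT hy)]
    refine (abs_add_le _ _).trans (add_le_add ?_ (hD n y hy))
    rw [abs_mul, abs_of_nonneg (boundaryCutoff_nonneg n y)]
    exact (mul_le_of_le_one_left (abs_nonneg _) (boundaryCutoff_le_one n y)).trans (hC y hy)
  · filter_upwards [ae_restrict_interior hT] with y hy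
    refine tendsto_const_nhds.congr' ?_
    filter_upwards [eventually_boundaryCutoff_eq_one hy.2] with n hn
    rw [grad_mul hT hV (hχ n) hy.1, hn.fderiv_eq, hn.eq_of_nhds]
    have : fderiv ℝ (1 : Euc d → ℝ) y = 0 := by
      rw [show (1 : Euc d → ℝ) = fun _ => 1 from rfl]; simp
    rw [this]; simp

/-- Mean value inequality between a point and its projection to the hyperplane, where `V` vanishes.
-/
theorem exists_abs_le_mul_coord {T K : Set (Euc d)} (hT : IsHalfOpen T)
    (hK : IsCompact K) (hKT : K ⊆ T) {V : Euc d → ℝ} (hV : ContDiffOn ℝ 1 V T)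
    (h0 : ∀ y ∈ T, y ∉ K → V y = 0) (hb : ∀ y ∈ T, y 0 = 0 → V y = 0) :
    ∃ L : ℝ, 0 ≤ L ∧ ∀ y ∈ T, |V y| ≤ L * y 0 := by
  obtain ⟨C, hC⟩ := hK.exists_bound_of_continuousOn
    ((hV.continuousOn_fderivWithin hT.uniqueDiffOn le_rfl).mono hKT)
  -- The segment down to the hyperplane may leave `T`. The extension by zero is differentiable on
  -- the whole half-space, which is convex.
  set V' := T.indicator V
  have hz : ∀ y ∉ K, V' y = 0 := fun y hy => by
    by_cases hyT : y ∈ T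
    · simp only [V', indicator_of_mem hyT, h0 y hyT hy]
    · simp only [V', indicator_of_notMem hyT]
  have hnear : ∀ y ∈ K, V' =ᶠ[𝓝[halfSpace d] y] V := fun y hy => by
    rw [← hT.nhdsWithin_eq (hKT hy)]
    filter_upwards [self_mem_nhdsWithin] with z hz
    simp only [V', indicator_of_mem hz]
  have hfar : ∀ y ∉ K, V' =ᶠ[𝓝 y] fun _ => 0 := fun y hy => by
    filter_upwards [hK.isClosed.isOpen_compl.mem_nhds hy] with z hzK
    exact hz z hzK
  have hd : DifferentiableOn ℝ V' (halfSpace d) := fun y hy => by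
    by_cases hyK : y ∈ K
    · exact ((hT.contDiffWithinAt hV (hKT hyK)).differentiableWithinAt one_ne_zero).congr_of_eventuallyEq
        (hnear y hyK) ((hnear y hyK).self_of_nhdsWithin hy)
    · exact ((hfar y hyK).differentiableAt_iff.2 (differentiableAt_const _)).differentiableWithinAt
  have hbound : ∀ y ∈ halfSpace d, ‖fderivWithin ℝ V' (halfSpace d) y‖ ≤ max C 0 := fun y hy => by
    by_cases hyK : y ∈ K
    · rw [(hnear y hyK).fderivWithin_eq ((hnear y hyK).self_of_nhdsWithin hy),
        ← hT.fderivWithin_eq (hKT hyK)]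
      exact (hC y hyK).trans (le_max_left _ _)
    · rw [((hfar y hyK).filter_mono nhdsWithin_le_nhds).fderivWithin_eq (hfar y hyK).eq_of_nhds]
      simp
  refine ⟨max C 0, le_max_right _ _, fun y hy => ?_⟩
  have hy0 : 0 ≤ y 0 := hT.subset hy
  set y' : Euc d := y - y 0 • EuclideanSpace.single 0 1
  have hy'0 : y' 0 = 0 := by simp [y']
  have hV'y' : V' y' = 0 := by
    by_cases h : y' ∈ T
    · simp only [V', indicator_of_mem h, hb y' h hy'0]
    · simp only [V', indicator_of_notMem h]
  have := convex_halfSpace.norm_image_sub_le_of_norm_fderivWithin_le hd hbound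
    (x := y') (y := y) hy'0.ge (hT.subset hy)
  rw [hV'y', sub_zero] at this
  simp only [V', indicator_of_mem hy] at this
  refine this.trans (le_of_eq ?_)
  simp [y', norm_smul, abs_of_nonneg hy0]

/-- A weak gradient in the interior can be tested against functions not supported in the interior,
provided these vanish on the boundary or the derivative is tangential. -/
theorem IsWeakGradient.integral_mul_fderiv_eq {T : Set (Euc d)} (hT : IsHalfOpen T) {u : Euc d → ℝ}
    {w : Euc d → Fin d → ℝ} (h : IsWeakGradient T u w) (hu : IsLocL2 T u)
    (hw : ∀ i, IsLocL2 T fun y => w y i) {η : Euc d → ℝ} (hη : ContDiff ℝ ∞ η)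
    (hηc : HasCompactSupport η) (hηT : tsupport η ∩ halfSpace d ⊆ T) (i : Fin d)
    (hi : i ≠ 0 ∨ ∀ y, y 0 = 0 → η y = 0) :
    ∫ y in T, u y * fderiv ℝ η y (EuclideanSpace.single i 1) = -∫ y in T, w y i * η y := by
  set K := tsupport η ∩ halfSpace d
  have hK : IsCompact K := hηc.isCompact.inter_right isClosed_halfSpace
  have h0 : ∀ y ∈ T, y ∉ K → η y = 0 := fun y hy hyK =>
    image_eq_zero_of_notMem_tsupport fun h' => hyK ⟨h', hT.subset hy⟩
  have hη1 : ContDiffOn ℝ 1 η T := (hη.of_le (by simp)).contDiffOn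
  have hgrad : ∀ {f : Euc d → ℝ}, ContDiff ℝ ∞ f → ∫ y in T, u y * grad f T y i =
      ∫ y in T, u y * fderiv ℝ f y (EuclideanSpace.single i 1) := fun hf =>
    setIntegral_congr_fun hT.measurableSet fun y hy => by
      simp only [grad, (hf.differentiable (by simp) y).fderivWithin (hT.uniqueDiffOn y hy)]
  have l1 := tendsto_integral_grad_boundaryCutoff hT hK hηT hη1 h0 (hu.integrableOn hK hηT) (i := i)
    (hi.imp_right fun hb => exists_abs_le_mul_coord hT hK hηT hη1 h0 fun y _ hy => hb y hy)
  have l2 : Tendsto (fun n => ∫ y in T, w y i * (boundaryCutoff n y * η y)) atTop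
      (𝓝 (∫ y in T, w y i * η y)) := by
    obtain ⟨C, hC⟩ := hK.exists_bound_of_continuousOn hη.continuous.continuousOn
    refine tendsto_setIntegral_mul_of_bounded (C := C) hT.measurableSet hK.measurableSet hηT
      ((hw i).integrableOn hK hηT)
      (fun n => ((contDiff_boundaryCutoff n).continuous.mul hη.continuous).aestronglyMeasurable)
      (fun n y hy => ?_) (fun n y hy hyK => by rw [h0 y hy hyK, mul_zero]) h0 ?_
    · rw [abs_mul, abs_of_nonneg (boundaryCutoff_nonneg n y)]
      exact (mul_le_of_le_one_left (abs_nonneg _) (boundaryCutoff_le_one n y)).trans (hC y hy)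
    · filter_upwards [ae_restrict_interior hT] with y hy
      refine tendsto_const_nhds.congr' ?_
      filter_upwards [eventually_boundaryCutoff_eq_one hy.2] with n hn
      rw [hn.eq_of_nhds]; simp
  -- Multiplication by the cutoff forces `1 ≤ n * y 0` on the support, so the product is a genuine
  -- interior test function.
  have key : ∀ n : ℕ, ∫ y in T, u y * grad (fun y => boundaryCutoff n y * η y) T y i =
      -∫ y in T, w y i * (boundaryCutoff n y * η y) := by
    intro n
    have hcd : ContDiff ℝ ∞ fun y => boundaryCutoff n y * η y := (contDiff_boundaryCutoff n).mul hη
    rw [hgrad hcd]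
    refine h _ hcd hηc.mul_left ?_ i
    have hcl : IsClosed (tsupport η ∩ {y : Euc d | 1 ≤ n * y 0}) :=
      (isClosed_tsupport _).inter (isClosed_le continuous_const (by fun_prop))
    refine (closure_minimal (fun y hy => ?_) hcl).trans fun y hy => ?_
    · rw [Function.mem_support] at hy
      refine ⟨subset_tsupport _ (right_ne_zero_of_mul hy), ?_⟩
      by_contra hlt
      exact left_ne_zero_of_mul hy (boundaryCutoff_eq_zero (not_le.1 hlt).le)
    · have h1 : (1 : ℝ) ≤ n * y 0 := hy.2
      have hpos : 0 < y 0 := by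
        by_contra hneg
        have := n.cast_nonneg (α := ℝ)
        nlinarith
      rw [hT.interior_eq]
      exact ⟨hηT ⟨hy.1, hpos.le⟩, hpos⟩
  simp only [key] at l1
  rw [← hgrad hη]
  exact tendsto_nhds_unique l1 l2.neg

end Cutoff

/-! ### Doubling maps of the half-space -/

section DoubleMap

variable {d : ℕ} [NeZero d]

/-- The extension of `θ` commuting with the reflection. -/
noncomputable def doubleMap (θ : Euc d → Euc d) (y : Euc d) : Euc d :=
  if 0 ≤ y 0 then θ y else reflect d (θ (reflect d y))

theorem doubleMap_of_nonneg {θ : Euc d → Euc d} {y : Euc d} (h : 0 ≤ y 0) :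
    doubleMap θ y = θ y := if_pos h

theorem doubleMap_of_neg {θ : Euc d → Euc d} {y : Euc d} (h : y 0 < 0) :
    doubleMap θ y = reflect d (θ (reflect d y)) := if_neg (not_le.2 h)

theorem doubleMap_of_nonpos {θ : Euc d → Euc d} {y : Euc d} (h : y 0 ≤ 0)
    (hθ : y 0 = 0 → θ y 0 = 0) : doubleMap θ y = reflect d (θ (reflect d y)) := by
  rcases h.lt_or_eq with h | h
  · exact doubleMap_of_neg h
  · rw [doubleMap_of_nonneg h.ge, reflect_of_zero h, reflect_of_zero (hθ h)]

/-- The reflection as a continuous linear map. -/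
noncomputable def reflectL (d : ℕ) [NeZero d] : Euc d →L[ℝ] Euc d :=
  ((reflect d).toContinuousLinearEquiv : Euc d →L[ℝ] Euc d)

@[simp]
theorem reflectL_apply (y : Euc d) : reflectL d y = reflect d y := rfl

theorem hasFDerivWithinAt_doubleMap_nonpos {θ : Euc d → Euc d} {W : Set (Euc d)}
    (hW : IsHalfOpen W) (hθ : ContDiffOn ℝ 1 θ W) (hb : ∀ y ∈ W, y 0 = 0 → θ y 0 = 0) {y : Euc d}
    (hy : fold y ∈ W) (h : y 0 ≤ 0) :
    HasFDerivWithinAt (doubleMap θ)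
      ((reflectL d).comp ((fderivWithin ℝ θ W (reflect d y)).comp (reflectL d))) {z | z 0 ≤ 0} y := by
  rw [fold_of_nonpos h] at hy
  have h1 := hW.hasFDerivWithinAt hθ hy
  rw [← hW.fderivWithin_eq hy] at h1
  have h2 : HasFDerivWithinAt (reflect d) (reflectL d) {z : Euc d | z 0 ≤ 0} y :=
    (reflectL d).hasFDerivWithinAt
  have h3 := (reflectL d).hasFDerivAt.comp_hasFDerivWithinAt y
    (h1.comp y h2 fun z (hz : z 0 ≤ 0) => by simpa [halfSpace] using hz)
  have hO : fold ⁻¹' W ∈ 𝓝 y := hW.isOpen_preimage_fold.mem_nhds (by rwa [mem_preimage,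
    fold_of_nonpos h])
  suffices hev : doubleMap θ =ᶠ[𝓝[{z | z 0 ≤ 0}] y] fun z => reflect d (θ (reflect d z)) by
    exact h3.congr_of_eventuallyEq hev (hev.self_of_nhdsWithin h)
  filter_upwards [self_mem_nhdsWithin, mem_nhdsWithin_of_mem_nhds hO] with z hz hzW
  rw [mem_preimage, fold_of_nonpos hz] at hzW
  refine doubleMap_of_nonpos hz fun hz0 => hb z ?_ hz0
  rwa [reflect_of_zero hz0] at hzW

theorem hasFDerivWithinAt_doubleMap_nonneg {θ : Euc d → Euc d} {W : Set (Euc d)}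
    (hW : IsHalfOpen W) (hθ : ContDiffOn ℝ 1 θ W) {y : Euc d} (hy : fold y ∈ W) (h : 0 ≤ y 0) :
    HasFDerivWithinAt (doubleMap θ) (fderivWithin ℝ θ W y) (halfSpace d) y := by
  rw [fold_of_nonneg h] at hy
  have h1 := hW.hasFDerivWithinAt hθ hy
  rw [← hW.fderivWithin_eq hy] at h1
  exact h1.congr (fun z hz => doubleMap_of_nonneg hz) (doubleMap_of_nonneg h)

/-- The derivative of `doubleMap θ`. -/
noncomputable def doubleMapDeriv (θ : Euc d → Euc d) (W : Set (Euc d)) (y : Euc d) :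
    Euc d →L[ℝ] Euc d :=
  if 0 ≤ y 0 then fderivWithin ℝ θ W y
  else (reflectL d).comp ((fderivWithin ℝ θ W (reflect d y)).comp (reflectL d))

theorem doubleMapDeriv_of_nonpos {θ : Euc d → Euc d} {W : Set (Euc d)}
    (hc : ∀ y ∈ W, y 0 = 0 → ∀ v, fderivWithin ℝ θ W y (reflect d v) =
      reflect d (fderivWithin ℝ θ W y v)) {y : Euc d} (hy : fold y ∈ W) (h : y 0 ≤ 0) :
    doubleMapDeriv θ W y =
      (reflectL d).comp ((fderivWithin ℝ θ W (reflect d y)).comp (reflectL d)) := by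
  rcases h.lt_or_eq with h | h
  · exact if_neg (not_le.2 h)
  · rw [fold_of_nonneg h.ge] at hy
    rw [doubleMapDeriv, if_pos h.ge, reflect_of_zero h]
    ext1 v
    simp [hc y hy h]

variable {θ : Euc d → Euc d} {W : Set (Euc d)}

/-- Off the hyperplane only one formula matters. On it, `hc` makes the derivatives from the two
sides coincide. -/
theorem hasFDerivAt_doubleMap (hW : IsHalfOpen W) (hθ : ContDiffOn ℝ 1 θ W)
    (hb : ∀ y ∈ W, y 0 = 0 → θ y 0 = 0)
    (hc : ∀ y ∈ W, y 0 = 0 → ∀ v, fderivWithin ℝ θ W y (reflect d v) =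
      reflect d (fderivWithin ℝ θ W y v)) {y : Euc d} (hy : fold y ∈ W) :
    HasFDerivAt (doubleMap θ) (doubleMapDeriv θ W y) y := by
  rcases lt_trichotomy 0 (y 0) with h | h | h
  · have := hasFDerivWithinAt_doubleMap_nonneg hW hθ hy h.le
    rw [doubleMapDeriv, if_pos h.le]
    refine this.hasFDerivAt ?_
    filter_upwards [(continuous_coord 0).continuousAt.eventually (lt_mem_nhds h)] with z hz
    exact hz.le
  -- Equal derivatives within the two closed half-spaces give a derivative within their union, the
  -- whole space.
  · have h1 := hasFDerivWithinAt_doubleMap_nonneg hW hθ hy h.le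
    have h2 := hasFDerivWithinAt_doubleMap_nonpos hW hθ hb hy h.ge
    rw [← doubleMapDeriv_of_nonpos hc hy h.ge] at h2
    rw [show fderivWithin ℝ θ W y = doubleMapDeriv θ W y from (if_pos h.le).symm] at h1
    rw [← hasFDerivWithinAt_univ]
    convert h1.union h2
    ext z
    simpa [halfSpace] using le_total 0 (z 0)
  · have := hasFDerivWithinAt_doubleMap_nonpos hW hθ hb hy h.le
    rw [doubleMapDeriv, if_neg (not_le.2 h)]
    refine this.hasFDerivAt ?_
    filter_upwards [(continuous_coord 0).continuousAt.eventually (gt_mem_nhds h)] with z hz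
    exact hz.le

/-- A locally Lipschitz function on the half-space and its reflection glue together. -/
theorem locallyLipschitzOn_preimage_fold {β : Type*} [PseudoMetricSpace β] {f f₁ f₂ : Euc d → β}
    (hW : IsHalfOpen W) (h₁ : LocallyLipschitzOn W f₁) (h₂ : LocallyLipschitzOn W f₂)
    (e₁ : ∀ y, fold y ∈ W → 0 ≤ y 0 → f y = f₁ y)
    (e₂ : ∀ y, fold y ∈ W → y 0 ≤ 0 → f y = f₂ (reflect d y)) :
    LocallyLipschitzOn (fold ⁻¹' W) f := by
  refine LocallyLipschitzOn.glue (ℓ := (EuclideanSpace.proj (0 : Fin d) : Euc d →L[ℝ] ℝ))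
    hW.isOpen_preimage_fold ?_ ?_
  · refine (h₁.mono fun y hy => ?_).congr fun y hy => e₁ y hy.1 hy.2
    have h := hy.1
    rwa [mem_preimage, fold_of_nonneg hy.2] at h
  · refine LocallyLipschitzOn.congr (LocallyLipschitzOn.comp_mapsTo (f := reflect d) h₂
      (reflect d).lipschitz.locallyLipschitz.locallyLipschitzOn fun y hy => ?_) fun y hy => e₂ y hy.1 hy.2
    have h := hy.1
    rwa [mem_preimage, fold_of_nonpos hy.2] at h

/-- The derivative consists of two Lipschitz halves that agree on the hyperplane, hence is locally
Lipschitz and in particular continuous. -/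
theorem isW2InftyOn_doubleMap (hW : IsHalfOpen W) (hθ : IsW2InftyOn θ W)
    (hb : ∀ y ∈ W, y 0 = 0 → θ y 0 = 0)
    (hc : ∀ y ∈ W, y 0 = 0 → ∀ v, fderivWithin ℝ θ W y (reflect d v) =
      reflect d (fderivWithin ℝ θ W y v)) : IsW2InftyOn (doubleMap θ) (fold ⁻¹' W) := by
  have hO := hW.isOpen_preimage_fold
  have hl : LocallyLipschitzOn (fold ⁻¹' W) (doubleMapDeriv θ W) := by
    refine locallyLipschitzOn_preimage_fold hW hθ.2
      ((LocallyLipschitzOn.const (reflectL d) W).clm_comp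
        (hθ.2.clm_comp (LocallyLipschitzOn.const (reflectL d) W)))
      (fun y _ h => if_pos h) fun y hy h => doubleMapDeriv_of_nonpos hc hy h
  have hd : ∀ y ∈ fold ⁻¹' W, HasFDerivAt (doubleMap θ) (doubleMapDeriv θ W y) y := fun y hy =>
    hasFDerivAt_doubleMap hW hθ.1 hb hc hy
  have e : EqOn (fderivWithin ℝ (doubleMap θ) (fold ⁻¹' W)) (doubleMapDeriv θ W) (fold ⁻¹' W) :=
    fun y hy => by rw [fderivWithin_of_isOpen hO hy, (hd y hy).fderiv]
  refine ⟨?_, hl.congr e⟩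
  have h01 : (1 : WithTop ℕ∞) = 0 + 1 := by simp
  rw [h01, contDiffOn_succ_iff_fderiv_of_isOpen hO]
  refine ⟨fun y hy => (hd y hy).differentiableAt.differentiableWithinAt, by simp, ?_⟩
  rw [contDiffOn_zero]
  exact hl.continuousOn.congr fun y hy => (hd y hy).fderiv

/-- The matrix of the reflection. -/
def reflMatrix (d : ℕ) [NeZero d] : Matrix (Fin d) (Fin d) ℝ := Matrix.diagonal reflSign

theorem reflMatrix_transpose : (reflMatrix d)ᵀ = reflMatrix d := Matrix.diagonal_transpose _

theorem reflMatrix_mul_self : reflMatrix d * reflMatrix d = 1 := by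
  rw [reflMatrix, Matrix.diagonal_mul_diagonal]
  simp [reflSign_mul_self]

theorem abs_det_reflMatrix : |(reflMatrix d).det| = 1 := by
  have h := congrArg Matrix.det (reflMatrix_mul_self (d := d))
  rw [Matrix.det_mul, Matrix.det_one] at h
  rcases mul_self_eq_one_iff.1 h with h | h <;> simp [h]

theorem reflMatrix_mul_mul_apply (A : Matrix (Fin d) (Fin d) ℝ) (i j : Fin d) :
    (reflMatrix d * A * reflMatrix d) i j = reflSign i * A i j * reflSign j := by
  simp [reflMatrix, Matrix.mul_diagonal, Matrix.diagonal_mul]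

theorem jacobian_doubleMap_of_nonneg (hW : IsHalfOpen W) (hθ : ContDiffOn ℝ 1 θ W)
    (hb : ∀ y ∈ W, y 0 = 0 → θ y 0 = 0)
    (hc : ∀ y ∈ W, y 0 = 0 → ∀ v, fderivWithin ℝ θ W y (reflect d v) =
      reflect d (fderivWithin ℝ θ W y v)) {y : Euc d} (hy : fold y ∈ W) (h : 0 ≤ y 0) :
    jacobian (doubleMap θ) (fold ⁻¹' W) y = jacobian θ W y := by
  simp only [jacobian]
  rw [fderivWithin_of_isOpen hW.isOpen_preimage_fold hy,
    (hasFDerivAt_doubleMap hW hθ hb hc hy).fderiv, doubleMapDeriv, if_pos h]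

theorem jacobian_doubleMap_of_nonpos (hW : IsHalfOpen W) (hθ : ContDiffOn ℝ 1 θ W)
    (hb : ∀ y ∈ W, y 0 = 0 → θ y 0 = 0)
    (hc : ∀ y ∈ W, y 0 = 0 → ∀ v, fderivWithin ℝ θ W y (reflect d v) =
      reflect d (fderivWithin ℝ θ W y v)) {y : Euc d} (hy : fold y ∈ W) (h : y 0 ≤ 0) :
    jacobian (doubleMap θ) (fold ⁻¹' W) y =
      reflMatrix d * jacobian θ W (reflect d y) * reflMatrix d := by
  ext i j
  rw [reflMatrix_mul_mul_apply]
  simp only [jacobian, Matrix.of_apply]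
  rw [fderivWithin_of_isOpen hW.isOpen_preimage_fold hy,
    (hasFDerivAt_doubleMap hW hθ hb hc hy).fderiv, doubleMapDeriv_of_nonpos hc hy h]
  simp only [ContinuousLinearMap.comp_apply, reflectL_apply, reflect_single, map_smul,
    reflect_apply, PiLp.smul_apply, smul_eq_mul]
  ring

theorem fderivWithin_reflect_comm_of_jacobian {y : Euc d}
    (h : reflMatrix d * jacobian θ W y * reflMatrix d = jacobian θ W y) (v : Euc d) :
    fderivWithin ℝ θ W y (reflect d v) = reflect d (fderivWithin ℝ θ W y v) := by
  have h1 : ∀ j : Fin d, fderivWithin ℝ θ W y (reflect d (EuclideanSpace.single j 1)) =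
      reflect d (fderivWithin ℝ θ W y (EuclideanSpace.single j 1)) := fun j => by
    ext i
    have := congrFun (congrFun h i) j
    rw [reflMatrix_mul_mul_apply] at this
    simp only [jacobian, Matrix.of_apply] at this
    rw [reflect_single, map_smul, reflect_apply, PiLp.smul_apply, smul_eq_mul]
    linear_combination (-reflSign j) * this + (reflSign i * (fderivWithin ℝ θ W y (EuclideanSpace.single j 1)) i) *
      reflSign_mul_self j
  have h2 : ((fderivWithin ℝ θ W y).comp (reflectL d)).toLinearMap =
      ((reflectL d).comp (fderivWithin ℝ θ W y)).toLinearMap :=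
    (EuclideanSpace.basisFun (Fin d) ℝ).toBasis.ext fun j => by simpa using h1 j
  exact LinearMap.congr_fun h2 v

/-- A change of coordinates preserving the boundary, between metrics for which the first coordinate
direction is normal to it, is block diagonal on the boundary. -/
theorem reflMatrix_mul_mul_eq_self {A B J : Matrix (Fin d) (Fin d) ℝ} (hA : A.PosDef)
    (hB : B.PosDef) (hAB : A = Jᵀ * B * J) (hA0 : ∀ j ≠ 0, A 0 j = 0) (hB0 : ∀ j ≠ 0, B 0 j = 0)
    (hJ0 : ∀ j ≠ 0, J 0 j = 0) : reflMatrix d * J * reflMatrix d = J := by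
  have col : ∀ {C : Matrix (Fin d) (Fin d) ℝ}, C.PosDef → (∀ j ≠ 0, C 0 j = 0) →
      ∀ c : ℝ, C *ᵥ (Pi.single 0 c) = Pi.single 0 (c * C 0 0) := fun {C} hC hC0 c => by
    ext i
    rw [Matrix.mulVec_single]
    by_cases hi : i = 0
    · subst hi; simp [mul_comm]
    · have : C i 0 = C 0 i := by simpa using hC.isHermitian.apply 0 i
      simp [hi, this, hC0 i hi]
  have hJt : ∀ c : ℝ, Jᵀ *ᵥ (Pi.single 0 c) = Pi.single 0 (c * J 0 0) := fun c => by
    ext i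
    rw [Matrix.mulVec_single]
    by_cases hi : i = 0
    · subst hi; simp [mul_comm]
    · simp [hi, hJ0 i hi]
  have hdet : (Jᵀ * B).det ≠ 0 := by
    intro h
    have := hA.det_pos
    rw [hAB, Matrix.det_mul, h, zero_mul] at this
    exact this.false
  -- Otherwise the first row of `J` would vanish, so `Jᵀ e₀ = 0`, contradicting invertibility.
  have hJ00 : J 0 0 ≠ 0 := by
    intro h
    have h1 := hJt 1
    rw [h, mul_zero, Pi.single_zero] at h1
    have h2 : Jᵀ.det ≠ 0 := by
      rw [Matrix.det_mul] at hdet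
      exact left_ne_zero_of_mul hdet
    have h3 := Matrix.eq_zero_of_mulVec_eq_zero h2 h1
    have := congrFun h3 0
    simp at this
  have hB00 : B 0 0 ≠ 0 := hB.diag_pos.ne'
  -- Both `Jᵀ B (J e₀) = A e₀` and `Jᵀ B e₀` are multiples of `e₀`. As `Jᵀ B` is invertible, `J e₀`
  -- is itself a multiple of `e₀`.
  have key : J *ᵥ (Pi.single 0 1) = Pi.single 0 (A 0 0 / (J 0 0 * B 0 0)) := by
    rw [← sub_eq_zero]
    refine Matrix.eq_zero_of_mulVec_eq_zero hdet ?_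
    rw [Matrix.mulVec_sub, Matrix.mulVec_mulVec, ← hAB, ← Matrix.mulVec_mulVec, col hA hA0,
      col hB hB0, hJt, one_mul, sub_eq_zero]
    congr 1
    field_simp
  ext i j
  rw [reflMatrix_mul_mul_apply]
  by_cases hi : i = 0 <;> by_cases hj : j = 0
  · subst hi; subst hj; linear_combination J 0 0 * reflSign_mul_self (0 : Fin d)
  · subst hi; simp [hJ0 j hj]
  · subst hj
    have := congrFun key i
    rw [Matrix.mulVec_single] at this
    simp [hi] at this
    simp [this]
  · simp [reflSign, hi, hj]

end DoubleMap

/-! ### Charts of class `W^{2,∞}` of a manifold with boundary -/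

theorem IsW2InftyManifold.isManifold {d : ℕ} {H : Type*} [TopologicalSpace H]
    (I : ModelWithCorners ℝ (Euc d) H) (M : Type*) [TopologicalSpace M] [ChartedSpace H M]
    [IsW2InftyManifold I M] : IsManifold I 1 M := by
  refine isManifold_of_contDiffOn _ _ _ fun φ ψ hφ hψ => ?_
  have h := (IsW2InftyManifold.change_of_charts (I := I) (M := M) φ hφ ψ hψ).1
  refine (h.mono ?_).congr fun y _ => ?_
  · intro y hy
    simp only [readDomain, mfld_simps] at hy ⊢
    exact ⟨⟨hy.2, hy.1.1⟩, hy.1.2⟩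
  · simp only [readMap, mfld_simps]

section Charts

variable {d : ℕ} [NeZero d] {M : Type*} [TopologicalSpace M]
  [ChartedSpace (EuclideanHalfSpace d) M]

omit [ChartedSpace (EuclideanHalfSpace d) M] in
theorem isHalfOpen_extend_target (φ : OpenPartialHomeomorph M (EuclideanHalfSpace d)) :
    IsHalfOpen (φ.extend (𝓡∂ d)).target := by
  refine ⟨(𝓡∂ d).symm ⁻¹' φ.target, φ.open_target.preimage (𝓡∂ d).continuous_symm, ?_⟩
  rw [OpenPartialHomeomorph.extend_target, range_modelWithCornersEuclideanHalfSpace, inter_comm]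
  rfl

variable [IsW2InftyManifold (𝓡∂ d) M]

/-- The boundary is defined through preferred charts. Its invariance under C¹ changes of charts lets
it be read off in any chart of the atlas. -/
theorem mem_boundary_iff {φ : OpenPartialHomeomorph M (EuclideanHalfSpace d)}
    (hφ : φ ∈ atlas (EuclideanHalfSpace d) M) {x : M} (hx : x ∈ φ.source) :
    x ∈ (𝓡∂ d).boundary M ↔ φ.extend (𝓡∂ d) x 0 = 0 := by
  have := IsW2InftyManifold.isManifold (𝓡∂ d) M
  have hmem : φ.extend (𝓡∂ d) x ∈ (φ.extend (𝓡∂ d)).target :=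
    (φ.extend (𝓡∂ d)).map_source (by rwa [OpenPartialHomeomorph.extend_source])
  have h := (𝓡∂ d).isInteriorPoint_iff_of_mem_atlas (n := 1) one_ne_zero hφ hx
  rw [(isHalfOpen_extend_target φ).interior_eq] at h
  change (𝓡∂ d).IsBoundaryPoint x ↔ _
  rw [(𝓡∂ d).isBoundaryPoint_iff_not_isInteriorPoint, h]
  have h0 : 0 ≤ φ.extend (𝓡∂ d) x 0 := (isHalfOpen_extend_target φ).subset hmem
  constructor
  · intro h1
    by_contra h2
    exact h1 ⟨hmem, lt_of_le_of_ne h0 (Ne.symm h2)⟩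
  · rintro h1 ⟨_, h2⟩
    exact h2.ne' h1

variable (d M) in
/-- A chart of `M` obtained from a chart of the atlas by a change of coordinates of class
`C^1 ∩ W^{2,∞}` preserving the first coordinate. -/
structure W2Chart where
  base : OpenPartialHomeomorph M (EuclideanHalfSpace d)
  base_mem : base ∈ atlas (EuclideanHalfSpace d) M
  change : OpenPartialHomeomorph (Euc d) (Euc d)
  change_W2 : IsW2InftyOn change change.source
  change_symm_W2 : IsW2InftyOn change.symm change.target
  change_zero : ∀ y ∈ change.source, change y 0 = y 0

namespace W2Chart

/-- A chart of the atlas, as a `W2Chart`. -/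
noncomputable def ofAtlas {φ : OpenPartialHomeomorph M (EuclideanHalfSpace d)}
    (hφ : φ ∈ atlas (EuclideanHalfSpace d) M) : W2Chart d M where
  base := φ
  base_mem := hφ
  change := OpenPartialHomeomorph.refl _
  change_W2 := isW2InftyOn_of_hasFDerivAt isOpen_univ (fun x => hasFDerivAt_id x)
    (LocallyLipschitzOn.const _ _)
  change_symm_W2 := isW2InftyOn_of_hasFDerivAt isOpen_univ (fun x => hasFDerivAt_id x)
    (LocallyLipschitzOn.const _ _)
  change_zero := fun _ _ => rfl

variable (c c' c'' : W2Chart d M)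

/-- The coordinates of the chart. -/
noncomputable def chart : PartialEquiv M (Euc d) :=
  (c.base.extend (𝓡∂ d)).trans c.change.symm.toPartialEquiv

omit [IsW2InftyManifold (𝓡∂ d) M] in
theorem chart_ofAtlas {φ : OpenPartialHomeomorph M (EuclideanHalfSpace d)}
    (hφ : φ ∈ atlas (EuclideanHalfSpace d) M) : (ofAtlas hφ).chart = φ.extend (𝓡∂ d) :=
  PartialEquiv.trans_refl _

omit [IsW2InftyManifold (𝓡∂ d) M] in
theorem chart_source : c.chart.source =
    c.base.source ∩ c.base.extend (𝓡∂ d) ⁻¹' c.change.target := by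
  rw [chart, PartialEquiv.trans_source, OpenPartialHomeomorph.extend_source]; rfl

omit [IsW2InftyManifold (𝓡∂ d) M] in
theorem chart_target : c.chart.target =
    c.change.source ∩ c.change ⁻¹' (c.base.extend (𝓡∂ d)).target := by
  rw [chart, PartialEquiv.trans_target]; rfl

omit [IsW2InftyManifold (𝓡∂ d) M] in
theorem source_subset : c.chart.source ⊆ c.base.source := by
  rw [chart_source]; exact inter_subset_left

omit [IsW2InftyManifold (𝓡∂ d) M] in
theorem isOpen_source : IsOpen c.chart.source := by
  rw [chart_source]
  have := (c.base.continuousOn_extend (I := 𝓡∂ d)).isOpen_inter_preimage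
    (by rw [OpenPartialHomeomorph.extend_source]; exact c.base.open_source) c.change.open_target
  rwa [OpenPartialHomeomorph.extend_source] at this

omit [IsW2InftyManifold (𝓡∂ d) M] in
theorem isHalfOpen_target : IsHalfOpen c.chart.target := by
  obtain ⟨O, hO, h⟩ := isHalfOpen_extend_target c.base
  refine ⟨_, c.change.isOpen_inter_preimage hO, ?_⟩
  rw [chart_target, h]
  ext y
  simp only [mem_inter_iff, mem_preimage, halfSpace, mem_ofPred_eq]
  constructor
  · rintro ⟨h1, h2, h3⟩
    rw [c.change_zero y h1] at h2
    exact ⟨h2, h1, h3⟩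
  · rintro ⟨h2, h1, h3⟩
    rw [c.change_zero y h1]
    exact ⟨h1, h2, h3⟩

omit [IsW2InftyManifold (𝓡∂ d) M] in
theorem continuousOn_chart : ContinuousOn c.chart c.chart.source :=
  c.change.continuousOn_symm.comp
    ((c.base.continuousOn_extend (I := 𝓡∂ d)).mono (by
      rw [OpenPartialHomeomorph.extend_source]; exact c.source_subset))
    (fun x hx => by rw [chart_source] at hx; exact hx.2)

omit [IsW2InftyManifold (𝓡∂ d) M] in
theorem continuousOn_chart_symm : ContinuousOn c.chart.symm c.chart.target :=
  (c.base.continuousOn_extend_symm (I := 𝓡∂ d)).comp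
    (c.change.continuousOn.mono (by rw [chart_target]; exact inter_subset_left))
    (fun y hy => by rw [chart_target] at hy; exact hy.2)

omit [IsW2InftyManifold (𝓡∂ d) M] in
theorem change_chart {x : M} (hx : x ∈ c.chart.source) :
    c.change (c.chart x) = c.base.extend (𝓡∂ d) x := by
  rw [chart_source] at hx
  exact c.change.right_inv hx.2

omit [IsW2InftyManifold (𝓡∂ d) M] in
theorem chart_zero {x : M} (hx : x ∈ c.chart.source) :
    c.chart x 0 = c.base.extend (𝓡∂ d) x 0 := by
  have h : c.chart x ∈ c.change.source := by
    have := c.chart.map_source hx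
    rw [chart_target] at this
    exact this.1
  rw [← c.change_zero _ h, c.change_chart hx]

theorem mem_boundary_iff {x : M} (hx : x ∈ c.chart.source) :
    x ∈ (𝓡∂ d).boundary M ↔ c.chart x 0 = 0 := by
  rw [_root_.mem_boundary_iff c.base_mem (c.source_subset hx), c.chart_zero hx]

theorem symm_mem_boundary_iff {y : Euc d} (hy : y ∈ c.chart.target) :
    c.chart.symm y ∈ (𝓡∂ d).boundary M ↔ y 0 = 0 := by
  rw [c.mem_boundary_iff (c.chart.map_target hy), c.chart.right_inv hy]

/-- The change of coordinates between two charts. -/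
noncomputable def trans : PartialEquiv (Euc d) (Euc d) := c.chart.symm.trans c'.chart

/-- The points of the image of `c` lying in the domain of `c'`. -/
def overlap : Set (Euc d) := c.chart.target ∩ c.chart.symm ⁻¹' c'.chart.source

omit [IsW2InftyManifold (𝓡∂ d) M] in
theorem trans_source : (c.trans c').source = c.overlap c' := rfl

omit [IsW2InftyManifold (𝓡∂ d) M] in
theorem trans_target : (c.trans c').target = c'.overlap c := rfl

omit [IsW2InftyManifold (𝓡∂ d) M] in
theorem trans_symm : (c.trans c').symm = c'.trans c := rfl

omit [IsW2InftyManifold (𝓡∂ d) M] in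
theorem trans_apply (y : Euc d) : c.trans c' y = c'.chart (c.chart.symm y) := rfl

omit [IsW2InftyManifold (𝓡∂ d) M] in
theorem isHalfOpen_overlap : IsHalfOpen (c.overlap c') :=
  c.isHalfOpen_target.inter_preimage c.continuousOn_chart_symm c'.isOpen_source

omit [IsW2InftyManifold (𝓡∂ d) M] in
theorem change_mem_readDomain {y : Euc d} (hy : y ∈ c.overlap c') :
    c.change y ∈ readDomain (𝓡∂ d) (id : M → M) c.base c'.base := by
  have h1 := hy.1
  rw [chart_target] at h1
  exact ⟨h1.2, c'.source_subset hy.2⟩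

omit [IsW2InftyManifold (𝓡∂ d) M] in
theorem readMap_change (y : Euc d) : readMap (𝓡∂ d) (𝓡∂ d) (id : M → M) c.base c'.base (c.change y) =
    c'.base.extend (𝓡∂ d) (c.chart.symm y) := rfl

omit [IsW2InftyManifold (𝓡∂ d) M] in
theorem isW2InftyOn_change : IsW2InftyOn c.change c.chart.target :=
  c.change_W2.mono c.isHalfOpen_target.uniqueDiffOn (by rw [chart_target]; exact inter_subset_left)

theorem isW2InftyOn_readMap_comp_change :
    IsW2InftyOn (readMap (𝓡∂ d) (𝓡∂ d) (id : M → M) c.base c'.base ∘ c.change) (c.overlap c') := by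
  have hO := c.isHalfOpen_overlap c'
  have h1 : IsW2InftyOn c.change (c.overlap c') :=
    c.isW2InftyOn_change.mono hO.uniqueDiffOn inter_subset_left
  exact (IsW2InftyManifold.change_of_charts (I := 𝓡∂ d) _ c.base_mem _ c'.base_mem).comp h1
    hO.uniqueDiffOn (hO.locallyLipschitzOn h1.1) fun y hy => c.change_mem_readDomain c' hy

theorem isW2InftyOn_trans : IsW2InftyOn (c.trans c') (c.overlap c') := by
  have hO := c.isHalfOpen_overlap c'
  have h1 := c.isW2InftyOn_readMap_comp_change c'
  exact c'.change_symm_W2.comp h1 hO.uniqueDiffOn (hO.locallyLipschitzOn h1.1) fun y hy => by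
    have := hy.2
    rw [mem_preimage, chart_source] at this
    exact this.2

omit [IsW2InftyManifold (𝓡∂ d) M] in
theorem mapsTo_trans : MapsTo (c.trans c') (c.overlap c') (c'.overlap c) :=
  (c.trans c').mapsTo

theorem trans_zero_iff {y : Euc d} (hy : y ∈ c.overlap c') : c.trans c' y 0 = 0 ↔ y 0 = 0 := by
  rw [trans_apply, ← c'.mem_boundary_iff hy.2, c.symm_mem_boundary_iff hy.1]

theorem isHalfDiffeo_trans : IsHalfDiffeo (c.trans c') where
  source := c.isHalfOpen_overlap c'
  target := c'.isHalfOpen_overlap c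
  contDiffOn := (c.isW2InftyOn_trans c').1
  contDiffOn_symm := (c'.isW2InftyOn_trans c).1
  coord_eq_zero := fun _ hy => c.trans_zero_iff c' hy

/-- Both products are the Jacobian of one map, from the coordinates of `c` to the base coordinates
of `c'`, factored through the base of `c` or through the coordinates of `c'`. -/
theorem jacobian_readMap_mul_jacobian_change {y : Euc d} (hy : y ∈ c.overlap c') :
    readJacobian (𝓡∂ d) (𝓡∂ d) (id : M → M) c.base c'.base (c.change y) *
        jacobian c.change c.chart.target y =
      jacobian c'.change c'.chart.target (c.trans c' y) *
        jacobian (c.trans c') (c.overlap c') y := by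
  have hO := c.isHalfOpen_overlap c'
  have hm : MapsTo (c.trans c') (c.overlap c') c'.chart.target := fun z hz =>
    (c.mapsTo_trans c' hz).1
  have hW := IsW2InftyManifold.change_of_charts (I := 𝓡∂ d) (M := M) _ c.base_mem _ c'.base_mem
  have h1 : ContDiffOn ℝ 1 c.change (c.overlap c') :=
    c.isW2InftyOn_change.1.mono inter_subset_left
  rw [readJacobian, jacobian_eq_of_halfOpen c.isHalfOpen_target hy.1, ← jacobian_eq_of_halfOpen hO hy,
    ← jacobian_comp (t := readDomain (𝓡∂ d) (id : M → M) c.base c'.base)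
      (hW.1.differentiableOn one_ne_zero _ (c.change_mem_readDomain c' hy))
      (h1.differentiableOn one_ne_zero _ hy)
      (fun z hz => c.change_mem_readDomain c' hz) (hO.uniqueDiffOn y hy),
    ← jacobian_comp (c'.isW2InftyOn_change.1.differentiableOn one_ne_zero _ (hm hy))
      ((c.isW2InftyOn_trans c').1.differentiableOn one_ne_zero _ hy) hm (hO.uniqueDiffOn y hy)]
  refine jacobian_congr (fun z hz => ?_) hy
  simp only [Function.comp_apply]
  rw [readMap_change, trans_apply, c'.change_chart hz.2]

/-- The coefficients of the metric in the chart. -/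
noncomputable def metricCoeff (g : LipschitzMetric (𝓡∂ d) M) (y : Euc d) :
    Matrix (Fin d) (Fin d) ℝ :=
  (jacobian c.change c.chart.target y)ᵀ * g.coeff c.base (c.change y) *
    jacobian c.change c.chart.target y

/-- The coefficient of the density in the chart. -/
noncomputable def densityCoeff (κ : LipschitzDensity (𝓡∂ d) M) (y : Euc d) : ℝ :=
  |(jacobian c.change c.chart.target y).det| * κ.coeff c.base (c.change y)

theorem metricCoeff_compat (g : LipschitzMetric (𝓡∂ d) M) {y : Euc d} (hy : y ∈ c.overlap c') :
    c.metricCoeff g y = (jacobian (c.trans c') (c.overlap c') y)ᵀ *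
      c'.metricCoeff g (c.trans c' y) * jacobian (c.trans c') (c.overlap c') y := by
  have hJ := c.jacobian_readMap_mul_jacobian_change c' hy
  have hc := g.compat _ c.base_mem _ c'.base_mem _ (c.change_mem_readDomain c' hy)
  have e : c'.change (c.trans c' y) =
      readMap (𝓡∂ d) (𝓡∂ d) (id : M → M) c.base c'.base (c.change y) := by
    rw [trans_apply, c'.change_chart hy.2, readMap_change]
  rw [metricCoeff, hc, metricCoeff, e]
  set J := readJacobian (𝓡∂ d) (𝓡∂ d) (id : M → M) c.base c'.base (c.change y)
  set A := jacobian c.change c.chart.target y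
  set B := jacobian c'.change c'.chart.target (c.trans c' y)
  set T := jacobian (c.trans c') (c.overlap c') y
  set G := g.coeff c'.base (readMap (𝓡∂ d) (𝓡∂ d) (id : M → M) c.base c'.base (c.change y))
  calc Aᵀ * (Jᵀ * G * J) * A = (J * A)ᵀ * G * (J * A) := by
        rw [Matrix.transpose_mul]; simp only [Matrix.mul_assoc]
    _ = Tᵀ * (Bᵀ * G * B) * T := by
        rw [hJ, Matrix.transpose_mul]; simp only [Matrix.mul_assoc]

theorem densityCoeff_compat (κ : LipschitzDensity (𝓡∂ d) M) {y : Euc d} (hy : y ∈ c.overlap c') :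
    c.densityCoeff κ y = |(jacobian (c.trans c') (c.overlap c') y).det| *
      c'.densityCoeff κ (c.trans c' y) := by
  have hJ := congrArg (fun A => |Matrix.det A|) (c.jacobian_readMap_mul_jacobian_change c' hy)
  have hc := κ.compat _ c.base_mem _ c'.base_mem _ (c.change_mem_readDomain c' hy)
  have e : c'.change (c.trans c' y) =
      readMap (𝓡∂ d) (𝓡∂ d) (id : M → M) c.base c'.base (c.change y) := by
    rw [trans_apply, c'.change_chart hy.2, readMap_change]
  simp only [Matrix.det_mul, abs_mul] at hJ
  rw [densityCoeff, hc, densityCoeff, e]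
  linear_combination (κ.coeff c'.base
    (readMap (𝓡∂ d) (𝓡∂ d) (id : M → M) c.base c'.base (c.change y))) * hJ

omit [IsW2InftyManifold (𝓡∂ d) M] in
theorem det_jacobian_change_ne_zero {y : Euc d} (hy : y ∈ c.chart.target) :
    (jacobian c.change c.chart.target y).det ≠ 0 := by
  have hy' := hy
  rw [chart_target] at hy'
  have hy1 : c.change y ∈ c.change.target := c.change.map_source hy'.1
  have h1 := jacobian_comp (c.change_symm_W2.1.differentiableOn one_ne_zero _ hy1)
    (c.isW2InftyOn_change.1.differentiableOn one_ne_zero _ hy)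
    (fun z hz => by rw [chart_target] at hz; exact c.change.map_source hz.1)
    (c.isHalfOpen_target.uniqueDiffOn y hy)
  rw [jacobian_congr (f := c.change.symm ∘ c.change) (g := id) (fun z hz => by
      rw [chart_target] at hz; exact c.change.left_inv hz.1) hy,
    jacobian_id (c.isHalfOpen_target.uniqueDiffOn y hy)] at h1
  have h2 := congrArg Matrix.det h1
  rw [Matrix.det_mul, Matrix.det_one] at h2
  exact right_ne_zero_of_mul_eq_one h2.symm

omit [IsW2InftyManifold (𝓡∂ d) M] in
theorem metricCoeff_posDef (g : LipschitzMetric (𝓡∂ d) M) {y : Euc d} (hy : y ∈ c.chart.target) :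
    (c.metricCoeff g y).PosDef := by
  have hy' := hy
  rw [chart_target] at hy'
  have h := (g.posDef _ c.base_mem _ hy'.2).conjTranspose_mul_mul_same
    (B := jacobian c.change c.chart.target y) (by
      exact Matrix.mulVec_injective_iff_isUnit.2 ((Matrix.isUnit_iff_isUnit_det _).2
        (c.det_jacobian_change_ne_zero hy).isUnit))
  rwa [Matrix.conjTranspose_eq_transpose_of_trivial] at h

omit [IsW2InftyManifold (𝓡∂ d) M] in
theorem densityCoeff_pos (κ : LipschitzDensity (𝓡∂ d) M) {y : Euc d} (hy : y ∈ c.chart.target) :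
    0 < c.densityCoeff κ y := by
  have hy' := hy
  rw [chart_target] at hy'
  exact mul_pos (abs_pos.2 (c.det_jacobian_change_ne_zero hy)) (κ.pos _ c.base_mem _ hy'.2)

omit [IsW2InftyManifold (𝓡∂ d) M] in
theorem locallyLipschitzOn_jacobian_change (i j : Fin d) :
    LocallyLipschitzOn c.chart.target fun y => jacobian c.change c.chart.target y i j :=
  (ContDiff.comp_locallyLipschitzOn (g := fun v : Euc d => v i) (by fun_prop)
    (c.isW2InftyOn_change.2.clm_apply_const (EuclideanSpace.single j 1)) :)

omit [IsW2InftyManifold (𝓡∂ d) M] in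
theorem locallyLipschitzOn_comp_change {f : Euc d → ℝ}
    (hf : LocallyLipschitzOn (c.base.extend (𝓡∂ d)).target f) :
    LocallyLipschitzOn c.chart.target fun y => f (c.change y) :=
  LocallyLipschitzOn.comp_mapsTo hf
    (c.isHalfOpen_target.locallyLipschitzOn c.isW2InftyOn_change.1)
    fun y hy => by rw [chart_target] at hy; exact hy.2

omit [IsW2InftyManifold (𝓡∂ d) M] in
theorem metricCoeff_lipschitz (g : LipschitzMetric (𝓡∂ d) M) (i j : Fin d) :
    LocallyLipschitzOn c.chart.target fun y => c.metricCoeff g y i j :=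
  LocallyLipschitzOn.matrix_mul (LocallyLipschitzOn.matrix_mul
    (fun k l => c.locallyLipschitzOn_jacobian_change l k)
    fun k l => c.locallyLipschitzOn_comp_change (g.lipschitz _ c.base_mem k l))
    (fun k l => c.locallyLipschitzOn_jacobian_change k l) i j

omit [IsW2InftyManifold (𝓡∂ d) M] in
theorem densityCoeff_lipschitz (κ : LipschitzDensity (𝓡∂ d) M) :
    LocallyLipschitzOn c.chart.target (c.densityCoeff κ) :=
  (LocallyLipschitzOn.matrix_det
    fun k l => c.locallyLipschitzOn_jacobian_change k l).abs_real.mul_real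
    (c.locallyLipschitzOn_comp_change (κ.lipschitz _ c.base_mem))

omit [IsW2InftyManifold (𝓡∂ d) M] in
theorem jacobian_change_ofAtlas {φ : OpenPartialHomeomorph M (EuclideanHalfSpace d)}
    (hφ : φ ∈ atlas (EuclideanHalfSpace d) M) {y : Euc d} (hy : y ∈ (φ.extend (𝓡∂ d)).target) :
    jacobian (ofAtlas hφ).change (ofAtlas hφ).chart.target y = 1 := by
  rw [chart_ofAtlas]
  exact jacobian_id ((isHalfOpen_extend_target φ).uniqueDiffOn y hy)

omit [IsW2InftyManifold (𝓡∂ d) M] in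
theorem metricCoeff_ofAtlas (g : LipschitzMetric (𝓡∂ d) M)
    {φ : OpenPartialHomeomorph M (EuclideanHalfSpace d)}
    (hφ : φ ∈ atlas (EuclideanHalfSpace d) M) {y : Euc d} (hy : y ∈ (φ.extend (𝓡∂ d)).target) :
    (ofAtlas hφ).metricCoeff g y = g.coeff φ y := by
  rw [metricCoeff, jacobian_change_ofAtlas hφ hy, Matrix.transpose_one, Matrix.one_mul,
    Matrix.mul_one]
  rfl

omit [IsW2InftyManifold (𝓡∂ d) M] in
theorem densityCoeff_ofAtlas (κ : LipschitzDensity (𝓡∂ d) M)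
    {φ : OpenPartialHomeomorph M (EuclideanHalfSpace d)}
    (hφ : φ ∈ atlas (EuclideanHalfSpace d) M) {y : Euc d} (hy : y ∈ (φ.extend (𝓡∂ d)).target) :
    (ofAtlas hφ).densityCoeff κ y = κ.coeff φ y := by
  rw [densityCoeff, jacobian_change_ofAtlas hφ hy, Matrix.det_one, abs_one, one_mul]
  rfl

/-- The metric is block diagonal on the boundary in the chart. -/
def IsNormal (g : LipschitzMetric (𝓡∂ d) M) : Prop :=
  ∀ y ∈ c.chart.target, y 0 = 0 → ∀ j ≠ 0, c.metricCoeff g y 0 j = 0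

end W2Chart

omit [IsW2InftyManifold (𝓡∂ d) M] in
-- These charts cover the manifold, and only their reflections enter the atlas of the double.
theorem exists_isNormal (g : LipschitzMetric (𝓡∂ d) M) (p : M) :
    ∃ c : W2Chart d M, p ∈ c.chart.source ∧ c.IsNormal g := by
  set φ := chartAt (EuclideanHalfSpace d) p with hφ_def
  have hφ : φ ∈ atlas (EuclideanHalfSpace d) M := chart_mem_atlas _ p
  have hp : p ∈ φ.source := mem_chart_source _ p
  obtain ⟨Φ, h1, h2, h3, h4, h5⟩ := exists_normal_coordinates (isHalfOpen_extend_target φ)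
    (g.lipschitz φ hφ) (g.posDef φ hφ)
    ((φ.extend (𝓡∂ d)).map_source (x := p) (by rwa [OpenPartialHomeomorph.extend_source]))
  let c : W2Chart d M := ⟨φ, hφ, Φ, h2, h3, h4⟩
  refine ⟨c, ?_, fun y hy hy0 j hj => ?_⟩
  · rw [c.chart_source]
    exact ⟨hp, h1⟩
  · have hy' := hy
    rw [c.chart_target] at hy'
    have := h5 y hy'.1 hy'.2 hy0 j hj
    have e : jacobian c.change c.chart.target y = jacobian Φ Φ.source y := by
      simp only [jacobian]
      rw [fderivWithin_subset (t := Φ.source) (by rw [c.chart_target]; exact inter_subset_left)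
        (c.isHalfOpen_target.uniqueDiffOn y hy) (h2.1.differentiableOn one_ne_zero _ hy'.1)]
    rw [W2Chart.metricCoeff, e]
    exact this

end Charts

/-! ### The double of a manifold with boundary and its charts -/

section DoubleTopology

variable {d : ℕ} [NeZero d] {M : Type*} [TopologicalSpace M]
  [ChartedSpace (EuclideanHalfSpace d) M]

/-- The reflection if the sign is negative, the identity otherwise. -/
noncomputable def signReflect (ε : ℤˣ) (y : Euc d) : Euc d := if ε = 1 then y else reflect d y

@[simp] theorem signReflect_one (y : Euc d) : signReflect 1 y = y := if_pos rfl

@[simp] theorem signReflect_neg_one (y : Euc d) : signReflect (-1) y = reflect d y :=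
  if_neg (by decide)

theorem continuous_signReflect (ε : ℤˣ) : Continuous (signReflect ε : Euc d → Euc d) := by
  rcases Int.units_eq_one_or ε with rfl | rfl
  · exact continuous_id.congr fun y => (signReflect_one y).symm
  · exact (reflect d).continuous.congr fun y => (signReflect_neg_one y).symm

theorem fold_signReflect (ε : ℤˣ) (y : Euc d) : fold (signReflect ε y) = fold y := by
  rcases Int.units_eq_one_or ε with rfl | rfl <;> simp [fold_reflect]

/-! ### Topology of the double. -/

namespace Double

/-- The projection of the double onto the manifold. -/
def proj : Double d M → M := Quotient.lift Prod.fst fun _ _ h => h.1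

@[simp] theorem proj_incl (ε : ℤˣ) (x : M) : proj (incl d ε x) = x := rfl

theorem exists_eq_incl (p : Double d M) : ∃ ε x, p = incl d ε x := by
  obtain ⟨⟨x, ε⟩, rfl⟩ := Quotient.exists_rep p
  exact ⟨ε, x, rfl⟩

theorem incl_eq_incl_iff {ε ε' : ℤˣ} {x x' : M} :
    (incl d ε x : Double d M) = incl d ε' x' ↔ x = x' ∧ (ε = ε' ∨ x ∈ (𝓡∂ d).boundary M) :=
  Quotient.eq (r := doubleSetoid d M)

theorem incl_eq_of_mem_boundary {x : M} (hx : x ∈ (𝓡∂ d).boundary M) (ε ε' : ℤˣ) :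
    (incl d ε x : Double d M) = incl d ε' x := incl_eq_incl_iff.2 ⟨rfl, Or.inr hx⟩

/-- The group of signs is discrete, so the product is a disjoint union of two copies of `M`. -/
theorem isOpen_iff {s : Set (Double d M)} : IsOpen s ↔ ∀ ε, IsOpen (incl d ε ⁻¹' s : Set M) := by
  have h : IsOpen s ↔ IsOpen (Quotient.mk (doubleSetoid d M) ⁻¹' s) := isOpen_coinduced
  rw [h]
  constructor
  · intro h ε
    exact h.preimage (by fun_prop : Continuous fun x : M => (x, ε))
  · intro h
    have : Quotient.mk (doubleSetoid d M) ⁻¹' s = ⋃ ε : ℤˣ, (incl d ε ⁻¹' s) ×ˢ {ε} := by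
      ext ⟨x, ε⟩
      simp only [mem_preimage, mem_iUnion, mem_prod, mem_singleton_iff, exists_eq_right']
      rfl
    rw [this]
    exact isOpen_iUnion fun ε => (h ε).prod (isOpen_discrete _)

theorem continuous_incl (ε : ℤˣ) : Continuous (incl d ε : M → Double d M) :=
  continuous_def.2 fun _ hs => isOpen_iff.1 hs ε

theorem continuous_proj : Continuous (proj : Double d M → M) :=
  continuous_def.2 fun _ hs => isOpen_iff.2 fun _ => hs

theorem isEmbedding_incl (ε : ℤˣ) : IsEmbedding (incl d ε : M → Double d M) :=
  IsEmbedding.of_leftInverse (f := proj) (proj_incl ε) continuous_proj (continuous_incl ε)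

theorem continuousOn_preimage_proj {X : Type*} [TopologicalSpace X] {f : Double d M → X}
    {U : Set M} (hU : IsOpen U) (h : ∀ ε, ContinuousOn (f ∘ incl d ε) U) :
    ContinuousOn f (proj ⁻¹' U) := by
  rw [continuousOn_open_iff (hU.preimage continuous_proj)]
  exact fun t ht => isOpen_iff.2 fun ε => (h ε).isOpen_inter_preimage hU ht

/-- Points over different points of `M` are separated by preimages under the projection. Distinct
points over the same point lie off the boundary, which is closed, and there the two copies are open
and disjoint. -/
theorem t2Space [T2Space M] [IsW2InftyManifold (𝓡∂ d) M] : T2Space (Double d M) := by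
  have := IsW2InftyManifold.isManifold (𝓡∂ d) M
  refine ⟨fun p q hpq => ?_⟩
  by_cases hx : proj p = proj q
  · obtain ⟨ε, x, rfl⟩ := exists_eq_incl p
    obtain ⟨ε', x', rfl⟩ := exists_eq_incl q
    obtain rfl : x = x' := hx
    have h : ¬ (ε = ε' ∨ x ∈ (𝓡∂ d).boundary M) := fun h => hpq (incl_eq_incl_iff.2 ⟨rfl, h⟩)
    rw [not_or] at h
    have hb : ∀ {ε ε' : ℤˣ} {z z' : M}, z ∈ ((𝓡∂ d).boundary M)ᶜ →
        ((incl d ε z : Double d M) = incl d ε' z' ↔ z = z' ∧ ε = ε') := fun {ε ε' z z'} hz => by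
      rw [incl_eq_incl_iff, or_iff_left hz]
    have hO : IsOpen ((𝓡∂ d).boundary M)ᶜ :=
      ((𝓡∂ d).isClosed_boundary (M := M) (n := 1) one_ne_zero).isOpen_compl
    have ho : ∀ ε : ℤˣ, IsOpen ((incl d ε : M → Double d M) '' ((𝓡∂ d).boundary M)ᶜ) := by
      refine fun ε => isOpen_iff.2 fun ε' => ?_
      by_cases h : ε = ε'
      · subst h
        rwa [(isEmbedding_incl ε).injective.preimage_image]
      · convert isOpen_empty
        refine eq_empty_of_forall_notMem ?_
        rintro z ⟨z', hz', hzz⟩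
        exact h ((hb hz').1 hzz).2
    refine ⟨_, _, ho ε, ho ε', mem_image_of_mem _ h.2, mem_image_of_mem _ h.2, ?_⟩
    rw [Set.disjoint_left]
    rintro _ ⟨z, hz, rfl⟩ ⟨z', hz', hzz⟩
    exact h.1 ((hb hz').1 hzz).2.symm
  · obtain ⟨u, v, hu, hv, hpu, hqv, huv⟩ := t2_separation hx
    exact ⟨_, _, hu.preimage continuous_proj, hv.preimage continuous_proj, hpu, hqv,
      huv.preimage _⟩

end Double

/-- The sign of the side of the hyperplane on which a point lies. -/
noncomputable def sideSign (y : Euc d) : ℤˣ := if 0 ≤ y 0 then 1 else -1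

theorem sideSign_of_nonneg {y : Euc d} (h : 0 ≤ y 0) : sideSign y = 1 := if_pos h

theorem sideSign_of_neg {y : Euc d} (h : y 0 < 0) : sideSign y = -1 := if_neg (not_le.2 h)

theorem signReflect_sideSign_fold (y : Euc d) : signReflect (sideSign y) (fold y) = y := by
  rcases le_or_gt 0 (y 0) with h | h
  · rw [sideSign_of_nonneg h, fold_of_nonneg h, signReflect_one]
  · rw [sideSign_of_neg h, fold_of_nonpos h.le, signReflect_neg_one, reflect_reflect]

/-! ### Reflected charts of the double. -/

namespace W2Chart

variable [IsW2InftyManifold (𝓡∂ d) M] (c c' : W2Chart d M)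

open Double

open Classical in
/-- The coordinates on the double obtained by reflection. -/
noncomputable def doubleFun (p : Double d M) : Euc d :=
  if p = incl d 1 (proj p) then c.chart (proj p) else reflect d (c.chart (proj p))

theorem doubleFun_incl (ε : ℤˣ) {x : M} (hx : x ∈ c.chart.source) :
    c.doubleFun (incl d ε x) = signReflect ε (c.chart x) := by
  rw [doubleFun, proj_incl]
  rcases Int.units_eq_one_or ε with rfl | rfl
  · rw [if_pos rfl, signReflect_one]
  -- A point of the second copy equals its twin in the first only on the boundary, and there the
  -- reflection fixes the coordinates.
  · split_ifs with h
    · rw [incl_eq_incl_iff, or_iff_right (by decide), c.mem_boundary_iff hx] at h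
      rw [signReflect_neg_one, reflect_of_zero h.2]
    · rw [signReflect_neg_one]

/-- The inverse of the coordinates on the double. -/
noncomputable def doubleInv (y : Euc d) : Double d M :=
  incl d (sideSign y) (c.chart.symm (fold y))

omit [IsW2InftyManifold (𝓡∂ d) M] in
theorem doubleInv_of_nonneg {y : Euc d} (h : 0 ≤ y 0) :
    c.doubleInv y = incl d 1 (c.chart.symm y) := by
  rw [doubleInv, sideSign_of_nonneg h, fold_of_nonneg h]

theorem doubleInv_of_nonpos {y : Euc d} (hy : fold y ∈ c.chart.target) (h : y 0 ≤ 0) :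
    c.doubleInv y = incl d (-1) (c.chart.symm (reflect d y)) := by
  rcases h.lt_or_eq with h | h
  · rw [doubleInv, sideSign_of_neg h, fold_of_nonpos h.le]
  · rw [c.doubleInv_of_nonneg h.ge, reflect_of_zero h]
    rw [fold_of_nonneg h.ge] at hy
    exact incl_eq_of_mem_boundary ((c.symm_mem_boundary_iff hy).2 h) _ _

theorem continuousOn_doubleInv : ContinuousOn c.doubleInv (fold ⁻¹' c.chart.target) := by
  have h1 : ContinuousOn c.doubleInv (fold ⁻¹' c.chart.target ∩ {y | 0 ≤ y 0}) :=
    ((continuous_incl 1).comp_continuousOn (c.continuousOn_chart_symm.mono fun y hy => by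
      have := hy.1
      rwa [mem_preimage, fold_of_nonneg hy.2] at this)).congr
      fun y hy => c.doubleInv_of_nonneg hy.2
  have h2 : ContinuousOn c.doubleInv (fold ⁻¹' c.chart.target ∩ {y | y 0 ≤ 0}) :=
    ((continuous_incl (-1)).comp_continuousOn (c.continuousOn_chart_symm.comp
      (reflect d).continuous.continuousOn fun y hy => by
      have := hy.1
      rwa [mem_preimage, fold_of_nonpos hy.2] at this)).congr
      fun y hy => c.doubleInv_of_nonpos hy.1 hy.2
  intro y hy
  have hcov : fold ⁻¹' c.chart.target =
      fold ⁻¹' c.chart.target ∩ {y | 0 ≤ y 0} ∪ fold ⁻¹' c.chart.target ∩ {y | y 0 ≤ 0} := by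
    rw [← inter_union_distrib_left, eq_comm, inter_eq_left]
    exact fun z _ => le_total 0 (z 0)
  have hc0 : Continuous fun y : Euc d => y 0 := continuous_coord 0
  rcases lt_trichotomy 0 (y 0) with h | h | h
  · refine (h1 y ⟨hy, h.le⟩).mono_of_mem_nhdsWithin ?_
    exact inter_mem self_mem_nhdsWithin (mem_nhdsWithin_of_mem_nhds
      (mem_of_superset ((isOpen_lt continuous_const hc0).mem_nhds h) fun z (hz : 0 < z 0) => hz.le))
  · rw [hcov]
    exact (h1 y ⟨hy, h.le⟩).union (h2 y ⟨hy, h.ge⟩)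
  · refine (h2 y ⟨hy, h.le⟩).mono_of_mem_nhdsWithin ?_
    exact inter_mem self_mem_nhdsWithin (mem_nhdsWithin_of_mem_nhds
      (mem_of_superset ((isOpen_lt hc0 continuous_const).mem_nhds h) fun z (hz : z 0 < 0) => hz.le))

/-- The chart of the double obtained by reflection. -/
noncomputable def doubleChart : OpenPartialHomeomorph (Double d M) (Euc d) where
  toFun := c.doubleFun
  invFun := c.doubleInv
  source := proj ⁻¹' c.chart.source
  target := fold ⁻¹' c.chart.target
  map_source' p hp := by
    obtain ⟨ε, x, rfl⟩ := exists_eq_incl p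
    replace hp : x ∈ c.chart.source := hp
    have hx := c.chart.map_source hp
    rw [c.doubleFun_incl ε hp, mem_preimage, fold_signReflect,
      fold_of_nonneg (c.isHalfOpen_target.subset hx)]
    exact hx
  map_target' y hy := c.chart.map_target hy
  left_inv' p hp := by
    obtain ⟨ε, x, rfl⟩ := exists_eq_incl p
    replace hp : x ∈ c.chart.source := hp
    have hx : c.chart x ∈ c.chart.target := c.chart.map_source hp
    have h0 : 0 ≤ c.chart x 0 := c.isHalfOpen_target.subset hx
    rw [c.doubleFun_incl ε hp]
    rcases Int.units_eq_one_or ε with rfl | rfl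
    · rw [signReflect_one, c.doubleInv_of_nonneg h0, c.chart.left_inv hp]
    · rw [signReflect_neg_one, c.doubleInv_of_nonpos, reflect_reflect, c.chart.left_inv hp]
      · rwa [fold_reflect, fold_of_nonneg h0]
      · rwa [reflect_apply_zero, neg_nonpos]
  right_inv' y hy := by
    rw [doubleInv, c.doubleFun_incl _ (c.chart.map_target hy), c.chart.right_inv hy,
      signReflect_sideSign_fold]
  open_source := c.isOpen_source.preimage continuous_proj
  open_target := c.isHalfOpen_target.isOpen_preimage_fold
  continuousOn_toFun := continuousOn_preimage_proj c.isOpen_source fun ε =>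
    ((continuous_signReflect ε).comp_continuousOn c.continuousOn_chart).congr
      fun x hx => c.doubleFun_incl ε hx
  continuousOn_invFun := c.continuousOn_doubleInv

end W2Chart

end DoubleTopology

/-! ### The structures on the double -/

section DoubleStructure

variable {d : ℕ} [NeZero d]

/-- A map sending the boundary to the boundary has a derivative tangent to the boundary. -/
theorem IsHalfOpen.jacobian_zero_eq_zero {W : Set (Euc d)} {θ : Euc d → Euc d} (hW : IsHalfOpen W)
    (hθ : ContDiffOn ℝ 1 θ W) (hb : ∀ y ∈ W, y 0 = 0 → θ y 0 = 0) {y : Euc d} (hy : y ∈ W)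
    (hy0 : y 0 = 0) {j : Fin d} (hj : j ≠ 0) : jacobian θ W y 0 j = 0 := by
  -- A tangential line through `y` stays in the hyperplane, hence so does its image near `y`, and
  -- the first component of the image has zero derivative.
  set γ : ℝ → Euc d := fun t => y + t • EuclideanSpace.single j 1
  have hγ0 : ∀ t, γ t 0 = 0 := fun t => by simp [γ, hy0, hj.symm]
  have hγy : γ 0 = y := by simp [γ]
  have hγ : HasDerivAt γ (EuclideanSpace.single j 1) 0 := by
    have := ((hasDerivAt_id (0 : ℝ)).smul_const (EuclideanSpace.single j (1 : ℝ))).const_add y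
    rwa [one_smul] at this
  have h1 : HasFDerivWithinAt θ (fderivWithin ℝ θ W y) (halfSpace d) (γ 0) := by
    rw [hγy, hW.fderivWithin_eq hy]
    exact hW.hasFDerivWithinAt hθ hy
  have h2 : HasDerivWithinAt (θ ∘ γ) (fderivWithin ℝ θ W y (EuclideanSpace.single j 1)) univ 0 :=
    h1.comp_hasDerivWithinAt 0 hγ.hasDerivWithinAt fun t _ => (hγ0 t).ge
  rw [hasDerivWithinAt_univ] at h2
  have h3 : HasDerivAt (fun t => θ (γ t) 0) (jacobian θ W y 0 j) 0 :=
    ((EuclideanSpace.proj (0 : Fin d) : Euc d →L[ℝ] ℝ).hasFDerivAt.comp_hasDerivAt 0 h2 :)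
  have h4 : (fun t => θ (γ t) 0) =ᶠ[𝓝 0] fun _ => 0 := by
    have h5 : W ∈ 𝓝[halfSpace d] (γ 0) := by
      rw [hγy, ← hW.nhdsWithin_eq hy]
      exact self_mem_nhdsWithin
    have h6 : Tendsto γ (𝓝 0) (𝓝[halfSpace d] (γ 0)) :=
      tendsto_nhdsWithin_iff.2 ⟨hγ.continuousAt, Eventually.of_forall fun t => (hγ0 t).ge⟩
    filter_upwards [h6 h5] with t ht using hb _ ht (hγ0 t)
  exact h3.unique ((hasDerivAt_const (0 : ℝ) (0 : ℝ)).congr_of_eventuallyEq h4)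

theorem isW2InftyOn_reflect {s : Set (Euc d)} (hs : IsOpen s) : IsW2InftyOn (reflect d) s :=
  isW2InftyOn_of_hasFDerivAt hs (fun _ => (reflectL d).hasFDerivAt) (LocallyLipschitzOn.const _ _)

theorem jacobian_reflect (y : Euc d) : jacobian (reflect d) univ y = reflMatrix d := by
  ext i j
  simp only [jacobian, Matrix.of_apply, fderivWithin_univ]
  rw [show fderiv ℝ (reflect d) y = reflectL d from (reflectL d).hasFDerivAt.fderiv, reflectL_apply,
    reflect_single]
  by_cases h : i = j
  · subst h; simp [reflMatrix]
  · simp [reflMatrix, h]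

theorem jacobian_reflect_comp {θ : Euc d → Euc d} {s : Set (Euc d)} {y : Euc d}
    (hs : UniqueDiffWithinAt ℝ s y) (hθ : DifferentiableWithinAt ℝ θ s y) :
    jacobian (reflect d ∘ θ) s y = reflMatrix d * jacobian θ s y := by
  have h : DifferentiableWithinAt ℝ (reflect d) univ (θ y) :=
    (reflectL d).differentiableAt.differentiableWithinAt
  rw [jacobian_comp h hθ (mapsTo_univ _ _) hs, jacobian_reflect]

variable {M : Type*} [TopologicalSpace M] [ChartedSpace (EuclideanHalfSpace d) M]
  [IsW2InftyManifold (𝓡∂ d) M] (g : LipschitzMetric (𝓡∂ d) M) (κ : LipschitzDensity (𝓡∂ d) M)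

/-! ### Changes of charts, metric and density in reflected charts. -/

namespace W2Chart

variable {g} {c c' : W2Chart d M}

/-- Normality of both charts enters here, and yields the compatibility needed for the reflected
change of charts to be C¹. -/
theorem reflMatrix_mul_jacobian_trans_mul (hc : c.IsNormal g) (hc' : c'.IsNormal g) {y : Euc d}
    (hy : y ∈ c.overlap c') (hy0 : y 0 = 0) :
    reflMatrix d * jacobian (c.trans c') (c.overlap c') y * reflMatrix d =
      jacobian (c.trans c') (c.overlap c') y := by
  have hy' := c.mapsTo_trans c' hy
  refine reflMatrix_mul_mul_eq_self (c.metricCoeff_posDef g hy.1) (c'.metricCoeff_posDef g hy'.1)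
    (c.metricCoeff_compat c' g hy) (hc y hy.1 hy0)
    (hc' _ hy'.1 ((c.trans_zero_iff c' hy).2 hy0)) fun j hj => ?_
  exact (c.isHalfOpen_overlap c').jacobian_zero_eq_zero (c.isW2InftyOn_trans c').1
    (fun z hz hz0 => (c.trans_zero_iff c' hz).2 hz0) hy hy0 hj

theorem fderivWithin_trans_reflect (hc : c.IsNormal g) (hc' : c'.IsNormal g) :
    ∀ y ∈ c.overlap c', y 0 = 0 → ∀ v, fderivWithin ℝ (c.trans c') (c.overlap c') y (reflect d v) =
      reflect d (fderivWithin ℝ (c.trans c') (c.overlap c') y v) := fun _ hy hy0 =>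
  fderivWithin_reflect_comm_of_jacobian (reflMatrix_mul_jacobian_trans_mul hc hc' hy hy0)

theorem readDomain_doubleChart (c c' : W2Chart d M) :
    readDomain (𝓡 d) (id : Double d M → Double d M) c.doubleChart c'.doubleChart =
      fold ⁻¹' (c.overlap c') := by
  simp only [readDomain, mfld_simps]
  rfl

theorem readMap_doubleChart (c c' : W2Chart d M) :
    EqOn (readMap (𝓡 d) (𝓡 d) (id : Double d M → Double d M) c.doubleChart c'.doubleChart)
      (doubleMap (c.trans c')) (fold ⁻¹' (c.overlap c')) := by
  intro y hy
  have h : readMap (𝓡 d) (𝓡 d) (id : Double d M → Double d M) c.doubleChart c'.doubleChart y =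
      c'.doubleFun (c.doubleInv y) := rfl
  rw [h, doubleInv, c'.doubleFun_incl _ hy.2]
  rcases le_or_gt 0 (y 0) with h0 | h0
  · rw [sideSign_of_nonneg h0, signReflect_one, doubleMap_of_nonneg h0, fold_of_nonneg h0]; rfl
  · rw [sideSign_of_neg h0, signReflect_neg_one, doubleMap_of_neg h0, fold_of_nonpos h0.le]; rfl

theorem isW2InftyOn_readMap_doubleChart (hc : c.IsNormal g) (hc' : c'.IsNormal g) :
    IsW2InftyOn (readMap (𝓡 d) (𝓡 d) (id : Double d M → Double d M) c.doubleChart c'.doubleChart)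
      (readDomain (𝓡 d) (id : Double d M → Double d M) c.doubleChart c'.doubleChart) := by
  rw [readDomain_doubleChart]
  exact (isW2InftyOn_doubleMap (c.isHalfOpen_overlap c') (c.isW2InftyOn_trans c')
    (fun y hy => (c.trans_zero_iff c' hy).2) (fderivWithin_trans_reflect hc hc')).congr
    (readMap_doubleChart c c')

theorem readJacobian_doubleChart_of_nonneg (hc : c.IsNormal g) (hc' : c'.IsNormal g) {y : Euc d}
    (hy : fold y ∈ c.overlap c') (h : 0 ≤ y 0) :
    readJacobian (𝓡 d) (𝓡 d) (id : Double d M → Double d M) c.doubleChart c'.doubleChart y =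
      jacobian (c.trans c') (c.overlap c') y := by
  rw [readJacobian, readDomain_doubleChart, jacobian_congr (readMap_doubleChart c c') hy,
    jacobian_doubleMap_of_nonneg (c.isHalfOpen_overlap c') (c.isW2InftyOn_trans c').1
    (fun y hy => (c.trans_zero_iff c' hy).2) (fderivWithin_trans_reflect hc hc') hy h]

theorem readJacobian_doubleChart_of_nonpos (hc : c.IsNormal g) (hc' : c'.IsNormal g) {y : Euc d}
    (hy : fold y ∈ c.overlap c') (h : y 0 ≤ 0) :
    readJacobian (𝓡 d) (𝓡 d) (id : Double d M → Double d M) c.doubleChart c'.doubleChart y =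
      reflMatrix d * jacobian (c.trans c') (c.overlap c') (reflect d y) * reflMatrix d := by
  rw [readJacobian, readDomain_doubleChart, jacobian_congr (readMap_doubleChart c c') hy,
    jacobian_doubleMap_of_nonpos (c.isHalfOpen_overlap c') (c.isW2InftyOn_trans c').1
    (fun y hy => (c.trans_zero_iff c' hy).2) (fderivWithin_trans_reflect hc hc') hy h]

variable (c) in
/-- The coefficients of the metric of the double in the chart obtained by reflection. -/
noncomputable def doubleMetricCoeff (g : LipschitzMetric (𝓡∂ d) M) (y : Euc d) :
    Matrix (Fin d) (Fin d) ℝ :=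
  if 0 ≤ y 0 then c.metricCoeff g y else reflMatrix d * c.metricCoeff g (reflect d y) * reflMatrix d

omit [IsW2InftyManifold (𝓡∂ d) M] in
theorem doubleMetricCoeff_of_nonneg {y : Euc d} (h : 0 ≤ y 0) :
    c.doubleMetricCoeff g y = c.metricCoeff g y := if_pos h

omit [IsW2InftyManifold (𝓡∂ d) M] in
-- Conjugation by the reflection only changes the sign of the entries mixing index 0 with the
-- others. In a normal chart these vanish on the hyperplane, so the formulas for the two sides agree
-- there.
theorem doubleMetricCoeff_of_nonpos (hc : c.IsNormal g) {y : Euc d} (hy : fold y ∈ c.chart.target)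
    (h : y 0 ≤ 0) : c.doubleMetricCoeff g y =
      reflMatrix d * c.metricCoeff g (reflect d y) * reflMatrix d := by
  rcases h.lt_or_eq with h | h
  · exact if_neg (not_le.2 h)
  · rw [fold_of_nonneg h.ge] at hy
    rw [doubleMetricCoeff_of_nonneg h.ge, reflect_of_zero h]
    ext i j
    rw [reflMatrix_mul_mul_apply]
    have hs := (c.metricCoeff_posDef g hy).isHermitian.apply i j
    rw [star_trivial] at hs
    by_cases hi : i = 0 <;> by_cases hj : j = 0
    · subst hi; subst hj; simp [reflSign]
    · subst hi; simp [hc y hy h j hj]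
    · subst hj; simp [← hs, hc y hy h i hi]
    · simp [reflSign, hi, hj]

variable (c) in
/-- The coefficient of the density of the double in the chart obtained by reflection. -/
noncomputable def doubleDensityCoeff (κ : LipschitzDensity (𝓡∂ d) M) (y : Euc d) : ℝ :=
  c.densityCoeff κ (fold y)

omit [IsW2InftyManifold (𝓡∂ d) M] in
theorem doubleMetricCoeff_posDef {y : Euc d} (hy : fold y ∈ c.chart.target) :
    (c.doubleMetricCoeff g y).PosDef := by
  rcases le_or_gt 0 (y 0) with h | h
  · rw [fold_of_nonneg h] at hy
    rw [doubleMetricCoeff_of_nonneg h]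
    exact c.metricCoeff_posDef g hy
  · rw [fold_of_nonpos h.le] at hy
    rw [doubleMetricCoeff, if_neg (not_le.2 h)]
    have h1 := (c.metricCoeff_posDef g hy).conjTranspose_mul_mul_same (B := reflMatrix d)
      (Matrix.mulVec_injective_iff_isUnit.2 (IsUnit.of_mul_eq_one _ reflMatrix_mul_self))
    rwa [Matrix.conjTranspose_eq_transpose_of_trivial, reflMatrix_transpose] at h1

omit [IsW2InftyManifold (𝓡∂ d) M] in
theorem doubleMetricCoeff_lipschitz (hc : c.IsNormal g) (i j : Fin d) :
    LocallyLipschitzOn (fold ⁻¹' c.chart.target) fun y => c.doubleMetricCoeff g y i j := by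
  refine locallyLipschitzOn_preimage_fold c.isHalfOpen_target (c.metricCoeff_lipschitz g i j)
    (f₂ := fun y => reflSign i * c.metricCoeff g y i j * reflSign j) ?_ ?_ ?_
  · exact ((LocallyLipschitzOn.const _ _).mul_real (c.metricCoeff_lipschitz g i j)).mul_real
      (LocallyLipschitzOn.const _ _)
  · intro y _ h
    rw [doubleMetricCoeff_of_nonneg h]
  · intro y hy h
    rw [doubleMetricCoeff_of_nonpos hc hy h, reflMatrix_mul_mul_apply]

theorem doubleMetricCoeff_compat (hc : c.IsNormal g) (hc' : c'.IsNormal g) {y : Euc d}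
    (hy : fold y ∈ c.overlap c') :
    c.doubleMetricCoeff g y =
      (readJacobian (𝓡 d) (𝓡 d) (id : Double d M → Double d M) c.doubleChart c'.doubleChart y)ᵀ *
        c'.doubleMetricCoeff g (readMap (𝓡 d) (𝓡 d) (id : Double d M → Double d M)
          c.doubleChart c'.doubleChart y) *
      readJacobian (𝓡 d) (𝓡 d) (id : Double d M → Double d M) c.doubleChart c'.doubleChart y := by
  rw [readMap_doubleChart c c' hy]
  rcases le_total 0 (y 0) with h | h
  · rw [readJacobian_doubleChart_of_nonneg hc hc' hy h, doubleMap_of_nonneg h,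
      doubleMetricCoeff_of_nonneg h]
    rw [fold_of_nonneg h] at hy
    rw [doubleMetricCoeff_of_nonneg (c'.isHalfOpen_target.subset (c.mapsTo_trans c' hy).1)]
    exact c.metricCoeff_compat c' g hy
  · rw [readJacobian_doubleChart_of_nonpos hc hc' hy h, doubleMap_of_nonpos h
      (fun h0 => (c.trans_zero_iff c' (by rwa [fold_of_nonpos h, reflect_of_zero h0] at hy)).2 h0), doubleMetricCoeff_of_nonpos hc hy.1 h]
    rw [fold_of_nonpos h] at hy
    have hz := (c.mapsTo_trans c' hy).1
    have hz0 : 0 ≤ c.trans c' (reflect d y) 0 := c'.isHalfOpen_target.subset hz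
    rw [doubleMetricCoeff_of_nonpos hc' (by rwa [fold_reflect, fold_of_nonneg hz0])
      (by rwa [reflect_apply_zero, neg_nonpos]), reflect_reflect, c.metricCoeff_compat c' g hy]
    set R := reflMatrix d
    set J := jacobian (c.trans c') (c.overlap c') (reflect d y)
    set G := c'.metricCoeff g (c.trans c' (reflect d y))
    -- In the product all inner reflections occur in adjacent pairs, and each pair is the identity.
    have hR : ∀ A : Matrix (Fin d) (Fin d) ℝ, R * (R * A) = A := fun A => by
      rw [← Matrix.mul_assoc, reflMatrix_mul_self, Matrix.one_mul]
    rw [Matrix.transpose_mul, Matrix.transpose_mul, reflMatrix_transpose]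
    simp only [Matrix.mul_assoc]
    simp only [show reflMatrix d = R from rfl, hR]

theorem doubleDensityCoeff_compat (κ : LipschitzDensity (𝓡∂ d) M) (hc : c.IsNormal g)
    (hc' : c'.IsNormal g) {y : Euc d} (hy : fold y ∈ c.overlap c') :
    c.doubleDensityCoeff κ y = |(readJacobian (𝓡 d) (𝓡 d) (id : Double d M → Double d M)
        c.doubleChart c'.doubleChart y).det| *
      c'.doubleDensityCoeff κ (readMap (𝓡 d) (𝓡 d) (id : Double d M → Double d M)
        c.doubleChart c'.doubleChart y) := by
  rw [readMap_doubleChart c c' hy, doubleDensityCoeff, doubleDensityCoeff]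
  rcases le_total 0 (y 0) with h | h
  · rw [readJacobian_doubleChart_of_nonneg hc hc' hy h, doubleMap_of_nonneg h]
    rw [fold_of_nonneg h] at hy ⊢
    rw [fold_of_nonneg (c'.isHalfOpen_target.subset (c.mapsTo_trans c' hy).1)]
    exact c.densityCoeff_compat c' κ hy
  · rw [readJacobian_doubleChart_of_nonpos hc hc' hy h, doubleMap_of_nonpos h
      (fun h0 => (c.trans_zero_iff c' (by rwa [fold_of_nonpos h, reflect_of_zero h0] at hy)).2 h0)]
    rw [fold_of_nonpos h] at hy ⊢
    rw [fold_reflect, fold_of_nonneg (c'.isHalfOpen_target.subset (c.mapsTo_trans c' hy).1),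
      Matrix.det_mul, Matrix.det_mul, abs_mul, abs_mul, abs_det_reflMatrix, one_mul, mul_one]
    exact c.densityCoeff_compat c' κ hy

omit [IsW2InftyManifold (𝓡∂ d) M] in
theorem doubleDensityCoeff_lipschitz :
    LocallyLipschitzOn (fold ⁻¹' c.chart.target) (c.doubleDensityCoeff κ) := by
  refine locallyLipschitzOn_preimage_fold c.isHalfOpen_target (c.densityCoeff_lipschitz κ)
    (c.densityCoeff_lipschitz κ) ?_ ?_
  · intro y _ h
    rw [doubleDensityCoeff, fold_of_nonneg h]
  · intro y _ h
    rw [doubleDensityCoeff, fold_of_nonpos h]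

/-! #### The inclusions in coordinates -/

theorem readDomain_incl {φ : OpenPartialHomeomorph M (EuclideanHalfSpace d)}
    (hφ : φ ∈ atlas (EuclideanHalfSpace d) M) (c : W2Chart d M) (ε : ℤˣ) :
    readDomain (𝓡∂ d) (Double.incl d ε : M → Double d M) φ c.doubleChart =
      (ofAtlas hφ).overlap c := by
  rw [overlap, chart_ofAtlas]
  rfl

theorem readMap_incl {φ : OpenPartialHomeomorph M (EuclideanHalfSpace d)}
    (hφ : φ ∈ atlas (EuclideanHalfSpace d) M) (c : W2Chart d M) (ε : ℤˣ) :
    EqOn (readMap (𝓡∂ d) (𝓡 d) (Double.incl d ε : M → Double d M) φ c.doubleChart)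
      (signReflect ε ∘ (ofAtlas hφ).trans c) ((ofAtlas hφ).overlap c) := by
  intro y hy
  have h : readMap (𝓡∂ d) (𝓡 d) (Double.incl d ε : M → Double d M) φ c.doubleChart y =
      c.doubleFun (Double.incl d ε ((φ.extend (𝓡∂ d)).symm y)) := rfl
  have hy2 := hy.2
  rw [chart_ofAtlas] at hy2
  rw [h, c.doubleFun_incl ε hy2, Function.comp_apply, trans_apply, chart_ofAtlas]

theorem isW2InftyOn_readMap_incl {φ : OpenPartialHomeomorph M (EuclideanHalfSpace d)}
    (hφ : φ ∈ atlas (EuclideanHalfSpace d) M) (c : W2Chart d M) (ε : ℤˣ) :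
    IsW2InftyOn (readMap (𝓡∂ d) (𝓡 d) (Double.incl d ε : M → Double d M) φ c.doubleChart)
      (readDomain (𝓡∂ d) (Double.incl d ε : M → Double d M) φ c.doubleChart) := by
  rw [readDomain_incl hφ]
  have hO := (ofAtlas hφ).isHalfOpen_overlap c
  have h := (ofAtlas hφ).isW2InftyOn_trans c
  refine IsW2InftyOn.congr ?_ (readMap_incl hφ c ε)
  rcases Int.units_eq_one_or ε with rfl | rfl
  · exact h.congr fun y _ => signReflect_one _
  · exact ((isW2InftyOn_reflect isOpen_univ).comp h hO.uniqueDiffOn (hO.locallyLipschitzOn h.1)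
      (mapsTo_univ _ _)).congr fun y _ => signReflect_neg_one _

theorem readJacobian_incl_one {φ : OpenPartialHomeomorph M (EuclideanHalfSpace d)}
    (hφ : φ ∈ atlas (EuclideanHalfSpace d) M) (c : W2Chart d M) {y : Euc d}
    (hy : y ∈ (ofAtlas hφ).overlap c) :
    readJacobian (𝓡∂ d) (𝓡 d) (Double.incl d 1 : M → Double d M) φ c.doubleChart y =
      jacobian ((ofAtlas hφ).trans c) ((ofAtlas hφ).overlap c) y := by
  rw [readJacobian, readDomain_incl hφ]
  exact jacobian_congr (fun z hz => (readMap_incl hφ c 1 hz).trans (signReflect_one _)) hy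

theorem readJacobian_incl_neg_one {φ : OpenPartialHomeomorph M (EuclideanHalfSpace d)}
    (hφ : φ ∈ atlas (EuclideanHalfSpace d) M) (c : W2Chart d M) {y : Euc d}
    (hy : y ∈ (ofAtlas hφ).overlap c) :
    readJacobian (𝓡∂ d) (𝓡 d) (Double.incl d (-1) : M → Double d M) φ c.doubleChart y =
      reflMatrix d * jacobian ((ofAtlas hφ).trans c) ((ofAtlas hφ).overlap c) y := by
  rw [readJacobian, readDomain_incl hφ, ← jacobian_reflect_comp
    (((ofAtlas hφ).isHalfOpen_overlap c).uniqueDiffOn y hy)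
    (((ofAtlas hφ).isW2InftyOn_trans c).1.differentiableOn one_ne_zero _ hy)]
  exact jacobian_congr (fun z hz => (readMap_incl hφ c (-1) hz).trans (signReflect_neg_one _)) hy

theorem metricCoeff_pullback_incl (hc : c.IsNormal g)
    {φ : OpenPartialHomeomorph M (EuclideanHalfSpace d)}
    (hφ : φ ∈ atlas (EuclideanHalfSpace d) M) (ε : ℤˣ) {y : Euc d}
    (hy : y ∈ (ofAtlas hφ).overlap c) :
    g.coeff φ y =
      (readJacobian (𝓡∂ d) (𝓡 d) (Double.incl d ε : M → Double d M) φ c.doubleChart y)ᵀ *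
        c.doubleMetricCoeff g
          (readMap (𝓡∂ d) (𝓡 d) (Double.incl d ε : M → Double d M) φ c.doubleChart y) *
      readJacobian (𝓡∂ d) (𝓡 d) (Double.incl d ε : M → Double d M) φ c.doubleChart y := by
  have hz := ((ofAtlas hφ).mapsTo_trans c hy).1
  have hz0 : 0 ≤ (ofAtlas hφ).trans c y 0 := c.isHalfOpen_target.subset hz
  have hy1 := hy.1
  rw [chart_ofAtlas] at hy1
  rw [readMap_incl hφ c ε hy, Function.comp_apply, ← metricCoeff_ofAtlas g hφ hy1,
    (ofAtlas hφ).metricCoeff_compat c g hy]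
  rcases Int.units_eq_one_or ε with rfl | rfl
  · rw [signReflect_one, doubleMetricCoeff_of_nonneg hz0, readJacobian_incl_one hφ c hy]
  · rw [signReflect_neg_one, doubleMetricCoeff_of_nonpos hc
      (by rwa [fold_reflect, fold_of_nonneg hz0]) (by rwa [reflect_apply_zero, neg_nonpos]),
      reflect_reflect, readJacobian_incl_neg_one hφ c hy, Matrix.transpose_mul, reflMatrix_transpose]
    have hR : ∀ A : Matrix (Fin d) (Fin d) ℝ, reflMatrix d * (reflMatrix d * A) = A := fun A => by
      rw [← Matrix.mul_assoc, reflMatrix_mul_self, Matrix.one_mul]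
    simp only [Matrix.mul_assoc, hR]

theorem densityCoeff_pullback_incl {φ : OpenPartialHomeomorph M (EuclideanHalfSpace d)}
    (hφ : φ ∈ atlas (EuclideanHalfSpace d) M) (c : W2Chart d M) (ε : ℤˣ) {y : Euc d}
    (hy : y ∈ (ofAtlas hφ).overlap c) :
    κ.coeff φ y =
      |(readJacobian (𝓡∂ d) (𝓡 d) (Double.incl d ε : M → Double d M) φ c.doubleChart y).det| *
        c.doubleDensityCoeff κ
          (readMap (𝓡∂ d) (𝓡 d) (Double.incl d ε : M → Double d M) φ c.doubleChart y) := by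
  have hz := ((ofAtlas hφ).mapsTo_trans c hy).1
  have hz0 : 0 ≤ (ofAtlas hφ).trans c y 0 := c.isHalfOpen_target.subset hz
  have hy1 := hy.1
  rw [chart_ofAtlas] at hy1
  rw [readMap_incl hφ c ε hy, Function.comp_apply, ← densityCoeff_ofAtlas κ hφ hy1,
    (ofAtlas hφ).densityCoeff_compat c κ hy, doubleDensityCoeff, fold_signReflect,
    fold_of_nonneg hz0]
  rcases Int.units_eq_one_or ε with rfl | rfl
  · rw [readJacobian_incl_one hφ c hy]
  · rw [readJacobian_incl_neg_one hφ c hy, Matrix.det_mul, abs_mul, abs_det_reflMatrix, one_mul]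

end W2Chart

/-! #### The atlas, the metric and the density of the double -/

open Double

/-- The atlas of the double made of the reflections of charts in which the metric is block diagonal
on the boundary. -/
noncomputable abbrev doubleChartedSpace : ChartedSpace (Euc d) (Double d M) where
  atlas := {Φ | ∃ c : W2Chart d M, c.IsNormal g ∧ c.doubleChart = Φ}
  chartAt p := (exists_isNormal g (proj p)).choose.doubleChart
  mem_chart_source p := (exists_isNormal g (proj p)).choose_spec.1
  chart_mem_atlas p := ⟨_, (exists_isNormal g (proj p)).choose_spec.2, rfl⟩

theorem isW2InftyManifold_double :
    letI := doubleChartedSpace g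
    IsW2InftyManifold (𝓡 d) (Double d M) := by
  let := doubleChartedSpace g
  refine ⟨?_⟩
  rintro _ ⟨c, hc, rfl⟩ _ ⟨c', hc', rfl⟩
  exact W2Chart.isW2InftyOn_readMap_doubleChart hc hc'

open Classical in
/-- The metric of the double. -/
noncomputable def doubleMetric :
    letI := doubleChartedSpace g
    LipschitzMetric (𝓡 d) (Double d M) :=
  letI := doubleChartedSpace g
  -- A chart of the double does not record the `W2Chart` it comes from, so one is chosen. The
  -- properties below hold for any choice, and the value 0 outside the atlas is a dummy.
  { coeff := fun Φ => if h : Φ ∈ atlas (Euc d) (Double d M) then h.choose.doubleMetricCoeff g else 0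
    posDef := fun Φ h y hy => by
      rw [dif_pos h]
      rw [← h.choose_spec.2] at hy
      simp only [mfld_simps] at hy
      exact W2Chart.doubleMetricCoeff_posDef hy
    lipschitz := fun Φ h i j => by
      rw [dif_pos h]
      conv_lhs => rw [← h.choose_spec.2]
      simp only [mfld_simps]
      exact W2Chart.doubleMetricCoeff_lipschitz h.choose_spec.1 i j
    compat := fun Φ h Ψ h' y hy => by
      rw [dif_pos h, dif_pos h']
      have := W2Chart.doubleMetricCoeff_compat h.choose_spec.1 h'.choose_spec.1 (y := y)
      rw [← mem_preimage, ← W2Chart.readDomain_doubleChart, h.choose_spec.2, h'.choose_spec.2] at this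
      exact this hy }

open Classical in
/-- The density of the double. -/
noncomputable def doubleDensity :
    letI := doubleChartedSpace g
    LipschitzDensity (𝓡 d) (Double d M) :=
  letI := doubleChartedSpace g
  { coeff := fun Φ => if h : Φ ∈ atlas (Euc d) (Double d M) then h.choose.doubleDensityCoeff κ else 0
    pos := fun Φ h y hy => by
      rw [dif_pos h]
      rw [← h.choose_spec.2] at hy
      simp only [mfld_simps] at hy
      exact W2Chart.densityCoeff_pos _ κ hy
    lipschitz := fun Φ h => by
      rw [dif_pos h]
      conv_lhs => rw [← h.choose_spec.2]
      simp only [mfld_simps]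
      exact W2Chart.doubleDensityCoeff_lipschitz κ
    compat := fun Φ h Ψ h' y hy => by
      rw [dif_pos h, dif_pos h']
      have := W2Chart.doubleDensityCoeff_compat κ h.choose_spec.1 h'.choose_spec.1 (y := y)
      rw [← mem_preimage, ← W2Chart.readDomain_doubleChart, h.choose_spec.2, h'.choose_spec.2] at this
      exact this hy }

/-- Metric and density choose from the same existence statement, so a single `c` represents both. -/
theorem exists_doubleChart_eq :
    letI := doubleChartedSpace g
    ∀ Φ ∈ atlas (Euc d) (Double d M), ∃ c : W2Chart d M, c.IsNormal g ∧ c.doubleChart = Φ ∧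
      (doubleMetric g).coeff Φ = c.doubleMetricCoeff g ∧
      ∀ κ, (doubleDensity g κ).coeff Φ = c.doubleDensityCoeff κ :=
  fun _ hΦ => ⟨hΦ.choose, hΦ.choose_spec.1, hΦ.choose_spec.2, dif_pos hΦ, fun _ => dif_pos hΦ⟩

theorem isIsometricEmbedding_incl (ε : ℤˣ) :
    letI := doubleChartedSpace g
    IsIsometricEmbedding g (doubleMetric g) (incl d ε : M → Double d M) := by
  let := doubleChartedSpace g
  refine ⟨isEmbedding_incl ε, ?_, ?_⟩
  · rintro φ hφ _ ⟨c, hc, rfl⟩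
    exact W2Chart.isW2InftyOn_readMap_incl hφ c ε
  · intro φ hφ Φ hΦ y hy
    obtain ⟨c, hc, rfl, hg, -⟩ := exists_doubleChart_eq g Φ hΦ
    rw [W2Chart.readDomain_incl hφ] at hy
    rw [hg]
    exact W2Chart.metricCoeff_pullback_incl hc hφ ε hy

theorem isInducedDensity_incl (ε : ℤˣ) :
    letI := doubleChartedSpace g
    IsInducedDensity κ (doubleDensity g κ) (incl d ε : M → Double d M) := by
  let := doubleChartedSpace g
  intro φ hφ Φ hΦ y hy
  obtain ⟨c, hc, rfl, -, hκ⟩ := exists_doubleChart_eq g Φ hΦ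
  rw [W2Chart.readDomain_incl hφ] at hy
  rw [hκ κ]
  exact W2Chart.densityCoeff_pullback_incl κ hφ c ε hy

end DoubleStructure

/-! ### Even and odd extensions -/

section Extension

variable {d : ℕ}

theorem IsWeakGradient.mono {s t : Set (Euc d)} {u : Euc d → ℝ} {w : Euc d → Fin d → ℝ}
    (h : IsWeakGradient s u w) (hs : MeasurableSet s) (hts : t ⊆ s) :
    IsWeakGradient t u w := by
  intro ζ hζ hζc hζt i
  have h1 := h ζ hζ hζc (hζt.trans (interior_mono hts)) i
  have h0 : ∀ y, y ∉ t → ζ y = 0 := fun y hy => image_eq_zero_of_notMem_tsupport fun h =>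
    hy (interior_subset (hζt h))
  have h0' : ∀ y, y ∉ t → fderiv ℝ ζ y = 0 := fun y hy => by
    by_contra h3
    exact hy (interior_subset (hζt (support_fderiv_subset ℝ h3)))
  rw [setIntegral_eq_of_subset_of_forall_sdiff_eq_zero hs hts fun y hy => by
      rw [h0' y hy.2, zero_apply, mul_zero],
    setIntegral_eq_of_subset_of_forall_sdiff_eq_zero hs hts fun y hy => by
      rw [h0 y hy.2, mul_zero]] at h1
  exact h1

theorem IsWeakGradient.congr {s : Set (Euc d)} {u u' : Euc d → ℝ} {w w' : Euc d → Fin d → ℝ}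
    (h : IsWeakGradient s u w) (hs : MeasurableSet s) (hu : EqOn u' u s) (hw : EqOn w' w s) :
    IsWeakGradient s u' w' := by
  intro ζ hζ hζc hζs i
  have e1 : ∫ y in s, u' y * fderiv ℝ ζ y (EuclideanSpace.single i 1) =
      ∫ y in s, u y * fderiv ℝ ζ y (EuclideanSpace.single i 1) :=
    setIntegral_congr_fun hs fun y hy => by simp only [hu hy]
  have e2 : ∫ y in s, w' y i * ζ y = ∫ y in s, w y i * ζ y :=
    setIntegral_congr_fun hs fun y hy => by simp only [hw hy]
  rw [e1, e2]
  exact h ζ hζ hζc hζs i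

/-- On a compact set the measure is finite and `g` is bounded, so L² convergence implies L¹
convergence of the products. -/
theorem tendsto_integral_mul_of_tendsto_eLpNorm {K : Set (Euc d)} (hK : IsCompact K)
    {f : ℕ → Euc d → ℝ} {f₀ g : Euc d → ℝ} (hf₀ : MemLp f₀ 2 (volume.restrict K))
    (hf : ∀ n, AEStronglyMeasurable (f n) (volume.restrict K)) (hg : ContinuousOn g K)
    (h : Tendsto (fun n => eLpNorm (fun y => f n y - f₀ y) 2 (volume.restrict K)) atTop (𝓝 0)) :
    Tendsto (fun n => ∫ y in K, f n y * g y) atTop (𝓝 (∫ y in K, f₀ y * g y)) := by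
  have hfin : IsFiniteMeasure (volume.restrict K) := ⟨by simpa using hK.measure_lt_top⟩
  obtain ⟨C, hC⟩ := hK.exists_bound_of_continuousOn hg
  have hgm : AEStronglyMeasurable g (volume.restrict K) := hg.aestronglyMeasurable hK.measurableSet
  have hfm : ∀ n, AEStronglyMeasurable (fun y => f n y - f₀ y) (volume.restrict K) := fun n =>
    (hf n).sub hf₀.aestronglyMeasurable
  have hb : ∀ n, eLpNorm (fun y => f n y * g y - f₀ y * g y) 1 (volume.restrict K) ≤
      ENNReal.ofReal C * (eLpNorm (fun y => f n y - f₀ y) 2 (volume.restrict K) *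
        (volume.restrict K) univ ^ (1 / (1 : ENNReal).toReal - 1 / (2 : ENNReal).toReal)) := by
    intro n
    refine (eLpNorm_le_mul_eLpNorm_of_ae_le_mul (g := fun y => f n y - f₀ y) (c := C) ?_ 1).trans ?_
    · filter_upwards [ae_restrict_mem hK.measurableSet] with y hy
      rw [← sub_mul, norm_mul, mul_comm]
      exact mul_le_mul_of_nonneg_right (hC y hy) (norm_nonneg _)
    · gcongr
      exact eLpNorm_le_eLpNorm_mul_rpow_measure_univ one_le_two (hfm n)
  have hlim : Tendsto (fun n => eLpNorm (fun y => f n y * g y - f₀ y * g y) 1 (volume.restrict K))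
      atTop (𝓝 0) := by
    refine tendsto_of_tendsto_of_tendsto_of_le_of_le tendsto_const_nhds ?_ (fun _ => zero_le) hb
    have hm : (volume.restrict K) univ ^ (1 / (1 : ENNReal).toReal - 1 / (2 : ENNReal).toReal) ≠ ⊤ :=
      ENNReal.rpow_ne_top_of_nonneg (by norm_num) (measure_ne_top _ _)
    have := ENNReal.Tendsto.const_mul (a := ENNReal.ofReal C)
      (ENNReal.Tendsto.mul_const h (Or.inr hm)) (Or.inr ENNReal.ofReal_ne_top)
    simpa using this
  have hi : Integrable (fun y => f₀ y * g y) (volume.restrict K) :=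
    (hf₀.integrable one_le_two).mul_bdd (c := C) hgm (by
      filter_upwards [ae_restrict_mem hK.measurableSet] with y hy using hC y hy)
  refine tendsto_integral_of_L1' _ hi.aestronglyMeasurable ?_ hlim
  filter_upwards [hlim.eventually (gt_mem_nhds ENNReal.zero_lt_top)] with n hn
  have h1 : Integrable (fun y => f n y * g y - f₀ y * g y) (volume.restrict K) :=
    memLp_one_iff_integrable.1 ⟨((hf n).mul hgm).sub hi.aestronglyMeasurable, hn⟩
  exact (h1.add hi).congr (Eventually.of_forall fun y => sub_add_cancel _ _)

variable [NeZero d]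

/-- The extension of `f` to the other side of the hyperplane which is `τ` times its reflection. -/
noncomputable def extendSign (τ : ℝ) (f : Euc d → ℝ) (y : Euc d) : ℝ :=
  if 0 ≤ y 0 then f y else τ * f (reflect d y)

theorem extendSign_of_nonneg {τ : ℝ} {f : Euc d → ℝ} {y : Euc d} (h : 0 ≤ y 0) :
    extendSign τ f y = f y := if_pos h

theorem extendSign_reflect {τ : ℝ} {f : Euc d → ℝ} {y : Euc d} (h : 0 < y 0) :
    extendSign τ f (reflect d y) = τ * f y := by
  rw [extendSign, if_neg (by rw [reflect_apply_zero]; linarith), reflect_reflect]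

theorem isCompact_image_fold {K : Set (Euc d)} (hK : IsCompact K) : IsCompact (fold '' K) :=
  hK.image continuous_fold

theorem IsLocL2.extendSign {T : Set (Euc d)} {f : Euc d → ℝ} (hf : IsLocL2 T f) (τ : ℝ) :
    IsLocL2 (fold ⁻¹' T) (extendSign τ f) := by
  intro K hKT hK
  set K' := fold '' K
  have hK' : IsCompact K' := isCompact_image_fold hK
  have h1 : MemLp (K'.indicator f) 2 volume :=
    (memLp_indicator_iff_restrict hK'.measurableSet).2 (hf K' (image_subset_iff.2 hKT) hK')
  have h2 : MemLp (fun y => τ * (K'.indicator f) (reflect d y)) 2 volume :=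
    (h1.comp_measurePreserving measurePreserving_reflect).const_mul τ
  have hm : MeasurableSet {y : Euc d | 0 ≤ y 0} := isClosed_halfSpace.measurableSet
  have h3 := ((h1.indicator hm).add (h2.indicator hm.compl)).restrict K
  refine h3.ae_eq ?_
  filter_upwards [ae_restrict_mem hK.measurableSet] with y hy
  have hy' : fold y ∈ K' := mem_image_of_mem _ hy
  rw [Pi.add_apply]
  by_cases h : 0 ≤ y 0
  · rw [fold_of_nonneg h] at hy'
    have h' : y ∈ {y : Euc d | 0 ≤ y 0} := h
    rw [indicator_of_mem h', indicator_of_notMem (notMem_compl_iff.2 h'), indicator_of_mem hy',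
      add_zero, extendSign_of_nonneg h]
  · rw [fold_of_nonpos (not_le.1 h).le] at hy'
    have h' : y ∉ {y : Euc d | 0 ≤ y 0} := h
    rw [indicator_of_notMem h', indicator_of_mem (mem_compl h'), indicator_of_mem hy',
      zero_add, _root_.extendSign, if_neg h]

/-- Extension is dual to folding: reflecting the lower half upwards moves the sign `τ` from `f` to
the test function. -/
theorem integral_preimage_fold_extendSign {T K : Set (Euc d)} (hT : IsHalfOpen T) {f : Euc d → ℝ}
    (hf : IsLocL2 T f) (τ : ℝ) (hK : IsCompact K) (hKT : K ⊆ fold ⁻¹' T) {g : Euc d → ℝ}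
    (hg : ContinuousOn g (fold ⁻¹' T)) (h0 : ∀ y ∈ fold ⁻¹' T, y ∉ K → g y = 0) :
    IntegrableOn (fun y => f y * (g y + τ * g (reflect d y))) T ∧
    ∫ y in fold ⁻¹' T, extendSign τ f y * g y = ∫ y in T, f y * (g y + τ * g (reflect d y)) := by
  have hTf : T ⊆ fold ⁻¹' T := fun y hy => by rwa [mem_preimage, fold_of_nonneg (hT.subset hy)]
  have hTr : ∀ y ∈ T, reflect d y ∈ fold ⁻¹' T := fun y hy => by
    rw [mem_preimage, fold_reflect]; exact hTf hy
  have hK' : IsCompact (fold '' K) := isCompact_image_fold hK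
  have hK'T : fold '' K ⊆ T := image_subset_iff.2 hKT
  have hm : ∀ y ∈ T, y ∉ fold '' K → y ∉ K ∧ reflect d y ∉ K := fun y hy hyK =>
    ⟨fun h => hyK ⟨y, h, fold_of_nonneg (hT.subset hy)⟩, fun h => hyK ⟨_, h, by
      rw [fold_reflect, fold_of_nonneg (hT.subset hy)]⟩⟩
  have i1 : IntegrableOn (fun y => f y * g y) T :=
    integrableOn_mul_of_support hT.measurableSet hK' (hf.integrableOn hK' hK'T)
      (hg.mono (hK'T.trans hTf)) fun y hy hyK => h0 y (hTf hy) (hm y hy hyK).1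
  have i2 : IntegrableOn (fun y => f y * (τ * g (reflect d y))) T :=
    integrableOn_mul_of_support hT.measurableSet hK' (hf.integrableOn hK' hK'T)
      (continuousOn_const.mul (hg.comp (reflect d).continuous.continuousOn fun y hy =>
        hTr y (hK'T hy))) fun y hy hyK => by
          rw [h0 _ (hTr y hy) (hm y hy hyK).2, mul_zero]
  have e1 : EqOn (fun y => extendSign τ f y * g y) (fun y => f y * g y) T := fun y hy => by
    simp only [extendSign_of_nonneg (show 0 ≤ y 0 from hT.subset hy)]
  have e2 : (fun y => f y * (τ * g (reflect d y))) =ᵐ[volume.restrict T]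
      fun y => extendSign τ f (reflect d y) * g (reflect d y) := by
    filter_upwards [ae_restrict_interior hT] with y hy
    rw [extendSign_reflect hy.2]; ring
  refine ⟨(i1.add i2).congr (Eventually.of_forall fun y => (mul_add _ _ _).symm), ?_⟩
  rw [integral_preimage_fold hT (i1.congr_fun e1.symm hT.measurableSet) (i2.congr e2)]
  refine integral_congr_ae ?_
  filter_upwards [ae_restrict_interior hT] with y hy
  rw [extendSign_reflect hy.2, extendSign_of_nonneg hy.2.le]
  ring

/-- The weak gradient of an even or odd extension. -/
theorem isWeakGradient_extendSign {T : Set (Euc d)} (hT : IsHalfOpen T) {U : Euc d → ℝ}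
    {W : Euc d → Fin d → ℝ} (hU : IsLocL2 T U) (hW : ∀ i, IsLocL2 T fun y => W y i) {σ : ℝ}
    (h : ∀ η : Euc d → ℝ, ContDiff ℝ ∞ η → HasCompactSupport η → tsupport η ∩ halfSpace d ⊆ T →
      ∀ i, (σ = 1 → i = 0 → ∀ y, y 0 = 0 → η y = 0) →
      ∫ y in T, U y * fderiv ℝ η y (EuclideanSpace.single i 1) = -∫ y in T, W y i * η y) :
    IsWeakGradient (fold ⁻¹' T) (extendSign σ U)
      fun y i => extendSign (σ * reflSign i) (fun y => W y i) y := by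
  intro ζ hζ hζc hζs i
  rw [hT.isOpen_preimage_fold.interior_eq] at hζs
  -- The reflection reverses the normal derivative, so the `i`-th component of the gradient extends
  -- with an additional factor `reflSign i`.
  set τ := σ * reflSign i
  set η : Euc d → ℝ := fun y => ζ y + τ * ζ (reflect d y)
  have hζr : ContDiff ℝ ∞ fun y => ζ (reflect d y) := hζ.comp (reflectL d).contDiff
  have hη : ContDiff ℝ ∞ η := hζ.add (contDiff_const.mul hζr)
  have hdr : ∀ y, fderiv ℝ (fun y => ζ (reflect d y)) y (EuclideanSpace.single i 1) =
      reflSign i * fderiv ℝ ζ (reflect d y) (EuclideanSpace.single i 1) := fun y => by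
    have h1 : HasFDerivAt (fun y => ζ (reflect d y))
        ((fderiv ℝ ζ (reflect d y)).comp (reflectL d)) y :=
      (hζ.differentiable (by simp) _).hasFDerivAt.comp y (reflectL d).hasFDerivAt
    rw [h1.fderiv, ContinuousLinearMap.comp_apply, reflectL_apply, reflect_single, map_smul,
      smul_eq_mul]
  -- Differentiating the reflected term gives a second factor `reflSign i`, and the derivative of
  -- the folded function carries the sign `σ`, as folding for `U` requires.
  have hdη : ∀ y, fderiv ℝ η y (EuclideanSpace.single i 1) =
      fderiv ℝ ζ y (EuclideanSpace.single i 1) +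
        σ * fderiv ℝ ζ (reflect d y) (EuclideanSpace.single i 1) := fun y => by
    have h1 : fderiv ℝ η y = fderiv ℝ ζ y + τ • fderiv ℝ (fun y => ζ (reflect d y)) y :=
      ((hζ.differentiable (by simp) y).hasFDerivAt.add
        ((hζr.differentiable (by simp) y).hasFDerivAt.const_mul τ)).fderiv
    rw [h1, add_apply, smul_apply, hdr, smul_eq_mul]
    simp only [τ]
    linear_combination (σ * fderiv ℝ ζ (reflect d y) (EuclideanSpace.single i 1)) *
      reflSign_mul_self i
  have hsup : tsupport η ⊆ tsupport ζ ∪ reflect d ⁻¹' tsupport ζ := by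
    refine closure_minimal (fun y hy => ?_) ((isClosed_tsupport _).union
      ((isClosed_tsupport _).preimage (reflect d).continuous))
    by_contra h
    rw [mem_union, not_or, mem_preimage] at h
    refine hy ?_
    simp only [η, image_eq_zero_of_notMem_tsupport h.1, image_eq_zero_of_notMem_tsupport h.2,
      mul_zero, add_zero]
  have hηc : HasCompactSupport η :=
    (hζc.isCompact.union ((reflect d).toHomeomorph.isCompact_preimage.2 hζc.isCompact)).of_isClosed_subset
      (isClosed_tsupport _) hsup
  have hηT : tsupport η ∩ halfSpace d ⊆ T := fun y hy => by
    have h2 : y ∈ fold ⁻¹' T := by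
      rcases hsup hy.1 with h3 | h3
      · exact hζs h3
      · have := hζs h3
        rwa [mem_preimage, fold_reflect] at this
    rwa [mem_preimage, fold_of_nonneg hy.2] at h2
  have h0 : ∀ y ∈ fold ⁻¹' T, y ∉ tsupport ζ → ζ y = 0 := fun y _ hy =>
    image_eq_zero_of_notMem_tsupport hy
  have h0' : ∀ y ∈ fold ⁻¹' T, y ∉ tsupport ζ → fderiv ℝ ζ y (EuclideanSpace.single i 1) = 0 :=
    fun y _ hy => by
      have : fderiv ℝ ζ y = 0 := by
        by_contra h3
        exact hy (support_fderiv_subset ℝ h3)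
      rw [this]; rfl
  rw [(integral_preimage_fold_extendSign hT hU σ hζc.isCompact hζs
      (continuous_partialDeriv hζ _).continuousOn h0').2,
    (integral_preimage_fold_extendSign hT (hW i) τ hζc.isCompact hζs
      hζ.continuous.continuousOn h0).2]
  -- For an even extension and the normal derivative, `τ = -1`, and the two terms of `η` cancel on
  -- the hyperplane.
  have := h η hη hηc hηT i fun hσ1 hi y hy0 => by
    simp only [η, τ, hσ1, hi, reflSign, reflect_of_zero hy0]
    simp
  simpa only [hdη] using this

end Extension

/-! ### Functions of class `C^1` in charts -/

section ContMDiffCharts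

variable {d : ℕ} {H : Type*} [TopologicalSpace H] {I : ModelWithCorners ℝ (Euc d) H}
  {M : Type*} [TopologicalSpace M] [ChartedSpace H M]

theorem ContMDiff.contDiffOn_comp_symm [IsManifold I 1 M] {v : M → ℝ}
    (hv : ContMDiff I 𝓘(ℝ, ℝ) 1 v) {φ : OpenPartialHomeomorph M H} (hφ : φ ∈ atlas H M) :
    ContDiffOn ℝ 1 (v ∘ (φ.extend I).symm) (φ.extend I).target := by
  rw [← contMDiffOn_iff_contDiffOn, OpenPartialHomeomorph.extend_target']
  exact hv.comp_contMDiffOn (contMDiffOn_extend_symm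
    (IsManifold.subset_maximalAtlas hφ))

theorem contMDiff_of_contDiffOn_comp_symm [IsManifold I 1 M] {v : M → ℝ} (hc : Continuous v)
    (hv : ∀ φ ∈ atlas H M, ContDiffOn ℝ 1 (v ∘ (φ.extend I).symm) (φ.extend I).target) :
    ContMDiff I 𝓘(ℝ, ℝ) 1 v :=
  contMDiff_iff.2 ⟨hc, fun x _ => (hv _ (chart_mem_atlas H x)).mono inter_subset_left⟩

/-- Regularity of `f` is known in pairs of charts only. Near a given point `v ∘ f` is read through
one chart of `N` around the image point. -/
theorem ContMDiff.comp_of_readMap [IsManifold I 1 M] {H' : Type*} [TopologicalSpace H']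
    {I' : ModelWithCorners ℝ (Euc d) H'} {N : Type*} [TopologicalSpace N] [ChartedSpace H' N]
    [IsManifold I' 1 N] {f : M → N} (hf : Continuous f)
    (h : ∀ φ ∈ atlas H M, ∀ ψ ∈ atlas H' N,
      ContDiffOn ℝ 1 (readMap I I' f φ ψ) (readDomain I f φ ψ))
    {v : N → ℝ} (hv : ContMDiff I' 𝓘(ℝ, ℝ) 1 v) : ContMDiff I 𝓘(ℝ, ℝ) 1 (v ∘ f) := by
  refine contMDiff_of_contDiffOn_comp_symm (hv.continuous.comp hf) fun φ hφ y hy => ?_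
  set ψ := chartAt H' (f ((φ.extend I).symm y))
  have hψ : ψ ∈ atlas H' N := chart_mem_atlas _ _
  have hyD : y ∈ readDomain I f φ ψ := ⟨hy, mem_chart_source _ _⟩
  have hD : readDomain I f φ ψ ∈ 𝓝[(φ.extend I).target] y :=
    inter_mem self_mem_nhdsWithin ((φ.continuousOn_extend_symm y hy).preimage_mem_nhdsWithin
      ((ψ.open_source.preimage hf).mem_nhds hyD.2))
  have hm : MapsTo (readMap I I' f φ ψ) (readDomain I f φ ψ) (ψ.extend I').target := fun z hz =>
    (ψ.extend I').map_source (by rw [OpenPartialHomeomorph.extend_source]; exact hz.2)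
  have h1 := (hv.contDiffOn_comp_symm hψ).comp (h φ hφ ψ hψ) hm
  have h2 : ContDiffOn ℝ 1 ((v ∘ f) ∘ (φ.extend I).symm) (readDomain I f φ ψ) :=
    h1.congr fun z hz => by
      simp only [Function.comp_apply, readMap]
      rw [(ψ.extend I').left_inv (by rw [OpenPartialHomeomorph.extend_source]; exact hz.2)]
  exact (h2 y hyD).mono_of_mem_nhdsWithin hD

end ContMDiffCharts

/-! ### Sobolev functions in charts -/

namespace W2Chart

variable {d : ℕ} [NeZero d] {M : Type*} [TopologicalSpace M]
  [ChartedSpace (EuclideanHalfSpace d) M] [IsW2InftyManifold (𝓡∂ d) M] (c : W2Chart d M)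

/-- The change of coordinates to the underlying chart of the atlas. -/
noncomputable abbrev toBase : PartialEquiv (Euc d) (Euc d) := c.trans (ofAtlas c.base_mem)

omit [IsW2InftyManifold (𝓡∂ d) M] in
theorem toBase_source : c.toBase.source = c.chart.target := by
  rw [toBase, trans_source, overlap, chart_ofAtlas, OpenPartialHomeomorph.extend_source,
    inter_eq_left]
  exact fun y hy => c.source_subset (c.chart.map_target hy)

omit [IsW2InftyManifold (𝓡∂ d) M] in
theorem toBase_apply (y : Euc d) : c.toBase y = c.base.extend (𝓡∂ d) (c.chart.symm y) := by
  rw [toBase, trans_apply, chart_ofAtlas]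

omit [IsW2InftyManifold (𝓡∂ d) M] in
theorem toBase_target :
    c.toBase.target = (c.base.extend (𝓡∂ d)).target ∩
      (c.base.extend (𝓡∂ d)).symm ⁻¹' c.chart.source := by
  rw [toBase, trans_target, overlap, chart_ofAtlas]

omit [IsW2InftyManifold (𝓡∂ d) M] in
theorem base_symm_toBase {y : Euc d} (hy : y ∈ c.chart.target) :
    (c.base.extend (𝓡∂ d)).symm (c.toBase y) = c.chart.symm y := by
  rw [toBase_apply, (c.base.extend (𝓡∂ d)).left_inv]
  rw [OpenPartialHomeomorph.extend_source]
  exact c.source_subset (c.chart.map_target hy)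

theorem isHalfDiffeo_toBase : IsHalfDiffeo c.toBase := c.isHalfDiffeo_trans _

/-- The components in the chart of a gradient. -/
noncomputable def localGrad
    (w : OpenPartialHomeomorph M (EuclideanHalfSpace d) → Euc d → Fin d → ℝ) (y : Euc d) :
    Fin d → ℝ :=
  (jacobian c.toBase c.toBase.source y)ᵀ *ᵥ w c.base (c.toBase y)

variable {u : M → ℝ} {w : OpenPartialHomeomorph M (EuclideanHalfSpace d) → Euc d → Fin d → ℝ}

theorem isLocL2_comp_symm (h : IsH1 (𝓡∂ d) u w) : IsLocL2 c.chart.target (u ∘ c.chart.symm) := by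
  have h1 := c.isHalfDiffeo_toBase.isLocL2_comp ((h.memL2 _ c.base_mem).mono
    (by rw [toBase_target]; exact inter_subset_left))
  rw [toBase_source] at h1
  refine h1.congr ?_
  filter_upwards [ae_restrict_mem c.isHalfOpen_target.measurableSet] with y hy
  simp only [Function.comp_apply, c.base_symm_toBase hy]

theorem isLocL2_localGrad (h : IsH1 (𝓡∂ d) u w) (i : Fin d) :
    IsLocL2 c.chart.target fun y => c.localGrad w y i := by
  have h1 := c.isHalfDiffeo_toBase.isLocL2_transpose_mulVec (w := w c.base)
    (fun i => (h.grad_memL2 _ c.base_mem i).mono (by rw [toBase_target]; exact inter_subset_left)) i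
  have h2 : IsLocL2 c.toBase.source fun y => c.localGrad w y i := h1
  rwa [toBase_source] at h2

theorem isWeakGradient_localGrad (h : IsH1 (𝓡∂ d) u w) :
    IsWeakGradient c.chart.target (u ∘ c.chart.symm) (c.localGrad w) := by
  have hsub : c.toBase.target ⊆ (c.base.extend (𝓡∂ d)).target := by
    rw [toBase_target]; exact inter_subset_left
  have h1 := c.isHalfDiffeo_toBase.isWeakGradient_comp
    ((h.weakGradient _ c.base_mem).mono (isHalfOpen_extend_target _).measurableSet hsub)
    ((h.memL2 _ c.base_mem).mono hsub) (fun i => (h.grad_memL2 _ c.base_mem i).mono hsub)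
  have h2 : IsWeakGradient c.toBase.source (u ∘ c.chart.symm) (c.localGrad w) :=
    h1.congr c.isHalfDiffeo_toBase.source.measurableSet (fun y hy => by
      rw [toBase_source] at hy
      simp only [Function.comp_apply, c.base_symm_toBase hy]) fun y _ => rfl
  rwa [toBase_source] at h2

theorem contDiffOn_comp_chart_symm {q : M → ℝ} (hq : ContMDiff (𝓡∂ d) 𝓘(ℝ, ℝ) 1 q) :
    ContDiffOn ℝ 1 (q ∘ c.chart.symm) c.chart.target := by
  have := IsW2InftyManifold.isManifold (𝓡∂ d) M
  have h1 := (hq.contDiffOn_comp_symm c.base_mem).comp c.isHalfDiffeo_toBase.contDiffOn fun y hy => by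
    have := c.toBase.map_source hy
    rw [toBase_target] at this
    exact this.1
  rw [toBase_source] at h1
  exact h1.congr fun y hy => by simp only [Function.comp_apply, c.base_symm_toBase hy]

theorem grad_comp_chart_symm {q : M → ℝ} (hq : ContMDiff (𝓡∂ d) 𝓘(ℝ, ℝ) 1 q) {y : Euc d}
    (hy : y ∈ c.chart.target) : grad (q ∘ c.chart.symm) c.chart.target y =
      (jacobian c.toBase c.toBase.source y)ᵀ *ᵥ
        grad (q ∘ (c.base.extend (𝓡∂ d)).symm) (c.base.extend (𝓡∂ d)).target (c.toBase y) := by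
  have := IsW2InftyManifold.isManifold (𝓡∂ d) M
  have hm : MapsTo c.toBase c.toBase.source (c.base.extend (𝓡∂ d)).target := fun y hy => by
    have := c.toBase.map_source hy
    rw [toBase_target] at this
    exact this.1
  have hy' := hy
  rw [← toBase_source] at hy'
  rw [← grad_comp ((hq.contDiffOn_comp_symm c.base_mem).differentiableOn one_ne_zero _ (hm hy'))
    (c.isHalfDiffeo_toBase.contDiffOn.differentiableOn one_ne_zero _ hy') hm
    (c.isHalfDiffeo_toBase.source.uniqueDiffOn _ hy'), toBase_source]
  have e : EqOn (q ∘ c.chart.symm) ((q ∘ (c.base.extend (𝓡∂ d)).symm) ∘ c.toBase) c.chart.target :=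
    fun z hz => by simp only [Function.comp_apply, c.base_symm_toBase hz]
  ext i
  simp only [grad, fderivWithin_congr e (e hy)]

/-- Integration by parts for functions with zero trace. -/
theorem integral_mul_fderiv_eq_of_isH10 (h : IsH10 (𝓡∂ d) u w) {η : Euc d → ℝ}
    (hη : ContDiff ℝ ∞ η) (hηc : HasCompactSupport η)
    (hηT : tsupport η ∩ halfSpace d ⊆ c.chart.target) (i : Fin d) :
    ∫ y in c.chart.target, u (c.chart.symm y) * fderiv ℝ η y (EuclideanSpace.single i 1) =
      -∫ y in c.chart.target, c.localGrad w y i * η y := by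
  obtain ⟨hH1, v, hv, hlim⟩ := h
  set T := c.chart.target
  have hT : IsHalfOpen T := c.isHalfOpen_target
  have he := c.isHalfDiffeo_toBase
  set K := tsupport η ∩ halfSpace d
  have hK : IsCompact K := hηc.isCompact.inter_right isClosed_halfSpace
  have hKs : K ⊆ c.toBase.source := by rwa [toBase_source]
  have hKφ : c.toBase '' K ⊆ (c.base.extend (𝓡∂ d)).target := by
    refine image_subset_iff.2 fun y hy => ?_
    have := c.toBase.map_source (hKs hy)
    rw [toBase_target] at this
    exact this.1
  have hKc := he.image_isCompact hK hKs
  obtain ⟨l1, l2⟩ := hlim _ c.base_mem _ hKφ hKc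
  obtain ⟨C, hC⟩ := he.eLpNorm_comp_le hK hKs
  have hη0 : ∀ y ∈ T, y ∉ K → η y = 0 := fun y hy hyK =>
    image_eq_zero_of_notMem_tsupport fun h' => hyK ⟨h', hT.subset hy⟩
  have hη0' : ∀ y ∈ T, y ∉ K → fderiv ℝ η y (EuclideanSpace.single i 1) = 0 := fun y hy hyK => by
    have : fderiv ℝ η y = 0 := by
      by_contra h3
      exact hyK ⟨support_fderiv_subset ℝ h3, hT.subset hy⟩
    rw [this]; rfl
  have red : ∀ f g : Euc d → ℝ, (∀ y ∈ T, y ∉ K → g y = 0) →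
      ∫ y in T, f y * g y = ∫ y in K, f y * g y := fun f g hg =>
    setIntegral_eq_of_subset_of_forall_sdiff_eq_zero hT.measurableSet hηT fun y hy => by
      rw [hg y hy.1 hy.2, mul_zero]
  have := IsW2InftyManifold.isManifold (𝓡∂ d) M
  -- The convergence defining zero trace is stated in charts of the atlas. It is carried to the
  -- chart `c` by the uniform bound for composition with `c.toBase`.
  have lim : ∀ (f : ℕ → Euc d → ℝ) (f₀ g : Euc d → ℝ),
      IsLocL2 (c.base.extend (𝓡∂ d)).target f₀ →
      (∀ n, ContinuousOn (f n) (c.base.extend (𝓡∂ d)).target) → ContinuousOn g K →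
      Tendsto (fun n => eLpNorm (fun y => f n y - f₀ y) 2 (volume.restrict (c.toBase '' K)))
        atTop (𝓝 0) →
      Tendsto (fun n => ∫ y in K, f n (c.toBase y) * g y) atTop
        (𝓝 (∫ y in K, f₀ (c.toBase y) * g y)) := by
    intro f f₀ g hf₀ hf hg hl
    have hm : ∀ n, AEStronglyMeasurable (f n) (volume.restrict (c.toBase '' K)) := fun n =>
      ((hf n).mono hKφ).aestronglyMeasurable hKc.measurableSet
    have hf₀' := hf₀ _ hKφ hKc
    refine tendsto_integral_mul_of_tendsto_eLpNorm hK (f := fun n y => f n (c.toBase y))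
      (f₀ := fun y => f₀ (c.toBase y)) ?_ (fun n => (hC _ (hm n)).1) hg ?_
    · obtain ⟨m1, m2⟩ := hC _ hf₀'.aestronglyMeasurable
      exact ⟨m1, m2.trans_lt (ENNReal.mul_lt_top ENNReal.coe_lt_top hf₀'.2)⟩
    · refine tendsto_of_tendsto_of_tendsto_of_le_of_le tendsto_const_nhds ?_ (fun _ => zero_le)
        fun n => (hC _ ((hm n).sub hf₀'.aestronglyMeasurable)).2
      have := ENNReal.Tendsto.const_mul (a := (C : ENNReal)) hl (Or.inr ENNReal.coe_ne_top)
      rwa [mul_zero] at this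
  have hvφ : ∀ n, ContDiffOn ℝ 1 (v n ∘ (c.base.extend (𝓡∂ d)).symm)
      (c.base.extend (𝓡∂ d)).target := fun n => (hv n).1.contDiffOn_comp_symm c.base_mem
  have hJ : ∀ j, ContinuousOn (fun y => jacobian c.toBase c.toBase.source y j i * η y) K := fun j =>
    ((he.continuousOn_jacobian j i).mono hKs).mul hη.continuous.continuousOn
  have L1 := lim (fun n => v n ∘ (c.base.extend (𝓡∂ d)).symm) (u ∘ (c.base.extend (𝓡∂ d)).symm)
    (fun y => fderiv ℝ η y (EuclideanSpace.single i 1)) (hH1.memL2 _ c.base_mem)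
    (fun n => (hvφ n).continuousOn) (continuous_partialDeriv hη _).continuousOn l1
  have L2 := tendsto_finsetSum Finset.univ fun j _ =>
    lim (fun n y => grad (v n ∘ (c.base.extend (𝓡∂ d)).symm) (c.base.extend (𝓡∂ d)).target y j)
      (fun y => w c.base y j) _ (hH1.grad_memL2 _ c.base_mem j)
      (fun n => continuousOn_grad (isHalfOpen_extend_target _) (hvφ n) j) (hJ j) (l2 j)
  -- The approximants are supported in the interior, so integration by parts has no boundary term,
  -- although `η` need not vanish on the hyperplane.
  have key : ∀ n, ∫ y in K, (v n ∘ (c.base.extend (𝓡∂ d)).symm) (c.toBase y) *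
      fderiv ℝ η y (EuclideanSpace.single i 1) =
      -∑ j, ∫ y in K, grad (v n ∘ (c.base.extend (𝓡∂ d)).symm) (c.base.extend (𝓡∂ d)).target
        (c.toBase y) j * (jacobian c.toBase c.toBase.source y j i * η y) := by
    intro n
    set V := v n ∘ c.chart.symm
    have hV : ContDiffOn ℝ 1 V T := c.contDiffOn_comp_chart_symm (hv n).1
    -- This compact set avoids the hyperplane because the support of `v n` contains no boundary
    -- point.
    set Kn := K ∩ c.chart.symm ⁻¹' tsupport (v n)
    have hKn : IsCompact Kn :=
      hK.of_isClosed_subset ((c.continuousOn_chart_symm.mono hηT).preimage_isClosed_of_isClosed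
        hK.isClosed (isClosed_tsupport _)) inter_subset_left
    have hKnT : Kn ⊆ interior T := fun y hy => by
      rw [hT.interior_eq]
      refine ⟨hηT hy.1, lt_of_le_of_ne hy.1.2 fun h0 => ?_⟩
      have h1 := (c.symm_mem_boundary_iff (hηT hy.1)).2 h0.symm
      exact ((𝓡∂ d).disjoint_interior_boundary (M := M)).le_bot ⟨(hv n).2 hy.2, h1⟩
    have hz : ∀ y ∈ interior T, y ∉ Kn → V =ᶠ[𝓝 y] 0 ∨ η =ᶠ[𝓝 y] 0 := fun y hy hyK => by
      by_cases h1 : y ∈ tsupport η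
      · left
        have h2 : c.chart.symm y ∉ tsupport (v n) := fun h =>
          hyK ⟨⟨h1, hT.subset (interior_subset hy)⟩, h⟩
        exact (c.continuousOn_chart_symm.continuousAt (mem_interior_iff_mem_nhds.1 hy)).eventually
          (notMem_tsupport_iff_eventuallyEq.1 h2)
      · exact Or.inr (notMem_tsupport_iff_eventuallyEq.1 h1)
    have ibp := setIntegral_mul_fderiv_eq_neg isOpen_interior hKn hKnT (hV.mono interior_subset)
      (hη.of_le (by simp)).contDiffOn hz (EuclideanSpace.single i 1)
    rw [← hT.setIntegral_interior] at ibp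
    have e1 : ∫ y in interior T, fderiv ℝ V y (EuclideanSpace.single i 1) * η y =
        ∫ y in T, grad V T y i * η y := by
      rw [hT.setIntegral_interior]
      refine setIntegral_congr_fun isOpen_interior.measurableSet fun y hy => ?_
      simp only [grad, fderivWithin_of_mem_nhds (mem_interior_iff_mem_nhds.1 hy)]
    rw [e1, red V _ hη0', red _ η hη0] at ibp
    have e2 : ∫ y in K, (v n ∘ (c.base.extend (𝓡∂ d)).symm) (c.toBase y) *
        fderiv ℝ η y (EuclideanSpace.single i 1) =
        ∫ y in K, V y * fderiv ℝ η y (EuclideanSpace.single i 1) :=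
      setIntegral_congr_fun hK.measurableSet fun y hy => by
        simp only [V, Function.comp_apply, c.base_symm_toBase (hηT hy)]
    rw [e2, ibp, ← integral_finsetSum]
    · congr 1
      refine setIntegral_congr_fun hK.measurableSet fun y hy => ?_
      have hg : grad V T y i = _ := congrFun (c.grad_comp_chart_symm (hv n).1 (hηT hy)) i
      simp only [hg, Matrix.mulVec, dotProduct, Matrix.transpose_apply, Finset.sum_mul]
      exact Finset.sum_congr rfl fun j _ => by ring
    · intro j _
      refine ContinuousOn.integrableOn_compact hK ?_
      exact ((continuousOn_grad (isHalfOpen_extend_target _) (hvφ n) j).comp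
        (he.contDiffOn.continuousOn.mono hKs) fun y hy => hKφ (mem_image_of_mem _ hy)).mul (hJ j)
  simp only [key] at L1
  have hfin := tendsto_nhds_unique L1 L2.neg
  rw [red _ _ hη0', red _ η hη0]
  have e3 : ∫ y in K, u (c.chart.symm y) * fderiv ℝ η y (EuclideanSpace.single i 1) =
      ∫ y in K, (u ∘ (c.base.extend (𝓡∂ d)).symm) (c.toBase y) *
        fderiv ℝ η y (EuclideanSpace.single i 1) :=
    setIntegral_congr_fun hK.measurableSet fun y hy => by
      simp only [Function.comp_apply, c.base_symm_toBase (hηT hy)]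
  rw [e3, hfin, ← integral_finsetSum]
  · congr 1
    refine setIntegral_congr_fun hK.measurableSet fun y _ => ?_
    simp only [localGrad, Matrix.mulVec, dotProduct, Matrix.transpose_apply, Finset.sum_mul]
    exact Finset.sum_congr rfl fun j _ => by ring
  · intro j _
    have h1 := he.isLocL2_comp ((hH1.grad_memL2 _ c.base_mem j).mono (t := c.toBase.target)
      (by rw [toBase_target]; exact inter_subset_left))
    exact (h1.integrableOn hK hKs).mul_continuousOn (hJ j) hK

end W2Chart

/-! ### The weak equation in charts -/

section WeakEquation

variable {d : ℕ} [NeZero d] {M : Type*} [TopologicalSpace M]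
  [ChartedSpace (EuclideanHalfSpace d) M] [IsW2InftyManifold (𝓡∂ d) M]

omit [NeZero d] in
theorem isLocL2_flux {T : Set (Euc d)} {A : Euc d → Matrix (Fin d) (Fin d) ℝ} {k : Euc d → ℝ}
    {w : Euc d → Fin d → ℝ} (hA : ∀ i j, ContinuousOn (fun y => A y i j) T) (hk : ContinuousOn k T)
    (hw : ∀ i, IsLocL2 T fun y => w y i) (i : Fin d) :
    IsLocL2 T fun y => k y * (A y *ᵥ w y) i := by
  refine IsLocL2.continuousOn_mul ?_ hk
  simp only [Matrix.mulVec, dotProduct]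
  exact IsLocL2.sum fun j _ => (hw j).continuousOn_mul (hA i j)

omit [NeZero d] in
-- Invariance of the pairing of two gradients: covectors transform by `Jᵀ` and the metric by
-- congruence, so the Jacobians cancel.
theorem inv_congruence_dotProduct {G J : Matrix (Fin d) (Fin d) ℝ} (hJ : J.det ≠ 0)
    (w v : Fin d → ℝ) :
    ((Jᵀ * G * J)⁻¹ *ᵥ (Jᵀ *ᵥ w)) ⬝ᵥ (Jᵀ *ᵥ v) = (G⁻¹ *ᵥ w) ⬝ᵥ v := by
  have hu : IsUnit J.det := hJ.isUnit
  have hut : IsUnit Jᵀ.det := by rwa [Matrix.det_transpose]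
  rw [Matrix.mul_inv_rev, Matrix.mul_inv_rev, Matrix.mulVec_mulVec, Matrix.mul_assoc,
    Matrix.mul_assoc, Matrix.nonsing_inv_mul _ hut, Matrix.mul_one, Matrix.dotProduct_mulVec,
    Matrix.vecMul_transpose, Matrix.mulVec_mulVec, ← Matrix.mul_assoc, Matrix.mul_nonsing_inv _ hu,
    Matrix.one_mul]

omit [ChartedSpace (EuclideanHalfSpace d) M] [IsW2InftyManifold (𝓡∂ d) M] in
theorem eventually_comp_extend_symm_eq_zero {q : M → ℝ}
    (φ : OpenPartialHomeomorph M (EuclideanHalfSpace d)) {x : Euc d}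
    (hx : x ∈ (φ.extend (𝓡∂ d)).target) (hq : (φ.extend (𝓡∂ d)).symm x ∉ tsupport q) :
    q ∘ (φ.extend (𝓡∂ d)).symm =ᶠ[𝓝[(φ.extend (𝓡∂ d)).target] x] fun _ => 0 :=
  (φ.continuousOn_extend_symm x hx).eventually (notMem_tsupport_iff_eventuallyEq.1 hq)

omit [IsW2InftyManifold (𝓡∂ d) M] [ChartedSpace (EuclideanHalfSpace d) M] in
theorem grad_comp_extend_symm_eq_zero {q : M → ℝ}
    (φ : OpenPartialHomeomorph M (EuclideanHalfSpace d)) {x : Euc d}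
    (hx : x ∈ (φ.extend (𝓡∂ d)).target) (hq : (φ.extend (𝓡∂ d)).symm x ∉ tsupport q) :
    grad (q ∘ (φ.extend (𝓡∂ d)).symm) (φ.extend (𝓡∂ d)).target x = 0 := by
  have h := eventually_comp_extend_symm_eq_zero φ hx hq
  ext i
  simp only [grad]
  rw [h.fderivWithin_eq (h.self_of_nhdsWithin hx)]
  simp

namespace W2Chart

variable (c : W2Chart d M)

/-- The chart `c` covers only part of its base chart. The change of variables reaches the whole base
chart because the integrand vanishes on the rest. -/
theorem setIntegral_toBase {f F : Euc d → ℝ}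
    (h : ∀ y ∈ c.chart.target, f y = |(jacobian c.toBase c.toBase.source y).det| * F (c.toBase y))
    (hF : ∀ x ∈ (c.base.extend (𝓡∂ d)).target,
      (c.base.extend (𝓡∂ d)).symm x ∉ c.chart.source → F x = 0) :
    ∫ y in c.chart.target, f y = ∫ x in (c.base.extend (𝓡∂ d)).target, F x := by
  have hm := (isHalfOpen_extend_target c.base).measurableSet
  rw [setIntegral_congr_fun c.isHalfOpen_target.measurableSet h, ← c.toBase_source,
    ← c.isHalfDiffeo_toBase.integral_target, toBase_target]
  exact (setIntegral_eq_of_subset_of_forall_sdiff_eq_zero hm inter_subset_left fun x hx =>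
    hF x hx.1 fun h' => hx.2 ⟨hx.1, h'⟩).symm

variable (g : LipschitzMetric (𝓡∂ d) M) (κ : LipschitzDensity (𝓡∂ d) M) {u q : M → ℝ} {μ : ℝ}
  {w : OpenPartialHomeomorph M (EuclideanHalfSpace d) → Euc d → Fin d → ℝ}

/-- The weak equation can be written in any chart containing the support of the test function. -/
theorem weakEigenEquation_base_iff (hq : ContMDiff (𝓡∂ d) 𝓘(ℝ, ℝ) 1 q)
    (hs : tsupport q ⊆ c.chart.source) :
    WeakEigenEquation g κ μ u w c.base q ↔
      ∫ y in c.chart.target, (((c.metricCoeff g y)⁻¹ *ᵥ c.localGrad w y) ⬝ᵥ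
          grad (q ∘ c.chart.symm) c.chart.target y) * c.densityCoeff κ y =
        μ * ∫ y in c.chart.target, u (c.chart.symm y) * q (c.chart.symm y) * c.densityCoeff κ y := by
  have hd : ∀ y ∈ c.chart.target, c.densityCoeff κ y =
      |(jacobian c.toBase c.toBase.source y).det| * κ.coeff c.base (c.toBase y) := fun y hy => by
    have hy' := hy
    rw [← toBase_source] at hy'
    have h1 := c.toBase.map_source hy'
    rw [toBase_target] at h1
    rw [c.densityCoeff_compat _ κ hy', densityCoeff_ofAtlas κ c.base_mem h1.1]
    rfl
  have hg : ∀ y ∈ c.chart.target, c.metricCoeff g y =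
      (jacobian c.toBase c.toBase.source y)ᵀ * g.coeff c.base (c.toBase y) *
        jacobian c.toBase c.toBase.source y := fun y hy => by
    have hy' := hy
    rw [← toBase_source] at hy'
    have h1 := c.toBase.map_source hy'
    rw [toBase_target] at h1
    rw [c.metricCoeff_compat _ g hy', metricCoeff_ofAtlas g c.base_mem h1.1]
    rfl
  have e1 := c.setIntegral_toBase
    (f := fun y => (((c.metricCoeff g y)⁻¹ *ᵥ c.localGrad w y) ⬝ᵥ
      grad (q ∘ c.chart.symm) c.chart.target y) * c.densityCoeff κ y)
    (F := fun x => (((g.coeff c.base x)⁻¹ *ᵥ w c.base x) ⬝ᵥ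
      grad (q ∘ (c.base.extend (𝓡∂ d)).symm) (c.base.extend (𝓡∂ d)).target x) * κ.coeff c.base x)
    (fun y hy => by
      have hJ := c.isHalfDiffeo_toBase.det_ne_zero (c.toBase_source.symm ▸ hy : y ∈ c.toBase.source)
      simp only [hd y hy, hg y hy, c.grad_comp_chart_symm hq hy, localGrad]
      rw [inv_congruence_dotProduct hJ]
      ring)
    fun x hx hxs => by
      simp only [grad_comp_extend_symm_eq_zero c.base hx fun h => hxs (hs h), dotProduct_zero,
        zero_mul]
  have e2 := c.setIntegral_toBase
    (f := fun y => u (c.chart.symm y) * q (c.chart.symm y) * c.densityCoeff κ y)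
    (F := fun x => u ((c.base.extend (𝓡∂ d)).symm x) * q ((c.base.extend (𝓡∂ d)).symm x) *
      κ.coeff c.base x) (fun y hy => by
      simp only [hd y hy, c.base_symm_toBase hy]
      ring)
    fun x hx hxs => by
      simp only [image_eq_zero_of_notMem_tsupport fun h => hxs (hs h), mul_zero, zero_mul]
  rw [WeakEigenEquation, e1, e2]

end W2Chart

omit [NeZero d] in
theorem LipschitzMetric.continuousOn_inv {H N : Type*} [TopologicalSpace H] [TopologicalSpace N]
    [ChartedSpace H N] {I : ModelWithCorners ℝ (Euc d) H} (g : LipschitzMetric I N)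
    {φ : OpenPartialHomeomorph N H} (hφ : φ ∈ atlas H N) (i j : Fin d) :
    ContinuousOn (fun y => (g.coeff φ y)⁻¹ i j) (φ.extend I).target :=
  (LocallyLipschitzOn.matrix_inv (g.lipschitz φ hφ)
    (fun y hy => (g.posDef φ hφ y hy).det_pos.ne') i j).continuousOn

/-- For a Dirichlet eigenfunction, the weak equation holds for test functions vanishing on the
boundary. -/
theorem weakEigenEquation_of_eq_zero_on_boundary [CompactSpace M] {g : LipschitzMetric (𝓡∂ d) M}
    {κ : LipschitzDensity (𝓡∂ d) M} {u : M → ℝ} {μ : ℝ}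
    {w : OpenPartialHomeomorph M (EuclideanHalfSpace d) → Euc d → Fin d → ℝ}
    (hu : IsH1 (𝓡∂ d) u w) {φ : OpenPartialHomeomorph M (EuclideanHalfSpace d)}
    (hφ : φ ∈ atlas (EuclideanHalfSpace d) M)
    (h : ∀ v : M → ℝ, ContMDiff (𝓡∂ d) 𝓘(ℝ, ℝ) 1 v → tsupport v ⊆ φ.source →
      tsupport v ⊆ (𝓡∂ d).interior M → WeakEigenEquation g κ μ u w φ v)
    {q : M → ℝ} (hq : ContMDiff (𝓡∂ d) 𝓘(ℝ, ℝ) 1 q) (hs : tsupport q ⊆ φ.source)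
    (hb : ∀ x ∈ (𝓡∂ d).boundary M, q x = 0) : WeakEigenEquation g κ μ u w φ q := by
  have := IsW2InftyManifold.isManifold (𝓡∂ d) M
  set T := (φ.extend (𝓡∂ d)).target
  have hT : IsHalfOpen T := isHalfOpen_extend_target φ
  have hcφ : ContinuousOn (φ.extend (𝓡∂ d)) (tsupport q) :=
    φ.continuousOn_extend.mono (by rwa [OpenPartialHomeomorph.extend_source])
  set K := φ.extend (𝓡∂ d) '' tsupport q
  have hK : IsCompact K := (isClosed_tsupport q).isCompact.image_of_continuousOn hcφ
  have hKT : K ⊆ T := image_subset_iff.2 fun x hx => (φ.extend (𝓡∂ d)).map_source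
    (by rw [OpenPartialHomeomorph.extend_source]; exact hs hx)
  set Q := q ∘ (φ.extend (𝓡∂ d)).symm
  have hQ : ContDiffOn ℝ 1 Q T := hq.contDiffOn_comp_symm hφ
  have hQ0 : ∀ y ∈ T, y ∉ K → Q y = 0 := fun y hy hyK => by
    refine image_eq_zero_of_notMem_tsupport (f := q) fun h' => hyK ⟨_, h', ?_⟩
    exact (φ.extend (𝓡∂ d)).right_inv hy
  have hQb : ∀ y ∈ T, y 0 = 0 → Q y = 0 := fun y hy hy0 => hb _ <| by
    rw [mem_boundary_iff hφ, (φ.extend (𝓡∂ d)).right_inv hy, hy0]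
    have := (φ.extend (𝓡∂ d)).map_target hy
    rwa [OpenPartialHomeomorph.extend_source] at this
  -- The test function is cut off near the boundary in the coordinates of `φ`. Outside the chart
  -- these coordinates are meaningless, but there the factor `q` is zero.
  set qn : ℕ → M → ℝ := fun n x => boundaryCutoff n (φ.extend (𝓡∂ d) x) * q x
  have hqn0 : ∀ n, tsupport (qn n) ⊆ tsupport q := fun n => closure_mono fun x hx =>
    right_ne_zero_of_mul hx
  have hqn : ∀ n, ContMDiff (𝓡∂ d) 𝓘(ℝ, ℝ) 1 (qn n) := fun n x => by
    by_cases hx : x ∈ tsupport q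
    · have h1 : ContMDiffAt (𝓡∂ d) 𝓘(ℝ, Euc d) 1 (φ.extend (𝓡∂ d)) x :=
        (OpenPartialHomeomorph.contMDiffOn_extend (IsManifold.subset_maximalAtlas hφ)).contMDiffAt
          (φ.open_source.mem_nhds (hs hx))
      have h2 : ContMDiffAt (𝓡∂ d) 𝓘(ℝ, ℝ) 1 (fun x => boundaryCutoff n (φ.extend (𝓡∂ d) x)) x :=
        (((contDiff_boundaryCutoff n).of_le (by simp)).contMDiff.contMDiffAt (n := 1)).comp x h1
      exact h2.mul (hq x)
    · refine contMDiffAt_const (c := (0 : ℝ)) |>.congr_of_eventuallyEq ?_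
      filter_upwards [notMem_tsupport_iff_eventuallyEq.1 hx] with z hz
      simp only [qn, hz, Pi.zero_apply, mul_zero]
  have hqi : ∀ n, tsupport (qn n) ⊆ (𝓡∂ d).interior M := fun n => by
    have hcl : IsClosed (tsupport q ∩ φ.extend (𝓡∂ d) ⁻¹' {y | 1 ≤ n * y 0}) :=
      hcφ.preimage_isClosed_of_isClosed (isClosed_tsupport q)
        (isClosed_le continuous_const (by fun_prop))
    refine (closure_minimal (fun x hx => ?_) hcl).trans fun x hx => ?_
    · rw [Function.mem_support] at hx
      refine ⟨subset_tsupport _ (right_ne_zero_of_mul hx), ?_⟩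
      by_contra hlt
      exact left_ne_zero_of_mul hx (boundaryCutoff_eq_zero (not_le.1 hlt).le)
    · rw [← (𝓡∂ d).compl_boundary]
      intro hx'
      rw [mem_boundary_iff hφ (hs hx.1)] at hx'
      have := hx.2
      rw [mem_preimage, mem_ofPred_eq, hx', mul_zero] at this
      linarith
  have hread : ∀ n, EqOn (qn n ∘ (φ.extend (𝓡∂ d)).symm) (fun y => boundaryCutoff n y * Q y) T :=
    fun n y hy => by simp only [qn, Q, Function.comp_apply, (φ.extend (𝓡∂ d)).right_inv hy]
  have hgread : ∀ n, ∀ y ∈ T, grad (qn n ∘ (φ.extend (𝓡∂ d)).symm) T y =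
      grad (fun y => boundaryCutoff n y * Q y) T y := fun n y hy => by
    ext i
    simp only [grad, fderivWithin_congr (hread n) (hread n hy)]
  -- Metric and density are continuous, so the flux `κ g⁻¹ w` is locally L² like `w`, and the energy
  -- becomes a sum of integrals of flux components against partial derivatives.
  have hF : ∀ i, IsLocL2 T fun y => κ.coeff φ y * ((g.coeff φ y)⁻¹ *ᵥ w φ y) i :=
    isLocL2_flux (g.continuousOn_inv hφ) (κ.lipschitz φ hφ).continuousOn (hu.grad_memL2 φ hφ)
  have split : ∀ V : Euc d → ℝ, ContDiffOn ℝ 1 V T → (∀ y ∈ T, y ∉ K → V y = 0) →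
      ∫ y in T, (((g.coeff φ y)⁻¹ *ᵥ w φ y) ⬝ᵥ grad V T y) * κ.coeff φ y =
        ∑ i, ∫ y in T, κ.coeff φ y * ((g.coeff φ y)⁻¹ *ᵥ w φ y) i * grad V T y i := by
    intro V hV hV0
    rw [← integral_finsetSum]
    · refine integral_congr_ae (Eventually.of_forall fun y => ?_)
      simp only [dotProduct, Finset.sum_mul]
      exact Finset.sum_congr rfl fun i _ => by ring
    · exact fun i _ => integrableOn_mul_of_support hT.measurableSet hK ((hF i).integrableOn hK hKT)
        ((continuousOn_grad hT hV i).mono hKT)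
        fun y hy hyK => grad_eq_zero_of_notMem hK.isClosed hV0 hy hyK i
  have hχ : ∀ n, ContDiffOn ℝ 1 (fun y => boundaryCutoff n y * Q y) T := fun n =>
    ((contDiff_boundaryCutoff n).of_le (by simp)).contDiffOn.mul hQ
  have hχ0 : ∀ n, ∀ y ∈ T, y ∉ K → boundaryCutoff n y * Q y = 0 := fun n y hy hyK => by
    rw [hQ0 y hy hyK, mul_zero]
  -- The vanishing of `Q` on the hyperplane gives the bound `|Q| ≤ L * y 0`, which controls the
  -- normal derivative of the cutoff.
  have l1 := tendsto_finsetSum Finset.univ fun i _ => tendsto_integral_grad_boundaryCutoff hT hK hKT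
    hQ hQ0 ((hF i).integrableOn hK hKT) (i := i)
    (Or.inr (exists_abs_le_mul_coord hT hK hKT hQ hQ0 hQb))
  have hU : IsLocL2 T fun y => κ.coeff φ y * u ((φ.extend (𝓡∂ d)).symm y) :=
    (hu.memL2 φ hφ).continuousOn_mul (κ.lipschitz φ hφ).continuousOn
  have l2 : Tendsto (fun n => ∫ y in T, (κ.coeff φ y * u ((φ.extend (𝓡∂ d)).symm y)) *
      (boundaryCutoff n y * Q y)) atTop
      (𝓝 (∫ y in T, (κ.coeff φ y * u ((φ.extend (𝓡∂ d)).symm y)) * Q y)) := by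
    obtain ⟨C, hC⟩ := hK.exists_bound_of_continuousOn (hQ.continuousOn.mono hKT)
    refine tendsto_setIntegral_mul_of_bounded (C := C) hT.measurableSet hK.measurableSet hKT
      (hU.integrableOn hK hKT) (fun n => (hχ n).continuousOn.aestronglyMeasurable hT.measurableSet)
      (fun n y hy => ?_) hχ0 hQ0 ?_
    · rw [abs_mul, abs_of_nonneg (boundaryCutoff_nonneg n y)]
      exact (mul_le_of_le_one_left (abs_nonneg _) (boundaryCutoff_le_one n y)).trans (hC y hy)
    · filter_upwards [ae_restrict_interior hT] with y hy
      refine tendsto_const_nhds.congr' ?_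
      filter_upwards [eventually_boundaryCutoff_eq_one hy.2] with n hn
      rw [hn.eq_of_nhds]; simp
  have heq : ∀ n, ∑ i, ∫ y in T, κ.coeff φ y * ((g.coeff φ y)⁻¹ *ᵥ w φ y) i *
      grad (fun y => boundaryCutoff n y * Q y) T y i =
      μ * ∫ y in T, (κ.coeff φ y * u ((φ.extend (𝓡∂ d)).symm y)) * (boundaryCutoff n y * Q y) := by
    intro n
    rw [← split _ (hχ n) (hχ0 n)]
    have h1 : WeakEigenEquation g κ μ u w φ (qn n) := h _ (hqn n) ((hqn0 n).trans hs) (hqi n)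
    have e1 : ∫ y in T, (((g.coeff φ y)⁻¹ *ᵥ w φ y) ⬝ᵥ
        grad (fun y => boundaryCutoff n y * Q y) T y) * κ.coeff φ y =
        ∫ y in T, (((g.coeff φ y)⁻¹ *ᵥ w φ y) ⬝ᵥ
        grad (qn n ∘ (φ.extend (𝓡∂ d)).symm) T y) * κ.coeff φ y :=
      setIntegral_congr_fun hT.measurableSet fun y hy => by simp only [hgread n y hy]
    rw [e1]
    refine h1.trans ?_
    congr 1
    refine setIntegral_congr_fun hT.measurableSet fun y hy => ?_
    have := hread n hy
    simp only [Function.comp_apply] at this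
    simp only [this]
    ring
  simp only [heq] at l1
  have hfin := tendsto_nhds_unique (l2.const_mul μ) l1
  rw [WeakEigenEquation, split Q hQ hQ0, ← hfin]
  congr 1
  refine integral_congr_ae (Eventually.of_forall fun y => ?_)
  simp only [Q, Function.comp_apply]
  ring

/-- A function which is not almost everywhere zero is not so near some point. -/
theorem IsNonzeroAE.exists_forall_chart {u : M → ℝ} (h : IsNonzeroAE (𝓡∂ d) u) :
    ∃ p : M, ∀ c : W2Chart d M, p ∈ c.chart.source →
      ¬ ∀ᵐ y ∂volume.restrict c.chart.target, u (c.chart.symm y) = 0 := by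
  by_contra! hcon
  obtain ⟨φ, hφ, hne⟩ := h
  refine hne ?_
  have hT := isHalfOpen_extend_target φ
  rw [ae_restrict_iff' hT.measurableSet, ae_iff]
  -- It is enough to show that each bad point has a neighbourhood, within the bad set, of measure
  -- zero.
  refine measure_null_of_locally_null _ fun y hy => ?_
  simp only [mem_ofPred_eq, Classical.not_imp] at hy
  obtain ⟨c, hc, hae⟩ := hcon ((φ.extend (𝓡∂ d)).symm y)
  set e := c.trans (W2Chart.ofAtlas hφ)
  have he : IsHalfDiffeo e := c.isHalfDiffeo_trans _
  have htar : e.target = (φ.extend (𝓡∂ d)).target ∩ (φ.extend (𝓡∂ d)).symm ⁻¹' c.chart.source := by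
    rw [W2Chart.trans_target, W2Chart.overlap, W2Chart.chart_ofAtlas]
  have hnh : e.target ∈ 𝓝[(φ.extend (𝓡∂ d)).target] y := by
    rw [htar]
    exact inter_mem self_mem_nhdsWithin ((φ.continuousOn_extend_symm y hy.1).preimage_mem_nhdsWithin
      (c.isOpen_source.mem_nhds hc))
  set N := {z | z ∈ c.chart.target ∧ u (c.chart.symm z) ≠ 0}
  have hN : volume N = 0 := by
    rw [ae_restrict_iff' c.isHalfOpen_target.measurableSet, ae_iff] at hae
    simpa only [Classical.not_imp] using hae
  -- C¹ maps send null sets to null sets, so vanishing almost everywhere in `c` transfers to `φ`.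
  have himg : volume (e '' (N ∩ e.source)) = 0 :=
    addHaar_image_eq_zero_of_differentiableOn_of_addHaar_eq_zero volume
      ((he.contDiffOn.differentiableOn one_ne_zero).mono inter_subset_right)
      (measure_mono_null inter_subset_left hN)
  refine ⟨e.target ∩ {a | ¬(a ∈ (φ.extend (𝓡∂ d)).target → u ((φ.extend (𝓡∂ d)).symm a) = 0)},
    inter_mem (nhdsWithin_mono _ (fun a ha => (Classical.not_imp.1 ha).1) hnh) self_mem_nhdsWithin,
    measure_mono_null ?_ himg⟩
  rintro a ⟨ha, ha'⟩
  have ha' : a ∈ (φ.extend (𝓡∂ d)).target ∧ u ((φ.extend (𝓡∂ d)).symm a) ≠ 0 := Classical.not_imp.1 ha'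
  have hs := e.map_target ha
  refine ⟨e.symm a, ⟨⟨hs.1, ?_⟩, hs⟩, e.right_inv ha⟩
  have h1 : c.chart.symm (e.symm a) = (φ.extend (𝓡∂ d)).symm a := by
    rw [W2Chart.trans_symm, W2Chart.trans_apply, W2Chart.chart_ofAtlas, c.chart.left_inv]
    rw [htar] at ha
    exact ha.2
  rw [h1]
  exact ha'.2

end WeakEquation

/-! ### Eigenfunctions on the double -/

section DoubleEigenfunction

variable {d : ℕ} [NeZero d] {M : Type*} [TopologicalSpace M]
  [ChartedSpace (EuclideanHalfSpace d) M]

open Double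

open Classical in
/-- The function on the double equal to `u` on the first copy and to `σ * u` on the second one. -/
noncomputable def doubleLift (σ : ℝ) (u : M → ℝ) (p : Double d M) : ℝ :=
  if p = incl d 1 (proj p) then u (proj p) else σ * u (proj p)

theorem doubleLift_incl_one (σ : ℝ) (u : M → ℝ) (x : M) :
    doubleLift σ u (incl d 1 x) = u x := if_pos rfl

theorem doubleLift_incl_neg_one (σ : ℝ) (u : M → ℝ) {x : M} (hx : x ∉ (𝓡∂ d).boundary M) :
    doubleLift σ u (incl d (-1) x) = σ * u x := by
  refine if_neg fun h => ?_
  rw [proj_incl, incl_eq_incl_iff, or_iff_right (by decide)] at h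
  exact hx h.2

theorem doubleLift_one (u : M → ℝ) (p : Double d M) : doubleLift 1 u p = u (proj p) := by
  rw [doubleLift, one_mul, ite_self]

instance [CompactSpace M] : CompactSpace (Double d M) :=
  inferInstanceAs (CompactSpace (Quotient (doubleSetoid d M)))

variable [IsW2InftyManifold (𝓡∂ d) M]

namespace W2Chart

variable (c : W2Chart d M)

theorem doubleChart_extend_target :
    (c.doubleChart.extend (𝓡 d)).target = fold ⁻¹' c.chart.target := by
  simp only [mfld_simps]
  rfl

theorem doubleLift_doubleInv (σ : ℝ) (u : M → ℝ) {y : Euc d} (hy : fold y ∈ c.chart.target) :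
    doubleLift σ u (c.doubleInv y) = extendSign σ (u ∘ c.chart.symm) y := by
  rcases le_or_gt 0 (y 0) with h | h
  · rw [c.doubleInv_of_nonneg h, doubleLift_incl_one, extendSign_of_nonneg h]
    rfl
  · rw [c.doubleInv_of_nonpos hy h.le, extendSign, if_neg (not_le.2 h)]
    rw [fold_of_nonpos h.le] at hy
    rw [doubleLift_incl_neg_one, Function.comp_apply]
    rw [c.symm_mem_boundary_iff hy, reflect_apply_zero]
    linarith

variable {c} {g : LipschitzMetric (𝓡∂ d) M} (κ : LipschitzDensity (𝓡∂ d) M)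

omit [IsW2InftyManifold (𝓡∂ d) M] in
theorem inv_doubleMetricCoeff_reflect (hc : c.IsNormal g) {y : Euc d} (hy : y ∈ c.chart.target)
    (i j : Fin d) : (c.doubleMetricCoeff g (reflect d y))⁻¹ i j =
      reflSign i * (c.metricCoeff g y)⁻¹ i j * reflSign j := by
  have h0 : 0 ≤ y 0 := c.isHalfOpen_target.subset hy
  rw [doubleMetricCoeff_of_nonpos hc (by rwa [fold_reflect, fold_of_nonneg h0])
    (by rwa [reflect_apply_zero, neg_nonpos]), reflect_reflect, Matrix.mul_inv_rev,
    Matrix.mul_inv_rev, Matrix.inv_eq_left_inv reflMatrix_mul_self, ← Matrix.mul_assoc,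
    reflMatrix_mul_mul_apply]

omit [IsW2InftyManifold (𝓡∂ d) M] in
theorem continuousOn_inv_doubleMetricCoeff (hc : c.IsNormal g) (i j : Fin d) :
    ContinuousOn (fun y => (c.doubleMetricCoeff g y)⁻¹ i j) (fold ⁻¹' c.chart.target) :=
  (LocallyLipschitzOn.matrix_inv (doubleMetricCoeff_lipschitz hc)
    (fun _ hy => (doubleMetricCoeff_posDef hy).det_pos.ne') i j).continuousOn

/-- The sum, up to sign, of the values of a function at the two points above a point. -/
noncomputable def _root_.Double.trace (σ : ℝ) (v : Double d M → ℝ) (x : M) : ℝ :=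
  v (incl d 1 x) + σ * v (incl d (-1) x)

theorem trace_chart_symm (σ : ℝ) (v : Double d M → ℝ) :
    EqOn (trace σ v ∘ c.chart.symm)
      (fun y => (v ∘ c.doubleInv) y + σ * (v ∘ c.doubleInv) (reflect d y)) c.chart.target := by
  intro y hy
  have h0 : 0 ≤ y 0 := c.isHalfOpen_target.subset hy
  simp only [Function.comp_apply, Double.trace]
  rw [c.doubleInv_of_nonneg h0, c.doubleInv_of_nonpos (by rwa [fold_reflect, fold_of_nonneg h0])
    (by rwa [reflect_apply_zero, neg_nonpos]), reflect_reflect]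

omit [IsW2InftyManifold (𝓡∂ d) M] in
theorem subset_preimage_fold : c.chart.target ⊆ fold ⁻¹' c.chart.target := fun y hy => by
  rwa [mem_preimage, fold_of_nonneg (c.isHalfOpen_target.subset hy)]

omit [IsW2InftyManifold (𝓡∂ d) M] in
theorem reflect_mem_preimage_fold {y : Euc d} (hy : y ∈ c.chart.target) :
    reflect d y ∈ fold ⁻¹' c.chart.target := by
  rw [mem_preimage, fold_reflect]
  exact subset_preimage_fold hy

theorem grad_trace_chart_symm (σ : ℝ) {v : Double d M → ℝ}
    (hv : ContDiffOn ℝ 1 (v ∘ c.doubleInv) (fold ⁻¹' c.chart.target)) {y : Euc d}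
    (hy : y ∈ c.chart.target) (i : Fin d) :
    grad (trace σ v ∘ c.chart.symm) c.chart.target y i =
      grad (v ∘ c.doubleInv) (fold ⁻¹' c.chart.target) y i +
        σ * (reflSign i * grad (v ∘ c.doubleInv) (fold ⁻¹' c.chart.target) (reflect d y) i) := by
  have hO := c.isHalfOpen_target.isOpen_preimage_fold
  have hd : ∀ z ∈ fold ⁻¹' c.chart.target, HasFDerivAt (v ∘ c.doubleInv)
      (fderivWithin ℝ (v ∘ c.doubleInv) (fold ⁻¹' c.chart.target) z) z := fun z hz => by
    have := (hv.contDiffAt (hO.mem_nhds hz)).differentiableAt one_ne_zero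
    rw [fderivWithin_of_isOpen hO hz]
    exact this.hasFDerivAt
  have h2 : HasFDerivAt (fun y => (v ∘ c.doubleInv) (reflect d y)) _ y :=
    (hd _ (reflect_mem_preimage_fold hy)).comp y (reflectL d).hasFDerivAt
  have h3 := (hd y (subset_preimage_fold hy)).add (h2.const_mul σ)
  have h4 := h3.hasFDerivWithinAt (s := c.chart.target)
  simp only [grad]
  rw [fderivWithin_congr (trace_chart_symm σ v) (trace_chart_symm σ v hy)]
  have h5 := h4.fderivWithin (c.isHalfOpen_target.uniqueDiffOn y hy)
  rw [show (fun y => (v ∘ c.doubleInv) y + σ * (v ∘ c.doubleInv) (reflect d y)) =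
    (v ∘ c.doubleInv) + fun y => σ * (v ∘ c.doubleInv) (reflect d y) from rfl, h5]
  simp only [add_apply, smul_apply, ContinuousLinearMap.comp_apply, reflectL_apply, reflect_single,
    map_smul, smul_eq_mul]

variable {w : Euc d → Fin d → ℝ}

/-- The energy of an even or odd extension against a test function. -/
theorem integral_energy_extendSign (hc : c.IsNormal g) (σ : ℝ)
    (hw : ∀ i, IsLocL2 c.chart.target fun y => w y i) {v : Double d M → ℝ} {K : Set (Euc d)}
    (hK : IsCompact K) (hKT : K ⊆ fold ⁻¹' c.chart.target)
    (hv : ContDiffOn ℝ 1 (v ∘ c.doubleInv) (fold ⁻¹' c.chart.target))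
    (hv0 : ∀ y ∈ fold ⁻¹' c.chart.target, y ∉ K → (v ∘ c.doubleInv) y = 0) :
    ∫ y in fold ⁻¹' c.chart.target, (((c.doubleMetricCoeff g y)⁻¹ *ᵥ
        fun i => extendSign (σ * reflSign i) (fun y => w y i) y) ⬝ᵥ
          grad (v ∘ c.doubleInv) (fold ⁻¹' c.chart.target) y) * c.doubleDensityCoeff κ y =
      ∫ y in c.chart.target, (((c.metricCoeff g y)⁻¹ *ᵥ w y) ⬝ᵥ
        grad (trace σ v ∘ c.chart.symm) c.chart.target y) * c.densityCoeff κ y := by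
  have hT := c.isHalfOpen_target
  have hO := hT.isOpen_preimage_fold
  set V' := grad (v ∘ c.doubleInv) (fold ⁻¹' c.chart.target)
  have hV'c : ∀ i, ContinuousOn (fun y => V' y i) (fold ⁻¹' c.chart.target) := fun i =>
    (hv.continuousOn_fderivWithin hO.uniqueDiffOn le_rfl).clm_apply continuousOn_const
  -- Everything but the gradient `w` is collected in continuous functions vanishing off `K`, to
  -- which the folding identity applies one component at a time.
  set G : Fin d → Euc d → ℝ := fun j y =>
    c.doubleDensityCoeff κ y * ∑ i, (c.doubleMetricCoeff g y)⁻¹ i j * V' y i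
  have hG : ∀ j, ContinuousOn (G j) (fold ⁻¹' c.chart.target) := fun j =>
    (doubleDensityCoeff_lipschitz κ).continuousOn.mul (continuousOn_finsetSum _ fun i _ =>
      (continuousOn_inv_doubleMetricCoeff hc i j).mul (hV'c i))
  have hG0 : ∀ j, ∀ y ∈ fold ⁻¹' c.chart.target, y ∉ K → G j y = 0 := fun j y hy hyK => by
    simp only [G, V', grad_eq_zero_of_notMem hK.isClosed hv0 hy hyK, mul_zero,
      Finset.sum_const_zero]
  have h1 := fun j => integral_preimage_fold_extendSign hT (hw j) (σ * reflSign j) hK hKT (hG j)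
    (hG0 j)
  have h2 : ∀ j, IntegrableOn (fun y => extendSign (σ * reflSign j) (fun y => w y j) y * G j y)
      (fold ⁻¹' c.chart.target) := fun j =>
    integrableOn_mul_of_support hO.measurableSet hK
      (((hw j).extendSign _).integrableOn hK hKT) ((hG j).mono hKT) (hG0 j)
  calc _ = ∫ y in fold ⁻¹' c.chart.target,
        ∑ j, extendSign (σ * reflSign j) (fun y => w y j) y * G j y := by
        refine integral_congr_ae (Eventually.of_forall fun y => ?_)
        simp only [G, Matrix.mulVec, dotProduct, Finset.sum_mul, Finset.mul_sum]
        rw [Finset.sum_comm]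
        exact Finset.sum_congr rfl fun j _ => Finset.sum_congr rfl fun i _ => by ring
    _ = ∫ y in c.chart.target, ∑ j, w y j * (G j y + σ * reflSign j * G j (reflect d y)) := by
        rw [integral_finsetSum _ fun j _ => h2 j, integral_finsetSum _ fun j _ => (h1 j).1]
        exact Finset.sum_congr rfl fun j _ => (h1 j).2
    -- At the mirror point the inverse metric contributes `reflSign i * reflSign j`. The factor with
    -- `j` cancels that of the extended gradient, and the factor with `i` is that of the gradient of
    -- the folded test function.
    _ = _ := by
        refine setIntegral_congr_fun hT.measurableSet fun y hy => ?_
        have h0 : 0 ≤ y 0 := hT.subset hy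
        simp only [G, Matrix.mulVec, dotProduct, Finset.sum_mul, Finset.mul_sum,
          grad_trace_chart_symm σ hv hy, doubleDensityCoeff, fold_reflect, fold_of_nonneg h0,
          doubleMetricCoeff_of_nonneg h0, inv_doubleMetricCoeff_reflect hc hy,
          ← Finset.sum_add_distrib]
        rw [Finset.sum_comm]
        refine Finset.sum_congr rfl fun i _ => Finset.sum_congr rfl fun j _ => ?_
        linear_combination (w y j * σ * reflSign i * c.densityCoeff κ y *
          (c.metricCoeff g y)⁻¹ i j * V' (reflect d y) i) * reflSign_mul_self j

end W2Chart

variable (g : LipschitzMetric (𝓡∂ d) M) (κ : LipschitzDensity (𝓡∂ d) M)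

open Classical in
/-- The gradient of an even or odd extension in the charts of the double. -/
noncomputable def doubleGrad (σ : ℝ)
    (w : OpenPartialHomeomorph M (EuclideanHalfSpace d) → Euc d → Fin d → ℝ)
    (Φ : OpenPartialHomeomorph (Double d M) (Euc d)) (y : Euc d) (i : Fin d) : ℝ :=
  if h : ∃ c : W2Chart d M, c.IsNormal g ∧ c.doubleChart = Φ then
    extendSign (σ * reflSign i) (fun y => h.choose.localGrad w y i) y
  else 0

/-- Membership in the atlas unfolds to the existence statement used by `doubleGrad`, so the same `c`
also represents the gradient. -/
theorem exists_doubleChart_eq_and_doubleGrad :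
    letI := doubleChartedSpace g
    ∀ Φ ∈ atlas (Euc d) (Double d M), ∃ c : W2Chart d M, c.IsNormal g ∧ c.doubleChart = Φ ∧
      (doubleMetric g).coeff Φ = c.doubleMetricCoeff g ∧
      (∀ κ, (doubleDensity g κ).coeff Φ = c.doubleDensityCoeff κ) ∧
      ∀ σ w, doubleGrad g σ w Φ =
        fun y i => extendSign (σ * reflSign i) (fun y => c.localGrad w y i) y :=
  fun _ hΦ => ⟨hΦ.choose, hΦ.choose_spec.1, hΦ.choose_spec.2, dif_pos hΦ, fun _ => dif_pos hΦ,
    fun _ _ => funext₂ fun _ _ => dif_pos hΦ⟩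

variable {g κ} {u : M → ℝ}
  {w : OpenPartialHomeomorph M (EuclideanHalfSpace d) → Euc d → Fin d → ℝ} {σ : ℝ}

/-- In a normal chart around a point near which `u` is not almost everywhere zero, the upper half of
the reflected chart shows `u` itself. -/
theorem isNonzeroAE_doubleLift (h : IsNonzeroAE (𝓡∂ d) u) (σ : ℝ) :
    letI := doubleChartedSpace g
    IsNonzeroAE (𝓡 d) (doubleLift σ u : Double d M → ℝ) := by
  let := doubleChartedSpace g
  obtain ⟨p, hp⟩ := h.exists_forall_chart
  obtain ⟨c, hpc, hc⟩ := exists_isNormal g p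
  refine ⟨c.doubleChart, ⟨c, hc, rfl⟩, fun hae => hp c hpc ?_⟩
  rw [c.doubleChart_extend_target] at hae
  filter_upwards [ae_restrict_of_ae_restrict_of_subset W2Chart.subset_preimage_fold hae,
    ae_restrict_mem c.isHalfOpen_target.measurableSet] with y hy hyT
  have h1 : doubleLift σ u (c.doubleInv y) = 0 := hy
  rwa [c.doubleLift_doubleInv σ u (W2Chart.subset_preimage_fold hyT),
    extendSign_of_nonneg (c.isHalfOpen_target.subset hyT)] at h1

/-- For `σ = 1` each test is either tangential or vanishes on the hyperplane, and a cutoff suffices.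
For other signs the extension jumps unless the trace is zero, which is why `IsH10` is required. -/
theorem isH1_doubleLift (h : IsH1 (𝓡∂ d) u w) (hσ : σ ≠ 1 → IsH10 (𝓡∂ d) u w) :
    letI := doubleChartedSpace g
    IsH1 (𝓡 d) (doubleLift σ u : Double d M → ℝ) (doubleGrad g σ w) := by
  let := doubleChartedSpace g
  have key : ∀ c : W2Chart d M, EqOn (doubleLift σ u ∘ (c.doubleChart.extend (𝓡 d)).symm)
      (extendSign σ (u ∘ c.chart.symm)) (fold ⁻¹' c.chart.target) := fun c y hy =>
    c.doubleLift_doubleInv σ u hy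
  refine ⟨fun Φ hΦ => ?_, fun Φ hΦ i => ?_, fun Φ hΦ => ?_⟩
  · obtain ⟨c, hc, rfl⟩ := hΦ
    rw [c.doubleChart_extend_target]
    refine ((c.isLocL2_comp_symm h).extendSign σ).congr ?_
    filter_upwards [ae_restrict_mem c.isHalfOpen_target.isOpen_preimage_fold.measurableSet] with y hy
    exact (key c hy).symm
  · obtain ⟨c, hc, rfl, -, -, hgr⟩ := exists_doubleChart_eq_and_doubleGrad g Φ hΦ
    rw [c.doubleChart_extend_target, hgr]
    exact (c.isLocL2_localGrad h i).extendSign _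
  · obtain ⟨c, hc, rfl, -, -, hgr⟩ := exists_doubleChart_eq_and_doubleGrad g Φ hΦ
    rw [c.doubleChart_extend_target, hgr]
    refine (isWeakGradient_extendSign c.isHalfOpen_target (c.isLocL2_comp_symm h)
      (c.isLocL2_localGrad h) fun η hη hηc hηT i hi => ?_).congr
      c.isHalfOpen_target.isOpen_preimage_fold.measurableSet (key c) fun _ _ => rfl
    by_cases h1 : σ = 1
    · refine (c.isWeakGradient_localGrad h).integral_mul_fderiv_eq c.isHalfOpen_target
        (c.isLocL2_comp_symm h) (c.isLocL2_localGrad h) hη hηc hηT i ?_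
      by_cases hi0 : i = 0
      · exact Or.inr (hi h1 hi0)
      · exact Or.inl hi0
    · exact c.integral_mul_fderiv_eq_of_isH10 (hσ h1) hη hηc hηT i

theorem contMDiff_trace (σ : ℝ) {v : Double d M → ℝ} :
    letI := doubleChartedSpace g
    ContMDiff (𝓡 d) 𝓘(ℝ, ℝ) 1 v → ContMDiff (𝓡∂ d) 𝓘(ℝ, ℝ) 1 (trace σ v : M → ℝ) := by
  let := doubleChartedSpace g
  intro hv
  have := isW2InftyManifold_double g
  have := IsW2InftyManifold.isManifold (𝓡∂ d) M
  have := IsW2InftyManifold.isManifold (𝓡 d) (Double d M)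
  have h : ∀ ε : ℤˣ, ContMDiff (𝓡∂ d) 𝓘(ℝ, ℝ) 1 (v ∘ incl d ε : M → ℝ) := fun ε =>
    hv.comp_of_readMap (continuous_incl ε) fun φ hφ ψ hψ =>
      ((isIsometricEmbedding_incl g ε).regular φ hφ ψ hψ).1
  exact (h 1).add (contMDiff_const.mul (h (-1)))

omit [IsW2InftyManifold (𝓡∂ d) M] in
theorem tsupport_trace_subset (σ : ℝ) {v : Double d M → ℝ} {s : Set M}
    (hv : tsupport v ⊆ proj ⁻¹' s) : tsupport (trace σ v : M → ℝ) ⊆ s := by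
  have hcl : IsClosed ((incl d 1 ⁻¹' tsupport v ∪ incl d (-1) ⁻¹' tsupport v : Set M)) :=
    ((isClosed_tsupport v).preimage (continuous_incl 1)).union
      ((isClosed_tsupport v).preimage (continuous_incl (-1)))
  refine (closure_minimal (fun x hx => ?_) hcl).trans (union_subset ?_ ?_)
  · by_contra h
    rw [mem_union, not_or, mem_preimage, mem_preimage] at h
    refine hx ?_
    simp only [Double.trace, image_eq_zero_of_notMem_tsupport h.1,
      image_eq_zero_of_notMem_tsupport h.2, mul_zero, add_zero]
  · exact fun x hx => hv hx
  · exact fun x hx => hv hx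

/-- The even or odd extension of a function satisfying the weak equation is an eigenfunction. -/
theorem isEigenfunction_doubleLift [CompactSpace M] {μ : ℝ} (hne : IsNonzeroAE (𝓡∂ d) u)
    (h : IsH1 (𝓡∂ d) u w) (hσ : σ ≠ 1 → IsH10 (𝓡∂ d) u w)
    (heq : ∀ φ ∈ atlas (EuclideanHalfSpace d) M, ∀ q : M → ℝ, ContMDiff (𝓡∂ d) 𝓘(ℝ, ℝ) 1 q →
      tsupport q ⊆ φ.source → (σ = -1 → ∀ x ∈ (𝓡∂ d).boundary M, q x = 0) →
      WeakEigenEquation g κ μ u w φ q) :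
    letI := doubleChartedSpace g
    IsEigenfunction (doubleMetric g) (doubleDensity g κ) μ (doubleLift σ u) := by
  let := doubleChartedSpace g
  refine ⟨isNonzeroAE_doubleLift hne σ, doubleGrad g σ w, isH1_doubleLift h hσ,
    fun Φ hΦ v hv hvs => ?_⟩
  have := isW2InftyManifold_double g
  have := IsW2InftyManifold.isManifold (𝓡 d) (Double d M)
  obtain ⟨c, hc, rfl, hg, hκ, hgr⟩ := exists_doubleChart_eq_and_doubleGrad g Φ hΦ
  have hq := contMDiff_trace σ hv
  have hqs : tsupport (trace σ v : M → ℝ) ⊆ c.chart.source := tsupport_trace_subset σ hvs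
  -- Testing on the double against `v` amounts to testing on `M` against `trace σ v`. For `σ = -1`
  -- the latter vanishes on the boundary, where the two copies coincide.
  have hloc := (c.weakEigenEquation_base_iff g κ hq hqs).1
    (heq c.base c.base_mem _ hq (hqs.trans c.source_subset) fun hσ x hx => by
      rw [Double.trace, incl_eq_of_mem_boundary hx 1 (-1), hσ]
      ring)
  have hV : ContDiffOn ℝ 1 (v ∘ c.doubleInv) (fold ⁻¹' c.chart.target) := by
    have := hv.contDiffOn_comp_symm hΦ
    rwa [c.doubleChart_extend_target] at this
  set K := c.doubleChart '' tsupport v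
  have hK : IsCompact K := (isClosed_tsupport v).isCompact.image_of_continuousOn
    (c.doubleChart.continuousOn.mono hvs)
  have hKT : K ⊆ fold ⁻¹' c.chart.target := image_subset_iff.2 fun p hp =>
    c.doubleChart.map_source (hvs hp)
  have hV0 : ∀ y ∈ fold ⁻¹' c.chart.target, y ∉ K → (v ∘ c.doubleInv) y = 0 := fun y hy hyK =>
    image_eq_zero_of_notMem_tsupport (f := v) fun h' => hyK ⟨_, h', c.doubleChart.right_inv hy⟩
  have e1 := W2Chart.integral_energy_extendSign κ hc σ (c.isLocL2_localGrad h) hK hKT hV hV0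
  have e2 := (integral_preimage_fold_extendSign c.isHalfOpen_target (c.isLocL2_comp_symm h) σ hK hKT
    (g := fun y => (v ∘ c.doubleInv) y * c.doubleDensityCoeff κ y)
    (hV.continuousOn.mul (W2Chart.doubleDensityCoeff_lipschitz κ).continuousOn)
    fun y hy hyK => by rw [hV0 y hy hyK, zero_mul]).2
  have hO := c.isHalfOpen_target.isOpen_preimage_fold
  rw [WeakEigenEquation, c.doubleChart_extend_target, hg, hκ, hgr]
  refine e1.trans (hloc.trans ?_)
  congr 1
  calc _ = ∫ y in c.chart.target, (u ∘ c.chart.symm) y * ((v ∘ c.doubleInv) y *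
        c.doubleDensityCoeff κ y + σ * ((v ∘ c.doubleInv) (reflect d y) *
          c.doubleDensityCoeff κ (reflect d y))) := by
        refine setIntegral_congr_fun c.isHalfOpen_target.measurableSet fun y hy => ?_
        have h1 := W2Chart.trace_chart_symm σ v hy
        have h0 : 0 ≤ y 0 := c.isHalfOpen_target.subset hy
        simp only [Function.comp_apply] at h1 ⊢
        simp only [h1, W2Chart.doubleDensityCoeff, fold_reflect, fold_of_nonneg h0]
        ring
    _ = _ := by
        rw [← e2]
        refine setIntegral_congr_fun hO.measurableSet fun y hy => ?_
        have h1 : doubleLift σ u ((c.doubleChart.extend (𝓡 d)).symm y) = _ :=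
          c.doubleLift_doubleInv σ u hy
        simp only [h1, mul_assoc]
        rfl

end DoubleEigenfunction

theorem mainTheorem5 {d : ℕ} [NeZero d] {M : Type*} [TopologicalSpace M] [T2Space M]
    [CompactSpace M] [ChartedSpace (EuclideanHalfSpace d) M] [IsW2InftyManifold (𝓡∂ d) M]
    (g : LipschitzMetric (𝓡∂ d) M) (κ : LipschitzDensity (𝓡∂ d) M) :
    T2Space (Double d M) ∧
    ∃ _ : ChartedSpace (Euc d) (Double d M),
      IsW2InftyManifold (𝓡 d) (Double d M) ∧
      ∃ (g' : LipschitzMetric (𝓡 d) (Double d M)) (κ' : LipschitzDensity (𝓡 d) (Double d M)),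
        (∀ ε : ℤˣ, IsIsometricEmbedding g g' (Double.incl d ε : M → Double d M)) ∧
        (∀ ε : ℤˣ, IsInducedDensity κ κ' (Double.incl d ε : M → Double d M)) ∧
        (∀ (lam : ℝ) (e : M → ℝ), IsDirichletEigenfunction g κ (lam ^ 2) e →
          ∃ e' : Double d M → ℝ, IsEigenfunction g' κ' (lam ^ 2) e' ∧
            (∀ x : M, e' (Double.incl d 1 x) = e x) ∧
            (∀ x : M, x ∉ (𝓡∂ d).boundary M → e' (Double.incl d (-1) x) = -e x)) ∧
        (∀ (lam : ℝ) (e : M → ℝ), IsNeumannEigenfunction g κ (lam ^ 2) e →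
          ∃ e' : Double d M → ℝ, IsEigenfunction g' κ' (lam ^ 2) e' ∧
            (∀ x : M, e' (Double.incl d 1 x) = e x) ∧
            (∀ x : M, e' (Double.incl d (-1) x) = e x)) := by
  let := doubleChartedSpace g
  refine ⟨Double.t2Space, doubleChartedSpace g, isW2InftyManifold_double g, doubleMetric g,
    doubleDensity g κ, isIsometricEmbedding_incl g, isInducedDensity_incl g κ, ?_, ?_⟩
  · rintro lam e ⟨hne, w, hw, heq⟩
    -- The Dirichlet equation is assumed only for test functions supported in the interior, so it is
    -- first extended to those vanishing on the boundary.
    refine ⟨doubleLift (-1) e, isEigenfunction_doubleLift hne hw.1 (fun _ => hw)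
      fun φ hφ q hq hqs hb => weakEigenEquation_of_eq_zero_on_boundary hw.1 hφ (heq φ hφ) hq hqs
        (hb rfl), doubleLift_incl_one _ e, fun x hx => ?_⟩
    rw [doubleLift_incl_neg_one _ _ hx, neg_one_mul]
  · rintro lam e ⟨hne, w, hw, heq⟩
    exact ⟨doubleLift 1 e, isEigenfunction_doubleLift hne hw (fun h => absurd rfl h)
      fun φ hφ q hq hqs _ => heq φ hφ q hq hqs, doubleLift_incl_one _ e, fun x => doubleLift_one e _⟩
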